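/- Let $\mathbb F_2$ be the field with two elements and let $m\ge 1$. Every Boolean function $f:\mathbb F_2^m\to\mathbb F_2$ has a unique algebraic normal form $f(x)=\sum_{S\subseteq\{1,\dots,m\}}a_S\prod_{s\in S}x_s$ with $a_S\in\mathbb F_2$; its degree $\deg f$ is the largest $|S|$ with $a_S=1$, and the null function has degree $0$. For a linear subspace $V$ of $\mathbb F_2^m$ and $a\in\mathbb F_2^m$, let $f_{a,V}:V\to\mathbb F_2$, $v\mapsto f(a+v)$, whose degree is taken in the coordinates of any basis of $V$. For $0\le r\le m$ put $$\deg_r(f)=\min\{\deg(f_{a,V}) : V\le\mathbb F_2^m,\ \dim V=r,\ a\in\mathbb F_2^m\},$$ and for $0\le k\le m$ let $D_r^\dagger(k,m)$ be the maximum of $\deg_r(f)$ over all $f:\mathbb F_2^m\to\mathbb F_2$ with $\deg f=k$. The function $f$ is normal if $f_{a,V}$ is constant for some $a$ and some $V$ of dimension $\lceil m/2\rceil$, and weakly normal if $f_{a,V}$ is affine and not constant for some $a$ and some $V$ of dimension $\lceil m/2\rceil$. The values of $D_r^\dagger(k,7)$ for $2\le r\le 6$ and $1\le k\le 3$ are $$\begin{array}{c|ccc}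 r\backslash k & 1 & 2 & 3\\ \hline 6 & 0 & 2 & 3\\ 5 & 0 & 2 & 3\\ 4 & 0 & 1 & 1\\ 3 & 0 & 0 & 0\\ 2 & 0 & 0 & 0\end{array}$$ Moreover, every Boolean function $f$ in $7$ variables of degree at most $3$ is normal or weakly normal, and satisfies $\deg_4(f)\le 1$. -/

import Mathlib

namespace BoolFun

/-- The monomial `X_S = ∏ s ∈ S, x_s`, as a Boolean function. -/
def monomial {m : ℕ} (S : Finset (Fin m)) (x : Fin m → ZMod 2) : ZMod 2 :=
  ∏ i ∈ S, x i

/-- The coefficient `a_S` of the algebraic normal form of `f`: the sum of `f` over the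
indicator vectors of the subsets of `S` (see `eq_sum_anfCoeff` and `anfCoeff_unique`). -/
def anfCoeff {m : ℕ} (f : (Fin m → ZMod 2) → ZMod 2) (S : Finset (Fin m)) : ZMod 2 :=
  ∑ T ∈ S.powerset, f (fun i => if i ∈ T then 1 else 0)

/-- The degree of a Boolean function: the largest size of `S` with `a_S ≠ 0`; it is `0` for the
null function. -/
def degree {m : ℕ} (f : (Fin m → ZMod 2) → ZMod 2) : ℕ :=
  (Finset.univ.filter fun S : Finset (Fin m) => anfCoeff f S ≠ 0).sup Finset.card

theorem monomial_indicator {m : ℕ} (S X : Finset (Fin m)) :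
    monomial S (fun i => if i ∈ X then 1 else 0) = if S ⊆ X then 1 else 0 := by
  unfold monomial
  split_ifs with h
  · exact Finset.prod_eq_one fun i hi => if_pos (h hi)
  · obtain ⟨i, hi, hX⟩ := Finset.not_subset.1 h
    exact Finset.prod_eq_zero hi (if_neg hX)

theorem eq_indicator {m : ℕ} (x : Fin m → ZMod 2) :
    x = fun i => if i ∈ Finset.univ.filter (fun i => x i = 1) then 1 else 0 := by
  funext i
  have : ∀ a : ZMod 2, a = if a = 1 then 1 else 0 := by decide
  simpa using this (x i)

/-- Every Boolean function is represented by its algebraic normal form. -/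
theorem eq_sum_anfCoeff {m : ℕ} (f : (Fin m → ZMod 2) → ZMod 2) (x : Fin m → ZMod 2) :
    f x = ∑ S, anfCoeff f S * monomial S x := by
  rw [eq_indicator x]
  generalize Finset.univ.filter (fun i => x i = 1) = X
  simp only [monomial_indicator, mul_ite, mul_one, mul_zero]
  rw [← Finset.sum_filter]
  have h1 : ∀ S : Finset (Fin m), anfCoeff f S
      = ∑ T : Finset (Fin m), if T ⊆ S then f (fun i => if i ∈ T then 1 else 0) else 0 := by
    intro S
    rw [anfCoeff, ← Finset.sum_filter]
    refine Finset.sum_congr ?_ fun _ _ => rfl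
    ext T
    simp
  simp only [h1]
  rw [Finset.sum_comm]
  have h2 : ∀ T : Finset (Fin m), T ≠ X →
      (∑ S ∈ Finset.univ.filter (fun S => S ⊆ X),
        if T ⊆ S then f (fun i => if i ∈ T then 1 else 0) else 0) = 0 := by
    intro T hT
    rw [← Finset.sum_filter, Finset.sum_const]
    by_cases hTX : T ⊆ X
    · have : (Finset.univ.filter (fun S => S ⊆ X)).filter (fun S => T ⊆ S)
          = Finset.Icc T X := by
        ext S
        simp [and_comm]
      rw [this, Finset.card_Icc_finset hTX]
      have hlt : T.card < X.card := Finset.card_lt_card (hTX.ssubset_of_ne hT)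
      obtain ⟨k, hk⟩ : ∃ k, X.card - T.card = k + 1 := ⟨X.card - T.card - 1, by omega⟩
      rw [hk, pow_succ, mul_smul, two_nsmul, CharTwo.add_self_eq_zero, smul_zero]
    · have : (Finset.univ.filter (fun S => S ⊆ X)).filter (fun S => T ⊆ S) = ∅ := by
        ext S
        simp only [Finset.mem_filter, Finset.mem_univ, true_and, Finset.notMem_empty, iff_false]
        exact fun h => hTX (h.2.trans h.1)
      rw [this]
      simp
  rw [Finset.sum_eq_single X (fun T _ hT => h2 T hT) (fun h => absurd (Finset.mem_univ _) h)]
  rw [Finset.sum_eq_single X]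
  · simp
  · intro S hS hSX
    rw [if_neg]
    exact fun h => hSX (Finset.Subset.antisymm (by simpa using hS) h)
  · simp

/-- The coefficients of the algebraic normal form are unique. -/
theorem anfCoeff_unique {m : ℕ} (f : (Fin m → ZMod 2) → ZMod 2) (a : Finset (Fin m) → ZMod 2)
    (h : ∀ x, f x = ∑ S, a S * monomial S x) : a = anfCoeff f := by
  let E : (Finset (Fin m) → ZMod 2) → ((Fin m → ZMod 2) → ZMod 2) :=
    fun a x => ∑ S, a S * monomial S x
  have hs : Function.Surjective E := fun g => ⟨anfCoeff g, funext fun x => (eq_sum_anfCoeff g x).symm⟩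
  have hb : Function.Bijective E := by
    refine (Fintype.bijective_iff_surjective_and_card E).2 ⟨hs, ?_⟩
    simp [ZMod.card]
  refine hb.1 (funext fun x => ?_)
  exact (h x).symm.trans (eq_sum_anfCoeff f x)

theorem degree_le_card {m : ℕ} (f : (Fin m → ZMod 2) → ZMod 2) : degree f ≤ m :=
  Finset.sup_le fun S _ => by simpa using S.card_le_univ

theorem anfCoeff_monomial {m : ℕ} (S : Finset (Fin m)) :
    anfCoeff (monomial S) = fun T => if T = S then 1 else 0 := by
  refine (anfCoeff_unique _ _ fun x => ?_).symm
  simp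

theorem degree_monomial {m : ℕ} (S : Finset (Fin m)) : degree (monomial S) = S.card := by
  unfold degree
  rw [anfCoeff_monomial]
  have : (Finset.univ.filter fun T : Finset (Fin m) => (if T = S then (1 : ZMod 2) else 0) ≠ 0)
      = {S} := by
    ext T
    simp
  rw [this, Finset.sup_singleton]

/-- The degree is at most `d` exactly when `f` is a combination of monomials of degree at most
`d`. -/
theorem degree_le_iff {m : ℕ} (f : (Fin m → ZMod 2) → ZMod 2) (d : ℕ) :
    degree f ≤ d ↔
      f ∈ Submodule.span (ZMod 2) {g | ∃ S : Finset (Fin m), S.card ≤ d ∧ g = monomial S} := by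
  constructor
  · intro h
    have hf : f = ∑ S, anfCoeff f S • monomial S := by
      funext x
      rw [eq_sum_anfCoeff f x]
      simp
    rw [hf]
    refine Submodule.sum_mem _ fun S _ => ?_
    by_cases hS : anfCoeff f S = 0
    · simp [hS]
    · refine Submodule.smul_mem _ _ (Submodule.subset_span ⟨S, ?_, rfl⟩)
      refine le_trans ?_ h
      exact Finset.le_sup (f := Finset.card) (Finset.mem_filter.2 ⟨Finset.mem_univ S, hS⟩)
  · intro h
    have key : ∀ T : Finset (Fin m), d < T.card → anfCoeff f T = 0 := by
      intro T hT
      induction h using Submodule.span_induction with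
      | mem g hg =>
        obtain ⟨S, hS, rfl⟩ := hg
        rw [anfCoeff_monomial]
        refine if_neg ?_
        rintro rfl
        omega
      | zero => simp [anfCoeff]
      | add g h _ _ hg hh =>
        have : anfCoeff (g + h) T = anfCoeff g T + anfCoeff h T := by
          simp [anfCoeff, Finset.sum_add_distrib]
        rw [this, hg, hh, add_zero]
      | smul c g _ hg =>
        have : anfCoeff (c • g) T = c * anfCoeff g T := by
          simp [anfCoeff, Finset.mul_sum]
        rw [this, hg, mul_zero]
    refine Finset.sup_le fun T hT => ?_
    by_contra hlt
    exact (Finset.mem_filter.1 hT).2 (key T (by omega))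

/-- A linear change of variables does not raise the degree. -/
theorem degree_comp_le {m n : ℕ} (f : (Fin m → ZMod 2) → ZMod 2)
    (L : (Fin n → ZMod 2) →ₗ[ZMod 2] (Fin m → ZMod 2)) :
    degree (fun x => f (L x)) ≤ degree f := by
  have hmono : ∀ S : Finset (Fin m), (fun x => monomial S (L x)) ∈
      Submodule.span (ZMod 2)
        {g | ∃ T : Finset (Fin n), T.card ≤ S.card ∧ g = monomial T} := by
    intro S
    induction S using Finset.induction_on with
    | empty =>
      refine Submodule.subset_span ⟨∅, le_rfl, ?_⟩
      funext x
      simp [monomial]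
    | insert i S hi ih =>
      have h1 : (fun x => monomial (insert i S) (L x))
          = ∑ j, L (Pi.single j 1) i • (fun x => x j * monomial S (L x)) := by
        funext x
        have hx : L x i = ∑ j, L (Pi.single j 1) i * x j := by
          conv_lhs => rw [← Finset.univ_sum_single x]
          rw [map_sum, Finset.sum_apply]
          refine Finset.sum_congr rfl fun j _ => ?_
          have : (Pi.single j (x j) : Fin n → ZMod 2) = x j • Pi.single j 1 := by
            rw [← Pi.single_smul, smul_eq_mul, mul_one]
          rw [this, map_smul, Pi.smul_apply, smul_eq_mul, mul_comm]
        simp only [monomial, Finset.prod_insert hi, hx, Finset.sum_apply, Pi.smul_apply,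
          smul_eq_mul, Finset.sum_mul, mul_assoc]
      rw [h1]
      refine Submodule.sum_mem _ fun j _ => Submodule.smul_mem _ _ ?_
      rw [Finset.card_insert_of_notMem hi]
      let M : ((Fin n → ZMod 2) → ZMod 2) →ₗ[ZMod 2] ((Fin n → ZMod 2) → ZMod 2) :=
        LinearMap.mulLeft (ZMod 2) (fun x : Fin n → ZMod 2 => x j)
      have h2 : (fun x => x j * monomial S (L x)) = M (fun x => monomial S (L x)) := rfl
      rw [h2]
      have h3 := Submodule.mem_map_of_mem (f := M) ih
      rw [Submodule.map_span] at h3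
      refine Submodule.span_mono ?_ h3
      rintro _ ⟨_, ⟨T, hT, rfl⟩, rfl⟩
      refine ⟨insert j T, (Finset.card_insert_le _ _).trans (by omega), ?_⟩
      funext x
      change x j * monomial T x = monomial (insert j T) x
      by_cases hj : j ∈ T
      · rw [Finset.insert_eq_of_mem hj]
        unfold monomial
        rw [← Finset.mul_prod_erase T x hj, ← mul_assoc]
        congr 1
        have : ∀ a : ZMod 2, a * a = a := by decide
        exact this _
      · simp [monomial, Finset.prod_insert hj]
  rw [degree_le_iff]
  have hf := (degree_le_iff f (degree f)).1 le_rfl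
  have h3 := Submodule.mem_map_of_mem (f := LinearMap.funLeft (ZMod 2) (ZMod 2) L) hf
  rw [Submodule.map_span] at h3
  refine (Submodule.span_le.2 ?_) h3
  rintro _ ⟨_, ⟨S, hS, rfl⟩, rfl⟩
  refine Submodule.span_mono ?_ (hmono S)
  rintro g ⟨T, hT, rfl⟩
  exact ⟨T, hT.trans hS, rfl⟩

/-- The degree of a Boolean function `g : V → 𝔽₂` on a linear subspace `V` of `𝔽₂ᵐ`: the degree
of its algebraic normal form in the coordinates of a basis of `V`. By `degreeOn_eq` the choice
of the basis does not matter. -/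
noncomputable def degreeOn {m : ℕ} (V : Submodule (ZMod 2) (Fin m → ZMod 2))
    (g : V → ZMod 2) : ℕ :=
  degree fun x : Fin (Module.finrank (ZMod 2) V) → ZMod 2 =>
    g ((Module.finBasis (ZMod 2) V).equivFun.symm x)

theorem degreeOn_eq {m n : ℕ} (V : Submodule (ZMod 2) (Fin m → ZMod 2)) (g : V → ZMod 2)
    (b : Module.Basis (Fin n) (ZMod 2) V) :
    degreeOn V g = degree fun x : Fin n → ZMod 2 => g (b.equivFun.symm x) := by
  set c := Module.finBasis (ZMod 2) V
  apply le_antisymm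
  · have := degree_comp_le (fun x : Fin n → ZMod 2 => g (b.equivFun.symm x))
      (c.equivFun.symm.trans b.equivFun).toLinearMap
    simpa [degreeOn] using this
  · have := degree_comp_le (fun x => g (c.equivFun.symm x))
      (b.equivFun.symm.trans c.equivFun).toLinearMap
    simpa [degreeOn] using this

/-- The relative degree of `f` with respect to the affine space `a + V`: the degree of
`f_{a,V} : v ∈ V ↦ f (a + v)`. -/
noncomputable def relDegree {m : ℕ} (f : (Fin m → ZMod 2) → ZMod 2) (a : Fin m → ZMod 2)
    (V : Submodule (ZMod 2) (Fin m → ZMod 2)) : ℕ :=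
  degreeOn V fun v => f (a + v)

/-- The `r`-degree `deg_r f`: the minimal relative degree of `f` over all affine spaces of
dimension `r` (a minimum over a nonempty set when `r ≤ m`, see `rDegree_isLeast`). -/
noncomputable def rDegree {m : ℕ} (r : ℕ) (f : (Fin m → ZMod 2) → ZMod 2) : ℕ :=
  sInf {d | ∃ (a : Fin m → ZMod 2) (V : Submodule (ZMod 2) (Fin m → ZMod 2)),
    Module.finrank (ZMod 2) V = r ∧ relDegree f a V = d}

theorem rDegree_isLeast {m r : ℕ} (hr : r ≤ m) (f : (Fin m → ZMod 2) → ZMod 2) :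
    IsLeast {d | ∃ (a : Fin m → ZMod 2) (V : Submodule (ZMod 2) (Fin m → ZMod 2)),
      Module.finrank (ZMod 2) V = r ∧ relDegree f a V = d} (rDegree r f) := by
  have hne : {d | ∃ (a : Fin m → ZMod 2) (V : Submodule (ZMod 2) (Fin m → ZMod 2)),
      Module.finrank (ZMod 2) V = r ∧ relDegree f a V = d}.Nonempty := by
    have hli : LinearIndependent (ZMod 2)
        (fun i : Fin r => Pi.basisFun (ZMod 2) (Fin m) (Fin.castLE hr i)) :=
      (Pi.basisFun (ZMod 2) (Fin m)).linearIndependent.comp _ (Fin.castLE_injective hr)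
    have hV := finrank_span_eq_card hli
    rw [Fintype.card_fin] at hV
    exact ⟨_, 0, _, hV, rfl⟩
  exact ⟨Nat.sInf_mem hne, fun d hd => Nat.sInf_le hd⟩

/-- `D†_r(k, m)`: the maximum of `deg_r f` over the Boolean functions `f` in `m` variables of
degree equal to `k` (a maximum over a nonempty finite set when `k ≤ m`, see
`maxRDegree_isGreatest`). -/
noncomputable def maxRDegree (r k m : ℕ) : ℕ :=
  sSup {d | ∃ f : (Fin m → ZMod 2) → ZMod 2, degree f = k ∧ rDegree r f = d}

theorem maxRDegree_isGreatest (r : ℕ) {k m : ℕ} (hk : k ≤ m) :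
    IsGreatest {d | ∃ f : (Fin m → ZMod 2) → ZMod 2, degree f = k ∧ rDegree r f = d}
      (maxRDegree r k m) := by
  have hfin : {d | ∃ f : (Fin m → ZMod 2) → ZMod 2, degree f = k ∧ rDegree r f = d}.Finite := by
    refine (Set.finite_range fun f : (Fin m → ZMod 2) → ZMod 2 => rDegree r f).subset ?_
    rintro d ⟨f, _, rfl⟩
    exact ⟨f, rfl⟩
  have hne : {d | ∃ f : (Fin m → ZMod 2) → ZMod 2,
      degree f = k ∧ rDegree r f = d}.Nonempty := by
    obtain ⟨S, -, hS⟩ := Finset.exists_subset_card_eq (s := (Finset.univ : Finset (Fin m)))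
      (n := k) (by simpa using hk)
    exact ⟨_, monomial S, (degree_monomial S).trans hS, rfl⟩
  exact ⟨Nat.sSup_mem hne hfin.bddAbove, fun d hd => le_csSup hfin.bddAbove hd⟩

/-- `f` is normal: it is constant on some affine subspace `a + V` of dimension `⌈m/2⌉`. -/
def IsNormal {m : ℕ} (f : (Fin m → ZMod 2) → ZMod 2) : Prop :=
  ∃ (a : Fin m → ZMod 2) (V : Submodule (ZMod 2) (Fin m → ZMod 2)),
    Module.finrank (ZMod 2) V = ⌈(m : ℚ) / 2⌉₊ ∧ ∃ c : ZMod 2, ∀ v ∈ V, f (a + v) = c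

/-- `f` is weakly normal: it is affine and not constant on some affine subspace `a + V` of
dimension `⌈m/2⌉`. -/
def IsWeaklyNormal {m : ℕ} (f : (Fin m → ZMod 2) → ZMod 2) : Prop :=
  ∃ (a : Fin m → ZMod 2) (V : Submodule (ZMod 2) (Fin m → ZMod 2)),
    Module.finrank (ZMod 2) V = ⌈(m : ℚ) / 2⌉₊ ∧
      ∃ (φ : V →ₗ[ZMod 2] ZMod 2) (c : ZMod 2), φ ≠ 0 ∧ ∀ v : V, f (a + v) = φ v + c

end BoolFun

/-! Write D_a f(x) = f(x+a) + f(x). For f of degree at most 3 the third derivatives are constant and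
give an alternating trilinear form T (`tri`); the second derivative at 0, B (`bil`), is symmetric
and biadditive up to a defect given by T. Degree at most d means that all derivatives of order d+1
vanish, a criterion free of coordinates.

The upper bounds rest on one fact: a function of degree at most 3 in seven variables is affine on
some four-dimensional flat (`exists_affineOn_four`). This gives normality or weak normality and
deg_4 ≤ 1, and the kernel of the linear part gives a three-dimensional flat on which f is constant.
The pivot is a triple: independent e, b, c with D_b D_e f = D_c D_e f = 0.

From a triple to a flat: D_e f is invariant under b and c, hence lives on a four-dimensional
complement, where a quadratic function takes a single value on three cosets of a line. So D_e f is
constant on three parallel three-dimensional flats, and any two of these span a four-dimensional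
flat. If f is affine on a hyperplane of such a flat, adjoining e gives the required flat. Otherwise
f is quadratic with Pfaffian 1 on all three, which is impossible because the third Pfaffian is the
sum of the other two.

Existence of a triple (`hasTriple_of_degree_le`), by contradiction: character sums and the
divisibility of weights by 4 give some e for which the radical of T(e,·,·) contains a vector outside
{0, e}, and then a third independent one by parity of the rank. Without triples, this pins T down to
one explicit form in a suitable basis. At sixteen points, each with two further radical vectors, the
absence of triples restricts B; together with the constraint at one more point these restrictions
are inconsistent.

The lower bounds come from x·y + z, a cubic variant of it, and z(x·y) + x₀x₁x₂ + y₀y₁y₂, by counting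
dimensions of isotropic subspaces. -/

namespace BoolFun

/-! ### Finite differences -/

section Differences

variable {M : Type*} [AddCommGroup M]

/-- The derivative of a Boolean function in the direction `a`. -/
def diff (a : M) (f : M → ZMod 2) : M → ZMod 2 := fun x => f (x + a) + f x

/-- All derivatives of order `k` vanish. -/
def DegLT : ℕ → (M → ZMod 2) → Prop
  | 0, f => f = 0
  | k + 1, f => ∀ a, DegLT k (diff a f)

theorem diff_comm (a b : M) (f : M → ZMod 2) : diff a (diff b f) = diff b (diff a f) := by
  funext x
  simp only [diff, add_right_comm x a b]
  ring

theorem diff_add_fun (a : M) (f g : M → ZMod 2) : diff a (f + g) = diff a f + diff a g := by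
  funext x
  simp only [diff, Pi.add_apply]
  ring

/-- The defect of additivity in the direction is one derivative of higher order. It is the source
both of the trilinearity of `tri` on cubics and of the correction terms for `bil`. -/
theorem diff_add (a b : M) (f : M → ZMod 2) :
    diff (a + b) f = diff a f + diff b f + diff a (diff b f) := by
  funext x
  simp only [diff, Pi.add_apply, ← add_assoc]
  have h (t : ZMod 2) : t + t = 0 := CharTwo.add_self_eq_zero t
  linear_combination (-1) * h (f (x + a)) - h (f (x + b)) - h (f x)

theorem DegLT.zero_fun (k : ℕ) : DegLT k (0 : M → ZMod 2) := by
  induction k with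
  | zero => rfl
  | succ k ih =>
    intro a
    have : diff a (0 : M → ZMod 2) = 0 := by funext x; simp [diff]
    rwa [this]

theorem DegLT.add {k : ℕ} {f g : M → ZMod 2} (hf : DegLT k f) (hg : DegLT k g) :
    DegLT k (f + g) := by
  induction k generalizing f g with
  | zero => rw [DegLT] at *; rw [hf, hg, add_zero]
  | succ k ih =>
    intro a
    rw [diff_add_fun]
    exact ih (hf a) (hg a)

theorem DegLT.smul {k : ℕ} {f : M → ZMod 2} (c : ZMod 2) (hf : DegLT k f) : DegLT k (c • f) := by
  have hc : c = 0 ∨ c = 1 := by revert c; decide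
  rcases hc with rfl | rfl
  · rw [zero_smul]; exact DegLT.zero_fun k
  · rwa [one_smul]

theorem DegLT.succ {k : ℕ} {f : M → ZMod 2} (hf : DegLT k f) : DegLT (k + 1) f := by
  induction k generalizing f with
  | zero => rw [DegLT] at hf; rw [hf]; exact DegLT.zero_fun 1
  | succ k ih => exact fun a => ih (hf a)

theorem DegLT.mono {k l : ℕ} (h : k ≤ l) {f : M → ZMod 2} (hf : DegLT k f) : DegLT l f := by
  induction l, h using Nat.le_induction with
  | base => exact hf
  | succ l _ ih => exact ih.succ

theorem diff_translate (a b : M) (f : M → ZMod 2) :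
    diff a (fun x => f (b + x)) = fun x => diff a f (b + x) := by
  funext x
  simp [diff, add_assoc]

theorem DegLT.translate {k : ℕ} {f : M → ZMod 2} (hf : DegLT k f) (b : M) :
    DegLT k (fun x => f (b + x)) := by
  induction k generalizing f with
  | zero => rw [DegLT] at *; subst hf; rfl
  | succ k ih => intro a; rw [diff_translate]; exact ih (hf a)

theorem diff_comp {N : Type*} [AddCommGroup N] (L : N →+ M) (a : N) (f : M → ZMod 2) :
    diff a (fun x => f (L x)) = fun x => diff (L a) f (L x) := by
  funext x
  simp [diff]

theorem DegLT.comp {N : Type*} [AddCommGroup N] {k : ℕ} {f : M → ZMod 2} (hf : DegLT k f)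
    (L : N →+ M) : DegLT k (fun x => f (L x)) := by
  induction k generalizing f with
  | zero => rw [DegLT] at *; subst hf; rfl
  | succ k ih => intro a; rw [diff_comp]; exact ih (hf (L a))

/-- Leibniz rule: D_a(l f) = l D_a f + l(a)(f + D_a f), and induction on the order. -/
theorem DegLT.hom_mul {k : ℕ} {f : M → ZMod 2} (hf : DegLT k f) (l : M →+ ZMod 2) :
    DegLT (k + 1) (fun x => l x * f x) := by
  induction k generalizing f with
  | zero =>
    rw [DegLT] at hf
    subst hf
    have : (fun x : M => l x * (0 : M → ZMod 2) x) = 0 := by funext x; simp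
    rw [this]
    exact DegLT.zero_fun 1
  | succ k ih =>
    intro a
    have : BoolFun.diff a (fun x => l x * f x)
        = (fun x => l x * BoolFun.diff a f x) + l a • (f + BoolFun.diff a f) := by
      funext x
      simp only [BoolFun.diff, map_add, Pi.add_apply, Pi.smul_apply, smul_eq_mul]
      have h (t : ZMod 2) : t + t = 0 := CharTwo.add_self_eq_zero t
      linear_combination (-l a) * h (f x)
    rw [this]
    exact (ih (hf a)).add ((hf.add (hf a).succ).smul _)

end Differences

theorem degLT_monomial {m : ℕ} (S : Finset (Fin m)) : DegLT (S.card + 1) (monomial S) := by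
  induction S using Finset.induction_on with
  | empty =>
    intro a
    rw [Finset.card_empty, DegLT]
    funext x
    simp [diff, monomial, CharTwo.add_self_eq_zero]
  | insert i S hi ih =>
    rw [Finset.card_insert_of_notMem hi]
    have : monomial (insert i S) = fun x : Fin m → ZMod 2 =>
        (Pi.evalAddMonoidHom (fun _ : Fin m => ZMod 2) i) x * monomial S x := by
      funext x
      simp [monomial, Finset.prod_insert hi]
    rw [this]
    exact ih.hom_mul _

theorem degLT_of_degree_le {m d : ℕ} {f : (Fin m → ZMod 2) → ZMod 2} (h : degree f ≤ d) :
    DegLT (d + 1) f := by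
  rw [degree_le_iff] at h
  induction h using Submodule.span_induction with
  | mem g hg =>
    obtain ⟨S, hS, rfl⟩ := hg
    exact (degLT_monomial S).mono (by omega)
  | zero => exact DegLT.zero_fun _
  | add g h _ _ hg hh => exact hg.add hh
  | smul c g _ hg => exact hg.smul c

/-- The subsets of `insert i S` split by whether they contain `i`. Iterated, a_S is the derivative
of f at 0 along the basis vectors indexed by S, which links the algebraic normal form to `DegLT`. -/
theorem anfCoeff_insert {m : ℕ} (f : (Fin m → ZMod 2) → ZMod 2) {i : Fin m} {S : Finset (Fin m)}
    (hi : i ∉ S) : anfCoeff f (insert i S) = anfCoeff (diff (Pi.single i 1) f) S := by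
  unfold anfCoeff
  rw [Finset.sum_powerset_insert hi, ← Finset.sum_add_distrib]
  refine Finset.sum_congr rfl fun T hT => ?_
  rw [diff, add_comm]
  congr 2
  funext j
  have hiT : i ∉ T := fun h => hi (Finset.mem_powerset.1 hT h)
  by_cases hj : j = i
  · subst hj; simp [hiT]
  · simp [hj]

theorem degree_le_of_degLT {m d : ℕ} {f : (Fin m → ZMod 2) → ZMod 2} (h : DegLT (d + 1) f) :
    degree f ≤ d := by
  have key : ∀ (S : Finset (Fin m)) (k : ℕ) (g : (Fin m → ZMod 2) → ZMod 2), DegLT k g →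
      k ≤ S.card → anfCoeff g S = 0 := by
    intro S
    induction S using Finset.induction_on with
    | empty =>
      intro k g hg hk
      obtain rfl : k = 0 := by simpa using hk
      rw [DegLT] at hg
      simp [anfCoeff, hg]
    | insert i S hi ih =>
      intro k g hg hk
      rw [Finset.card_insert_of_notMem hi] at hk
      rw [anfCoeff_insert g hi]
      rcases k with _ | k
      · exact ih 0 _ (by rw [DegLT] at *; subst hg; funext x; simp [diff]) (Nat.zero_le _)
      · exact ih k _ (hg _) (by omega)
  refine Finset.sup_le fun S hS => ?_
  by_contra hlt
  exact (Finset.mem_filter.1 hS).2 (key S _ f h (by omega))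

theorem degree_le_iff_degLT {m d : ℕ} {f : (Fin m → ZMod 2) → ZMod 2} :
    degree f ≤ d ↔ DegLT (d + 1) f :=
  ⟨degLT_of_degree_le, degree_le_of_degLT⟩

/-! ### The bilinear and trilinear forms of a cubic function -/

section Forms

variable {M : Type*} [AddCommGroup M]

/-- The second derivative at `0`. -/
def bil (f : M → ZMod 2) (a b : M) : ZMod 2 := diff a (diff b f) 0

/-- The third derivative at `0`. -/
def tri (f : M → ZMod 2) (a b c : M) : ZMod 2 := diff a (diff b (diff c f)) 0

theorem bil_comm (f : M → ZMod 2) (a b : M) : bil f a b = bil f b a := by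
  rw [bil, bil, diff_comm]

theorem tri_swap_left (f : M → ZMod 2) (a b c : M) : tri f a b c = tri f b a c := by
  rw [tri, tri, diff_comm]

theorem tri_swap_right (f : M → ZMod 2) (a b c : M) : tri f a b c = tri f a c b := by
  rw [tri, tri, diff_comm b c]

theorem tri_rotate (f : M → ZMod 2) (a b c : M) : tri f a b c = tri f b c a := by
  rw [tri_swap_left, tri_swap_right]

theorem DegLT.diff_const {g : M → ZMod 2} (hg : DegLT 1 g) (x : M) : g x = g 0 := by
  have := congrFun (hg x) 0
  rw [BoolFun.diff, zero_add] at this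
  exact CharTwo.add_eq_zero.1 this

variable {f : M → ZMod 2}

theorem DegLT.diff_three (hf : DegLT 4 f) (a b c x : M) :
    BoolFun.diff a (BoolFun.diff b (BoolFun.diff c f)) x = tri f a b c :=
  DegLT.diff_const (hf c b a) x

/-- Second derivatives of a cubic are affine, with linear part T(a, b, ·). Hence one vanishes
identically as soon as T(a, b, ·) = 0 and B(a, b) = 0. -/
theorem DegLT.diff_two (hf : DegLT 4 f) (a b x : M) :
    BoolFun.diff a (BoolFun.diff b f) x = bil f a b + tri f a b x := by
  have h : tri f a b x = BoolFun.diff x (BoolFun.diff a (BoolFun.diff b f)) 0 := by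
    rw [tri_rotate, tri_rotate, tri]
  have hd (g : M → ZMod 2) : BoolFun.diff x g 0 = g x + g 0 := by rw [BoolFun.diff, zero_add]
  rw [h, bil, hd]
  have h2 (t : ZMod 2) : t + t = 0 := CharTwo.add_self_eq_zero t
  linear_combination -h2 (BoolFun.diff a (BoolFun.diff b f) 0)

theorem DegLT.diff_two_eq_zero (hf : DegLT 4 f) {a b : M} (hT : ∀ y, tri f a b y = 0)
    (hB : bil f a b = 0) : BoolFun.diff b (BoolFun.diff a f) = 0 := by
  funext x
  rw [hf.diff_two, bil_comm, hB, tri_swap_left, hT, add_zero]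
  rfl

theorem DegLT.tri_add_left (hf : DegLT 4 f) (a a' b c : M) :
    tri f (a + a') b c = tri f a b c + tri f a' b c := by
  have h : BoolFun.diff a (BoolFun.diff a' (BoolFun.diff b (BoolFun.diff c f))) = 0 := hf c b a' a
  rw [tri, diff_add, h, add_zero]
  rfl

theorem DegLT.tri_add_mid (hf : DegLT 4 f) (a b b' c : M) :
    tri f a (b + b') c = tri f a b c + tri f a b' c := by
  rw [tri_swap_left, hf.tri_add_left, tri_swap_left f b, tri_swap_left f b']

theorem DegLT.tri_add_right (hf : DegLT 4 f) (a b c c' : M) :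
    tri f a b (c + c') = tri f a b c + tri f a b c' := by
  rw [tri_swap_right, hf.tri_add_mid, tri_swap_right f a c, tri_swap_right f a c']

theorem bil_add_left (f : M → ZMod 2) (a a' b : M) :
    bil f (a + a') b = bil f a b + bil f a' b + tri f a a' b := by
  rw [bil, diff_add]
  rfl

theorem bil_add_right (f : M → ZMod 2) (a b b' : M) :
    bil f a (b + b') = bil f a b + bil f a b' + tri f a b b' := by
  rw [bil_comm, bil_add_left, bil_comm f b, bil_comm f b', tri_rotate, tri_rotate]

theorem diff_zero_left (f : M → ZMod 2) : diff 0 f = 0 := by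
  funext x
  simp [diff, CharTwo.add_self_eq_zero]

theorem bil_zero_left (f : M → ZMod 2) (b : M) : bil f 0 b = 0 := by
  rw [bil, diff_zero_left]; rfl

theorem tri_zero_left (f : M → ZMod 2) (b c : M) : tri f 0 b c = 0 := by
  rw [tri, diff_zero_left]; rfl

variable [Module (ZMod 2) M]

theorem diff_self (a : M) (f : M → ZMod 2) : diff a (diff a f) = 0 := by
  funext x
  simp only [diff, Pi.zero_apply, add_assoc, ZModModule.add_self, add_zero]
  have h2 (t : ZMod 2) : t + t = 0 := CharTwo.add_self_eq_zero t
  linear_combination h2 (f (x + a)) + h2 (f x)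

theorem bil_self (f : M → ZMod 2) (a : M) : bil f a a = 0 := by rw [bil, diff_self]; rfl

theorem tri_self_left (f : M → ZMod 2) (a b : M) : tri f a a b = 0 := by
  rw [tri, diff_self]; rfl

theorem tri_self_right (f : M → ZMod 2) (a b : M) : tri f a b b = 0 := by
  rw [tri_rotate, tri_self_left]

theorem tri_self_outer (f : M → ZMod 2) (a b : M) : tri f a b a = 0 := by
  rw [tri_swap_right, tri_self_left]

theorem DegLT.tri_smul_left (hf : DegLT 4 f) (t : ZMod 2) (a b c : M) :
    tri f (t • a) b c = t * tri f a b c := by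
  have ht : t = 0 ∨ t = 1 := by revert t; decide
  rcases ht with rfl | rfl
  · simp [tri_zero_left]
  · simp

theorem DegLT.tri_smul_mid (hf : DegLT 4 f) (t : ZMod 2) (a b c : M) :
    tri f a (t • b) c = t * tri f a b c := by
  rw [tri_swap_left, hf.tri_smul_left, tri_swap_left]

theorem DegLT.tri_smul_right (hf : DegLT 4 f) (t : ZMod 2) (a b c : M) :
    tri f a b (t • c) = t * tri f a b c := by
  rw [tri_swap_right, hf.tri_smul_mid, tri_swap_right]

/-- The linear functional `T(a, b, ·)`. -/
def DegLT.triLin (hf : DegLT 4 f) (a b : M) : M →ₗ[ZMod 2] ZMod 2 where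
  toFun c := tri f a b c
  map_add' := hf.tri_add_right a b
  map_smul' t c := by simp [hf.tri_smul_right]

end Forms

end BoolFun

namespace BoolFun

/-! ### Weights modulo four -/

theorem sum_monomial_val {m : ℕ} (S : Finset (Fin m)) :
    ∑ x, ((monomial S x).val : ℤ) = 2 ^ (m - S.card) := by
  have hmul : ∀ a b : ZMod 2, ((a * b).val : ℤ) = a.val * b.val := by decide
  have h1 : ∀ x : Fin m → ZMod 2, ((monomial S x).val : ℤ)
      = ∏ i, if i ∈ S then ((x i).val : ℤ) else 1 := by
    intro x
    rw [Finset.prod_ite_mem, Finset.univ_inter, monomial]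
    induction S using Finset.induction_on with
    | empty => simp; rfl
    | insert i S hi ih => rw [Finset.prod_insert hi, Finset.prod_insert hi, hmul, ih]
  simp only [h1]
  have h2 := Finset.prod_univ_sum (fun _ : Fin m => (Finset.univ : Finset (ZMod 2)))
    (fun i a => if i ∈ S then (a.val : ℤ) else 1)
  rw [Fintype.piFinset_univ] at h2
  rw [← h2]
  have h3 : ∀ i, (∑ a : ZMod 2, if i ∈ S then (a.val : ℤ) else 1) = if i ∈ S then 1 else 2 := by
    intro i
    split_ifs <;> decide
  simp only [h3]
  rw [Finset.prod_ite]
  simp only [Finset.prod_const_one, one_mul, Finset.prod_const]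
  congr 1
  rw [Finset.filter_not, Finset.card_sdiff]
  simp

theorem sum_val_cast {α : Type*} [Fintype α] (f : α → ZMod 2) :
    ((∑ x, ((f x).val : ℤ) : ℤ) : ZMod 2) = ∑ x, f x := by
  push_cast
  simp

theorem sum_eq_zero_of_degree_lt {m : ℕ} {f : (Fin m → ZMod 2) → ZMod 2} (h : degree f < m) :
    ∑ x, f x = 0 := by
  have key := (degree_le_iff f (degree f)).1 le_rfl
  generalize degree f = d at h key
  induction key using Submodule.span_induction with
  | mem g hg =>
    obtain ⟨S, hS, rfl⟩ := hg
    rw [← sum_val_cast, sum_monomial_val]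
    obtain ⟨k, hk⟩ : ∃ k, m - S.card = k + 1 := ⟨m - S.card - 1, by omega⟩
    rw [hk, pow_succ]
    push_cast
    rw [show (2 : ZMod 2) = 0 from rfl, mul_zero]
  | zero => simp
  | add g h _ _ hg hh => simp [Finset.sum_add_distrib, hg, hh]
  | smul c g _ hg => simp only [Pi.smul_apply, ← Finset.smul_sum, hg, smul_zero]

theorem monomial_mul {m : ℕ} (S T : Finset (Fin m)) :
    monomial S * monomial T = monomial (S ∪ T) := by
  funext x
  simp only [Pi.mul_apply, monomial]
  have hx : ∀ a : ZMod 2, a * a = a := by decide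
  rw [← Finset.prod_union_inter]
  rw [← Finset.prod_sdiff (Finset.inter_subset_union (s := S) (t := T)), mul_assoc,
    ← Finset.prod_mul_distrib]
  simp only [hx]

theorem weight_add {α : Type*} [Fintype α] (f g : α → ZMod 2) :
    ∑ x, (((f + g) x).val : ℤ)
      = ∑ x, ((f x).val : ℤ) + ∑ x, ((g x).val : ℤ) - 2 * ∑ x, (((f * g) x).val : ℤ) := by
  have h : ∀ a b : ZMod 2, ((a + b).val : ℤ) = a.val + b.val - 2 * (a * b).val := by decide
  simp only [Pi.add_apply, Pi.mul_apply, h, Finset.sum_sub_distrib, Finset.sum_add_distrib,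
    Finset.mul_sum]

/-- Add the monomials one at a time with wt(f+g) = wt f + wt g − 2 wt(fg). A monomial has weight
2^(7−|S|), and the product has degree at most 6 < 7, hence even weight. -/
theorem four_dvd_weight_sum (A : Finset (Finset (Fin 7))) (hA : ∀ S ∈ A, S.card ≤ 3) :
    (4 : ℤ) ∣ ∑ x, (((∑ S ∈ A, monomial S : (Fin 7 → ZMod 2) → ZMod 2) x).val : ℤ) := by
  induction A using Finset.induction_on with
  | empty => simp
  | insert S A hS ih =>
    rw [Finset.sum_insert hS, weight_add]
    have hSc := hA S (Finset.mem_insert_self _ _)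
    have hA' : ∀ T ∈ A, T.card ≤ 3 := fun T hT => hA T (Finset.mem_insert_of_mem hT)
    refine dvd_sub (dvd_add ?_ (ih hA')) ?_
    · rw [sum_monomial_val]
      exact (pow_dvd_pow (2 : ℤ) (show 2 ≤ 7 - S.card by omega))
    · rw [show (4 : ℤ) = 2 * 2 from rfl]
      refine mul_dvd_mul_left 2 ?_
      have := (ZMod.intCast_zmod_eq_zero_iff_dvd
        (∑ x, (((monomial S * ∑ T ∈ A, monomial T : (Fin 7 → ZMod 2) → ZMod 2) x).val : ℤ)) 2).1
      refine this ?_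
      rw [sum_val_cast]
      refine sum_eq_zero_of_degree_lt (lt_of_le_of_lt (b := 6) ?_ (by norm_num))
      rw [Finset.mul_sum, degree_le_iff]
      refine Submodule.sum_mem _ fun T hT => Submodule.subset_span ⟨S ∪ T, ?_, monomial_mul S T⟩
      have := Finset.card_union_le S T
      have := hA' T hT
      omega

theorem four_dvd_weight {f : (Fin 7 → ZMod 2) → ZMod 2} (hf : degree f ≤ 3) :
    (4 : ℤ) ∣ ∑ x, ((f x).val : ℤ) := by
  have h : f = ∑ S ∈ Finset.univ.filter (fun S => anfCoeff f S ≠ 0), monomial S := by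
    funext x
    rw [eq_sum_anfCoeff f x, Finset.sum_apply, Finset.sum_filter]
    refine Finset.sum_congr rfl fun S _ => ?_
    have hc : ∀ c d : ZMod 2, c * d = if c ≠ 0 then d else 0 := by decide
    exact hc _ _
  rw [h]
  exact four_dvd_weight_sum _ fun S hS => (Finset.le_sup (f := Finset.card) hS).trans hf

/-! ### Character sums -/

/-- The nontrivial character of `𝔽₂`. -/
def sgn (a : ZMod 2) : ℤ := if a = 0 then 1 else -1

theorem sgn_add (a b : ZMod 2) : sgn (a + b) = sgn a * sgn b := by revert a b; decide

theorem sgn_eq (a : ZMod 2) : sgn a = 1 - 2 * (a.val : ℤ) := by revert a; decide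

theorem eight_dvd_sum_sgn {f : (Fin 7 → ZMod 2) → ZMod 2} (hf : degree f ≤ 3) :
    (8 : ℤ) ∣ ∑ x, sgn (f x) := by
  simp only [sgn_eq, Finset.sum_sub_distrib, ← Finset.mul_sum]
  obtain ⟨k, hk⟩ := four_dvd_weight hf
  rw [hk]
  simp only [Finset.sum_const, Finset.card_univ, Fintype.card_fun, ZMod.card, Fintype.card_fin]
  refine ⟨16 - k, ?_⟩
  simp
  ring

section Sums

variable {M : Type*} [AddCommGroup M] [Fintype M]

/-- The square of a character sum is the sum over all derivatives. -/
theorem sq_sum_sgn [Module (ZMod 2) M] (g : M → ZMod 2) :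
    (∑ x, sgn (g x)) ^ 2 = ∑ b, ∑ x, sgn (diff b g x) := by
  rw [sq, Finset.sum_mul_sum, Finset.sum_comm' (t' := Finset.univ) (s' := fun _ => Finset.univ)
    (by simp)]
  rw [Finset.sum_comm]
  have : ∀ x, ∑ y, sgn (g x) * sgn (g y) = ∑ b, sgn (diff b g x) := by
    intro x
    rw [← Equiv.sum_comp (Equiv.addLeft x)]
    refine Finset.sum_congr rfl fun b _ => ?_
    rw [diff, sgn_add, mul_comm]
    rfl
  simp only [this]
  rw [Finset.sum_comm]

/-- Translation by c flips every sign. -/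
theorem sum_sgn_eq_zero {g : M → ZMod 2} (hg : DegLT 2 g) {c x₀ : M} (h : diff c g x₀ ≠ 0) :
    ∑ x, sgn (g x) = 0 := by
  have hc : ∀ x, g (x + c) = g x + 1 := by
    intro x
    have h1 := DegLT.diff_const (hg c) x
    rw [← DegLT.diff_const (hg c) x₀] at h1
    have h2 : diff c g x₀ = 1 := by
      revert h; generalize diff c g x₀ = t; revert t; decide
    rw [h2, diff] at h1
    have h3 : ∀ a b : ZMod 2, a + b = 1 → a = b + 1 := by decide
    exact h3 _ _ h1
  have h1 : ∑ x, sgn (g x) = ∑ x, sgn (g (x + c)) := (Equiv.sum_comp (Equiv.addRight c) _).symm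
  simp only [hc] at h1
  have hs : ∀ a : ZMod 2, sgn (a + 1) = - sgn a := by decide
  simp only [hs, Finset.sum_neg_distrib] at h1
  omega

/-- The square of the character sum of a function of degree at most two. -/
theorem sq_sum_sgn_quadratic [Module (ZMod 2) M] {g : M → ZMod 2} (hg : DegLT 3 g)
    (R : Finset M) (hR : ∀ b, b ∈ R ↔ ∀ c, diff c (diff b g) 0 = 0) :
    (∑ x, sgn (g x)) ^ 2 = Fintype.card M * ∑ b ∈ R, sgn (diff b g 0) := by
  rw [sq_sum_sgn, ← Finset.sum_subset (Finset.subset_univ R), Finset.mul_sum]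
  · refine Finset.sum_congr rfl fun b hb => ?_
    have : ∀ x, diff b g x = diff b g 0 := by
      intro x
      have h := (hR b).1 hb x
      rw [diff, zero_add] at h
      exact CharTwo.add_eq_zero.1 h
    simp [this]
  · intro b _ hb
    rw [hR] at hb
    push Not at hb
    obtain ⟨c, hc⟩ := hb
    exact sum_sgn_eq_zero (hg b) hc

end Sums

end BoolFun

namespace BoolFun

/-! ### Orthogonal triples -/

section Triples

variable {M : Type*} [AddCommGroup M] [Module (ZMod 2) M]

/-- `e, b, c` are independent and the mixed second derivatives in the directions `e, b` and
`e, c` vanish identically. -/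
def HasTriple (f : M → ZMod 2) : Prop :=
  ∃ e b c : M, LinearIndependent (ZMod 2) ![e, b, c] ∧ diff b (diff e f) = 0 ∧
    diff c (diff e f) = 0

theorem linearIndependent_combination {n k : ℕ} {v : Fin n → M}
    (hv : LinearIndependent (ZMod 2) v) (A : Fin k → Fin n → ZMod 2)
    (hA : LinearIndependent (ZMod 2) A) :
    LinearIndependent (ZMod 2) fun j => ∑ i, A j i • v i := by
  have := hA.map' (Fintype.linearCombination (ZMod 2) v)
    (LinearMap.ker_eq_bot.2 (hv.fintypeLinearCombination_injective))
  exact this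

theorem linearIndependent_of_eq_combination {n k : ℕ} {v : Fin n → M}
    (hv : LinearIndependent (ZMod 2) v) {w : Fin k → M} (A : Fin k → Fin n → ZMod 2)
    (hA : LinearIndependent (ZMod 2) A) (h : ∀ j, w j = ∑ i, A j i • v i) :
    LinearIndependent (ZMod 2) w := by
  rw [show w = _ from funext h]
  exact linearIndependent_combination hv A hA

/-- Independence of vectors written in a known independent family thus becomes a `decide` on their
coefficient rows. -/
instance decidableLinearIndependent {k n : ℕ} (A : Fin k → Fin n → ZMod 2) :
    Decidable (LinearIndependent (ZMod 2) A) :=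
  decidable_of_iff _ Fintype.linearIndependent_iff.symm

theorem zmod_two_cases (t : ZMod 2) : t = 0 ∨ t = 1 := by revert t; decide

theorem linearIndependent_pair {a b : M} (ha : a ≠ 0) (hb : b ≠ 0) (hab : b ≠ a) :
    LinearIndependent (ZMod 2) ![a, b] := by
  rw [LinearIndependent.pair_iff]
  intro s t h
  rcases zmod_two_cases s with rfl | rfl <;> rcases zmod_two_cases t with rfl | rfl <;>
    simp_all [ZModModule.add_self]
  exact hab (by rw [← sub_eq_zero, ZModModule.sub_eq_add, add_comm, h])

theorem linearIndependent_triple {a b c : M} (h : LinearIndependent (ZMod 2) ![a, b])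
    (h0 : c ≠ 0) (h1 : c ≠ a) (h2 : c ≠ b) (h3 : c ≠ a + b) :
    LinearIndependent (ZMod 2) ![a, b, c] := by
  have : ![a, b, c] = Fin.snoc ![a, b] c := by
    funext i; fin_cases i <;> rfl
  rw [this, linearIndependent_finSnoc]
  refine ⟨h, fun hc => ?_⟩
  rw [Matrix.range_cons, Matrix.range_cons, Matrix.range_empty, Set.union_empty,
    Set.singleton_union, Submodule.mem_span_pair] at hc
  obtain ⟨s, t, rfl⟩ := hc
  rcases zmod_two_cases s with rfl | rfl <;> rcases zmod_two_cases t with rfl | rfl <;>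
    simp_all

variable {f : M → ZMod 2}

theorem DegLT.hasTriple (hf : DegLT 4 f) {e b c : M} (h : LinearIndependent (ZMod 2) ![e, b, c])
    (hTb : ∀ y, tri f e b y = 0) (hTc : ∀ y, tri f e c y = 0)
    (hb : bil f e b = 0) (hc : bil f e c = 0) : HasTriple f :=
  ⟨e, b, c, h, hf.diff_two_eq_zero hTb hb, hf.diff_two_eq_zero hTc hc⟩

/-- If the radical of `T(x, ·, ·)` has dimension at least four, then there is a triple. -/
theorem DegLT.hasTriple_of_four (hf : DegLT 4 f) {x a b c : M}
    (h : LinearIndependent (ZMod 2) ![x, a, b, c]) (ha : ∀ y, tri f x a y = 0)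
    (hb : ∀ y, tri f x b y = 0) (hc : ∀ y, tri f x c y = 0) : HasTriple f := by
  -- B(x, ·) is linear on the span of a, b, c, so its kernel there has dimension at least two. The
  -- eight cases below pick two independent kernel vectors.
  have hab : ∀ y, tri f x (a + b) y = 0 := fun y => by rw [hf.tri_add_mid, ha, hb, add_zero]
  have hac : ∀ y, tri f x (a + c) y = 0 := fun y => by rw [hf.tri_add_mid, ha, hc, add_zero]
  have hbc : ∀ y, tri f x (b + c) y = 0 := fun y => by rw [hf.tri_add_mid, hb, hc, add_zero]
  have key : ∀ A : Fin 3 → Fin 4 → ZMod 2, LinearIndependent (ZMod 2) A →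
      LinearIndependent (ZMod 2) ![∑ i, A 0 i • ![x, a, b, c] i, ∑ i, A 1 i • ![x, a, b, c] i,
        ∑ i, A 2 i • ![x, a, b, c] i] := by
    intro A hA
    have := linearIndependent_combination h A hA
    convert this using 1
    funext i; fin_cases i <;> rfl
  have bab : bil f x (a + b) = bil f x a + bil f x b := by rw [bil_add_right, ha, add_zero]
  have bac : bil f x (a + c) = bil f x a + bil f x c := by rw [bil_add_right, ha, add_zero]
  have bbc : bil f x (b + c) = bil f x b + bil f x c := by rw [bil_add_right, hb, add_zero]
  rcases zmod_two_cases (bil f x a) with la | la <;>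
  rcases zmod_two_cases (bil f x b) with lb | lb <;>
  rcases zmod_two_cases (bil f x c) with lc | lc <;>
  rw [la, lb] at bab <;> rw [la, lc] at bac <;> rw [lb, lc] at bbc
  · refine hf.hasTriple ?_ ha hb la lb
    simpa [Fin.sum_univ_succ] using key ![![1,0,0,0],![0,1,0,0],![0,0,1,0]] (by decide)
  · refine hf.hasTriple ?_ ha hb la lb
    simpa [Fin.sum_univ_succ] using key ![![1,0,0,0],![0,1,0,0],![0,0,1,0]] (by decide)
  · refine hf.hasTriple ?_ ha hc la lc
    simpa [Fin.sum_univ_succ] using key ![![1,0,0,0],![0,1,0,0],![0,0,0,1]] (by decide)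
  · refine hf.hasTriple ?_ ha hbc la bbc
    simpa [Fin.sum_univ_succ] using key ![![1,0,0,0],![0,1,0,0],![0,0,1,1]] (by decide)
  · refine hf.hasTriple ?_ hb hc lb lc
    simpa [Fin.sum_univ_succ] using key ![![1,0,0,0],![0,0,1,0],![0,0,0,1]] (by decide)
  · refine hf.hasTriple ?_ hb hac lb bac
    simpa [Fin.sum_univ_succ] using key ![![1,0,0,0],![0,0,1,0],![0,1,0,1]] (by decide)
  · refine hf.hasTriple ?_ hab hc bab lc
    simpa [Fin.sum_univ_succ] using key ![![1,0,0,0],![0,1,1,0],![0,0,0,1]] (by decide)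
  · refine hf.hasTriple ?_ hab hac bab bac
    simpa [Fin.sum_univ_succ] using key ![![1,0,0,0],![0,1,1,0],![0,1,0,1]] (by decide)

/-- Two directions whose second derivative vanishes share no further radical vector. -/
theorem DegLT.hasTriple_of_common (hf : DegLT 4 f) {e e' r : M}
    (h : LinearIndependent (ZMod 2) ![e, e', r]) (he : ∀ y, tri f e e' y = 0)
    (hb : bil f e e' = 0) (h1 : ∀ y, tri f e r y = 0) (h2 : ∀ y, tri f e' r y = 0) :
    HasTriple f := by
  have key : ∀ A : Fin 3 → Fin 3 → ZMod 2, LinearIndependent (ZMod 2) A →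
      LinearIndependent (ZMod 2) ![∑ i, A 0 i • ![e, e', r] i, ∑ i, A 1 i • ![e, e', r] i,
        ∑ i, A 2 i • ![e, e', r] i] := by
    intro A hA
    have := linearIndependent_combination h A hA
    convert this using 1
    funext i; fin_cases i <;> rfl
  rcases zmod_two_cases (bil f e r) with l | l
  · exact hf.hasTriple h he h1 hb l
  rcases zmod_two_cases (bil f e' r) with l' | l'
  · refine hf.hasTriple (e := e') (b := e) (c := r) ?_ (fun y => ?_) h2 ?_ l'
    · simpa [Fin.sum_univ_succ] using key ![![0,1,0],![1,0,0],![0,0,1]] (by decide)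
    · rw [tri_swap_left, he]
    · rw [bil_comm, hb]
  -- Since T(e, e', r) = 0, B(e + e', r) = B(e, r) + B(e', r) = 1 + 1 = 0.
  · refine hf.hasTriple (e := e + e') (b := e) (c := r) ?_ (fun y => ?_) (fun y => ?_) ?_ ?_
    · simpa [Fin.sum_univ_succ] using key ![![1,1,0],![1,0,0],![0,0,1]] (by decide)
    · rw [hf.tri_add_left, tri_self_left, tri_swap_left, he, add_zero]
    · rw [hf.tri_add_left, h1, h2, add_zero]
    · rw [bil_add_left, bil_self, bil_comm, hb, tri_self_outer]; rfl
    · rw [bil_add_left, l, l', he]; rfl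

end Triples

/-! ### Radicals of the derivatives in seven variables -/

section Radicals

variable {f : (Fin 7 → ZMod 2) → ZMod 2}

/-- If every nonzero e had radical {0, e}, the character sum of D_e f would have square 128·2, so it
would be ±16, which is 16 modulo 32. Then the squared character sum of f, the total over all e,
would be 128 + 127·16, that is 16 modulo 32. But it is divisible by 64, because the weight of f is
divisible by 4. -/
theorem exists_radical_vector (hd : degree f ≤ 3) :
    ∃ e c : Fin 7 → ZMod 2, e ≠ 0 ∧ c ≠ 0 ∧ c ≠ e ∧ ∀ y, tri f e c y = 0 := by
  classical
  have hf : DegLT 4 f := degLT_of_degree_le hd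
  by_contra hcon
  push Not at hcon
  have hW : ∀ e : Fin 7 → ZMod 2, e ≠ 0 → (32 : ℤ) ∣ (∑ x, sgn (diff e f x)) - 16 := by
    intro e he
    have h := sq_sum_sgn_quadratic (hf e) {0, e} (by
      intro b
      rw [Finset.mem_insert, Finset.mem_singleton]
      constructor
      · rintro (rfl | rfl) c
        · rw [diff_zero_left]; simp [diff]
        · rw [diff_self]; simp [diff]
      · intro hb
        by_contra hne
        push Not at hne
        obtain ⟨y, hy⟩ := hcon e b he hne.1 hne.2
        apply hy
        rw [tri_swap_left, tri_rotate, tri_rotate]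
        exact hb y)
    rw [Finset.sum_pair he.symm, diff_zero_left, diff_self] at h
    have h256 : (∑ x, sgn (diff e f x)) ^ 2 = 16 ^ 2 := by
      rw [h]; simp [sgn]
    rcases sq_eq_sq_iff_eq_or_eq_neg.1 h256 with h1 | h1 <;> rw [h1] <;> norm_num
  have h1 := sq_sum_sgn f
  obtain ⟨k, hk⟩ := eight_dvd_sum_sgn hd
  rw [hk, ← Finset.add_sum_erase _ _ (Finset.mem_univ (0 : Fin 7 → ZMod 2))] at h1
  have h2 : (32 : ℤ) ∣ ∑ e ∈ Finset.univ.erase (0 : Fin 7 → ZMod 2),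
      ((∑ x, sgn (diff e f x)) - 16) :=
    Finset.dvd_sum fun e he => hW e (Finset.ne_of_mem_erase he)
  rw [Finset.sum_sub_distrib, Finset.sum_const, Finset.card_erase_of_mem (Finset.mem_univ _)] at h2
  have h3 : ∑ x, sgn (diff (0 : Fin 7 → ZMod 2) f x) = 128 := by
    rw [diff_zero_left]
    simp [sgn]
  rw [h3] at h1
  generalize ∑ e ∈ Finset.univ.erase (0 : Fin 7 → ZMod 2), ∑ x, sgn (diff e f x) = X at h1 h2
  simp only [Finset.card_univ, Fintype.card_fun, ZMod.card, Fintype.card_fin] at h2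
  obtain ⟨j, hj⟩ := h2
  have h4 : (8 * k) ^ 2 = 64 * k ^ 2 := by ring
  norm_num at hj
  omega

/-- An alternating form has even rank, so on a space of dimension seven its radical has odd
dimension. Here this appears as the fact that 128·4 = 512 is not a square. -/
theorem exists_second_radical_vector (hf : DegLT 4 f) {e c : Fin 7 → ZMod 2}
    (hec : LinearIndependent (ZMod 2) ![e, c]) (hT : ∀ y, tri f e c y = 0) :
    ∃ r, LinearIndependent (ZMod 2) ![e, c, r] ∧ ∀ y, tri f e r y = 0 := by
  classical
  have he : e ≠ 0 := hec.ne_zero 0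
  have hc : c ≠ 0 := hec.ne_zero 1
  have hne : c ≠ e := fun h => by
    have := hec.injective.ne (show (0 : Fin 2) ≠ 1 by decide)
    exact this h.symm
  by_contra hcon
  push Not at hcon
  have hcon' : ∀ r, r ≠ 0 → r ≠ e → r ≠ c → r ≠ e + c → ∃ y, tri f e r y ≠ 0 :=
    fun r h0 h1 h2 h3 => hcon r (linearIndependent_triple hec h0 h1 h2 h3)
  have hspan : c ∉ Submodule.span (ZMod 2) {e} := by
    rw [Submodule.mem_span_singleton]
    rintro ⟨t, ht⟩
    rcases zmod_two_cases t with rfl | rfl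
    · exact hc (by rw [← ht, zero_smul])
    · exact hne (by rw [← ht, one_smul])
  obtain ⟨φ, hφc, hφ⟩ := Submodule.exists_le_ker_of_notMem hspan
  have hφe : φ e = 0 := hφ (Submodule.mem_span_singleton_self e)
  have hφc : φ c = 1 := (zmod_two_cases _).resolve_left hφc
  -- Adding the linear function l·φ to D_e f leaves second derivatives alone and makes the
  -- derivatives at 0 along e and c vanish, so all four radical terms contribute +1.
  set l : ZMod 2 := bil f c e with hl
  set lam : (Fin 7 → ZMod 2) → ZMod 2 := fun x => l * φ x with hlam
  have dlam : ∀ b, diff b lam = fun _ => l * φ b := by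
    intro b
    funext x
    simp only [diff, hlam, map_add]
    have h2 (t : ZMod 2) : t + t = 0 := CharTwo.add_self_eq_zero t
    linear_combination h2 (l * φ x)
  have ddlam : ∀ a b, diff a (diff b lam) = 0 := by
    intro a b
    rw [dlam]
    funext x
    simp [diff, CharTwo.add_self_eq_zero]
  have hg : DegLT 3 (diff e f + lam) := (hf e).add (DegLT.succ (k := 2) fun a b => ddlam b a)
  have h := sq_sum_sgn_quadratic hg {0, e, c, e + c} (by
    intro b
    have hb : ∀ y, diff y (diff b (diff e f + lam)) 0 = tri f e b y := by
      intro y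
      rw [diff_add_fun, diff_add_fun, ddlam, add_zero, tri_swap_left, tri_rotate, tri_rotate, tri]
    simp only [Finset.mem_insert, Finset.mem_singleton, hb]
    constructor
    · rintro (rfl | rfl | rfl | rfl) y
      · rw [tri_swap_left, tri_zero_left]
      · rw [tri_self_left]
      · exact hT y
      · rw [hf.tri_add_mid, tri_self_left, hT, add_zero]
    · intro hy
      by_contra hne
      push Not at hne
      obtain ⟨y, hy'⟩ := hcon' b hne.1 hne.2.1 hne.2.2.1 hne.2.2.2
      exact hy' (hy y))
  have v : ∀ b, diff b (diff e f + lam) 0 = bil f b e + l * φ b := by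
    intro b
    rw [diff_add_fun, dlam]
    rfl
  have hecne : e + c ≠ 0 := fun h => hne (by
    rw [← sub_eq_zero, ZModModule.sub_eq_add, add_comm, h])
  rw [Finset.sum_insert (by
      simp only [Finset.mem_insert, Finset.mem_singleton, not_or]
      exact ⟨he.symm, hc.symm, hecne.symm⟩),
    Finset.sum_insert (by
      simp only [Finset.mem_insert, Finset.mem_singleton, not_or]
      exact ⟨hne.symm, by simpa using hc⟩),
    Finset.sum_pair (by simpa using he), v, v, v, v, bil_zero_left, bil_self, bil_add_left,
    bil_self, map_add, map_zero, hφe, hφc, ← hl, tri_self_outer] at h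
  have h2 : l + l = 0 := CharTwo.add_self_eq_zero l
  simp only [mul_zero, mul_one, zero_add, add_zero, h2] at h
  simp only [Fintype.card_fun, ZMod.card, Fintype.card_fin, sgn] at h
  norm_num at h
  generalize (∑ x, if diff e f x + lam x = 0 then (1 : ℤ) else -1) = W at h
  have h5 : W < 23 := by nlinarith
  have h6 : -23 < W := by nlinarith
  interval_cases W <;> omega

end Radicals

end BoolFun

namespace BoolFun

/-! ### The normal form of a cubic function without triples -/

section Pencil

variable {f : (Fin 7 → ZMod 2) → ZMod 2}

theorem tri_perms {M : Type*} [AddCommGroup M] {f : M → ZMod 2} {a b c : M} {t : ZMod 2}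
    (h : tri f a b c = t) :
    tri f a b c = t ∧ tri f a c b = t ∧ tri f b a c = t ∧ tri f b c a = t ∧ tri f c a b = t ∧
      tri f c b a = t := by
  have h1 : tri f a c b = t := by rw [tri_swap_right, h]
  refine ⟨h, h1, ?_, ?_, ?_, ?_⟩
  · rw [tri_swap_left, h]
  · rw [← tri_rotate, h]
  · rw [tri_swap_left, h1]
  · rw [← tri_rotate, h1]

theorem tri_perms_zero {M : Type*} [AddCommGroup M] {f : M → ZMod 2} {a b : M}
    (h : ∀ y, tri f a b y = 0) :
    (∀ y, tri f a b y = 0) ∧ (∀ y, tri f a y b = 0) ∧ (∀ y, tri f b a y = 0) ∧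
      (∀ y, tri f b y a = 0) ∧ (∀ y, tri f y a b = 0) ∧ ∀ y, tri f y b a = 0 :=
  ⟨h, fun y => (tri_perms (h y)).2.1, fun y => (tri_perms (h y)).2.2.1,
    fun y => (tri_perms (h y)).2.2.2.1, fun y => (tri_perms (h y)).2.2.2.2.1,
    fun y => (tri_perms (h y)).2.2.2.2.2⟩

/-- B(e, ·) is linear on the radical of T(e, ·, ·) and, without triples, not zero on a complement of
e: take e' in its kernel and r outside. The same for e' yields r'. The functionals T(e, r', ·) and
T(e', r, ·) are nonzero by `DegLT.hasTriple_of_common`. -/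
theorem exists_pencil (hd : degree f ≤ 3) (hN : ¬ HasTriple f) :
    ∃ e e' r r' : Fin 7 → ZMod 2, LinearIndependent (ZMod 2) ![r, r', e, e'] ∧
      (∀ y, tri f e e' y = 0) ∧ (∀ y, tri f e r y = 0) ∧ (∀ y, tri f e' r' y = 0) ∧
      bil f e e' = 0 ∧ bil f e r = 1 ∧ bil f e' r' = 1 ∧ (∃ y, tri f e r' y ≠ 0) ∧
      ∃ y, tri f e' r y ≠ 0 := by
  have hf : DegLT 4 f := degLT_of_degree_le hd
  obtain ⟨e, c, he, hc, hce, hT⟩ := exists_radical_vector hd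
  have hec := linearIndependent_pair he hc hce
  obtain ⟨d, hd3, hd⟩ := exists_second_radical_vector hf hec hT
  have step : ∃ e' r, LinearIndependent (ZMod 2) ![e, e', r] ∧ (∀ y, tri f e e' y = 0) ∧
      (∀ y, tri f e r y = 0) ∧ bil f e e' = 0 ∧ bil f e r = 1 := by
    rcases zmod_two_cases (bil f e c) with lc | lc <;>
      rcases zmod_two_cases (bil f e d) with ld | ld
    · exact absurd (hf.hasTriple hd3 hT hd lc ld) hN
    · exact ⟨c, d, hd3, hT, hd, lc, ld⟩
    · refine ⟨d, c, ?_, hd, hT, ld, lc⟩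
      exact linearIndependent_of_eq_combination hd3 ![![1,0,0],![0,0,1],![0,1,0]] (by decide)
        (by intro j; fin_cases j <;> simp [Fin.sum_univ_succ])
    · refine ⟨c + d, c, ?_, fun y => ?_, hT, ?_, lc⟩
      · exact linearIndependent_of_eq_combination hd3 ![![1,0,0],![0,1,1],![0,1,0]] (by decide)
          (by intro j; fin_cases j <;> simp [Fin.sum_univ_succ])
      · rw [hf.tri_add_mid, hT, hd, add_zero]
      · rw [bil_add_right, lc, ld, hT]; rfl
  obtain ⟨e', r, hli, he', hr, bee, ber⟩ := step
  have hli2 : LinearIndependent (ZMod 2) ![e', e] := by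
    exact linearIndependent_of_eq_combination hli ![![0,1,0],![1,0,0]]
      (by decide) (by intro j; fin_cases j <;> simp [Fin.sum_univ_succ])
  have he2 : ∀ y, tri f e' e y = 0 := (tri_perms_zero he').2.2.1
  obtain ⟨r', hr3, hr'⟩ := exists_second_radical_vector hf hli2 he2
  have ber' : bil f e' r' = 1 := by
    refine (zmod_two_cases _).resolve_left fun h0 => hN ?_
    exact hf.hasTriple hr3 he2 hr' (by rw [bil_comm, bee]) h0
  have hp : ∃ y, tri f e r' y ≠ 0 := by
    by_contra h
    push Not at h
    exact hN (hf.hasTriple_of_common hr3 he2 (by rw [bil_comm, bee]) hr' h)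
  have hs : ∃ y, tri f e' r y ≠ 0 := by
    by_contra h
    push Not at h
    exact hN (hf.hasTriple_of_common hli he' bee hr h)
  refine ⟨e, e', r, r', ?_, he', hr, hr', bee, ber, ber', hp, hs⟩
  have hli3 : LinearIndependent (ZMod 2) ![r, e, e'] := by
    exact linearIndependent_of_eq_combination hli ![![0,0,1],![1,0,0],![0,1,0]]
      (by decide) (by intro j; fin_cases j <;> simp [Fin.sum_univ_succ])
  have hli4 : LinearIndependent (ZMod 2) ![r', r, e, e'] := by
    -- For a suitable y, T(e, y, ·) kills r, e and e' but not r'.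
    refine linearIndependent_finCons.2 ⟨hli3, fun hmem => ?_⟩
    obtain ⟨y, hy⟩ := hp
    have hle : Submodule.span (ZMod 2) (Set.range ![r, e, e']) ≤
        LinearMap.ker (hf.triLin e y) := by
      rw [Submodule.span_le]
      rintro _ ⟨i, rfl⟩
      fin_cases i
      · exact (tri_perms_zero hr).2.1 y
      · exact tri_self_outer f e y
      · exact (tri_perms_zero he').2.1 y
    exact hy (by rw [tri_swap_right]; exact hle hmem)
  exact linearIndependent_of_eq_combination hli4 ![![0,1,0,0],![1,0,0,0],![0,0,1,0],![0,0,0,1]]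
    (by decide) (by intro j; fin_cases j <;> simp [Fin.sum_univ_succ])

theorem exists_mem_notMem_span {n : ℕ} (v : Fin n → Fin 7 → ZMod 2)
    (W : Submodule (ZMod 2) (Fin 7 → ZMod 2)) (h : n < Module.finrank (ZMod 2) W) :
    ∃ w ∈ W, w ∉ Submodule.span (ZMod 2) (Set.range v) := by
  by_contra hcon
  push Not at hcon
  have h1 : W ≤ Submodule.span (ZMod 2) (Set.range v) := hcon
  have h2 := Submodule.finrank_mono h1
  have h3 := finrank_range_le_card (R := ZMod 2) v
  rw [Set.finrank, Fintype.card_fin] at h3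
  omega

theorem linearMap_eq_zero_of_basis {v : Fin 7 → Fin 7 → ZMod 2}
    (hv : LinearIndependent (ZMod 2) v) (φ : (Fin 7 → ZMod 2) →ₗ[ZMod 2] ZMod 2)
    (h : ∀ i, φ (v i) = 0) (y : Fin 7 → ZMod 2) : φ y = 0 := by
  have htop := hv.span_eq_top_of_card_eq_finrank (by simp)
  have hle : Submodule.span (ZMod 2) (Set.range v) ≤ LinearMap.ker φ := by
    rw [Submodule.span_le]
    rintro _ ⟨i, rfl⟩
    exact h i
  rw [htop] at hle
  exact hle trivial

theorem DegLT.tri_eq_zero_of_basis (hf : DegLT 4 f) {z₁ z₂ z₃ z₄ z₅ z₆ z₇ a b : Fin 7 → ZMod 2}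
    (hv : LinearIndependent (ZMod 2) ![z₁, z₂, z₃, z₄, z₅, z₆, z₇])
    (h1 : tri f a b z₁ = 0) (h2 : tri f a b z₂ = 0) (h3 : tri f a b z₃ = 0)
    (h4 : tri f a b z₄ = 0) (h5 : tri f a b z₅ = 0) (h6 : tri f a b z₆ = 0)
    (h7 : tri f a b z₇ = 0) : ∀ y, tri f a b y = 0 := by
  refine linearMap_eq_zero_of_basis hv (hf.triLin a b) fun i => ?_
  fin_cases i
  exacts [h1, h2, h3, h4, h5, h6, h7]

theorem finrank_ker_ge (φ : (Fin 7 → ZMod 2) →ₗ[ZMod 2] ZMod 2) :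
    6 ≤ Module.finrank (ZMod 2) (LinearMap.ker φ) := by
  have h1 := LinearMap.finrank_range_add_finrank_ker φ
  have h2 := Submodule.finrank_le (LinearMap.range φ)
  simp at h1 h2
  omega

theorem finrank_ker_inf_ge (φ ψ : (Fin 7 → ZMod 2) →ₗ[ZMod 2] ZMod 2) :
    5 ≤ Module.finrank (ZMod 2) ((LinearMap.ker φ ⊓ LinearMap.ker ψ : Submodule _ _)) := by
  have h1 := Submodule.finrank_sup_add_finrank_inf_eq (LinearMap.ker φ) (LinearMap.ker ψ)
  have h2 := Submodule.finrank_le (LinearMap.ker φ ⊔ LinearMap.ker ψ)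
  have h3 := finrank_ker_ge φ
  have h4 := finrank_ker_ge ψ
  simp at h2
  omega

theorem notMem_span_of_linearMap {n : ℕ} {v : Fin n → Fin 7 → ZMod 2}
    (φ : (Fin 7 → ZMod 2) →ₗ[ZMod 2] ZMod 2) (hv : ∀ i, φ (v i) = 0) {z : Fin 7 → ZMod 2}
    (hz : φ z ≠ 0) : z ∉ Submodule.span (ZMod 2) (Set.range v) := by
  intro hmem
  have hle : Submodule.span (ZMod 2) (Set.range v) ≤ LinearMap.ker φ := by
    rw [Submodule.span_le]
    rintro _ ⟨i, rfl⟩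
    exact hv i
  exact hz (hle hmem)

/-- Over 𝔽₂ two distinct nonzero functionals are independent. -/
theorem exists_dual_vector {p s : (Fin 7 → ZMod 2) →ₗ[ZMod 2] ZMod 2} (hp : ∃ y, p y ≠ 0)
    (hps : ∃ y, p y ≠ s y) (hs : ∃ y, s y ≠ 0) : ∃ z, p z = 1 ∧ s z = 0 := by
  obtain ⟨x, hx⟩ := hp
  obtain ⟨y, hy⟩ := hps
  obtain ⟨t, ht⟩ := hs
  have hx := (zmod_two_cases _).resolve_left hx
  have ht := (zmod_two_cases _).resolve_left ht
  rcases zmod_two_cases (s x) with h1 | h1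
  · exact ⟨x, hx, h1⟩
  rcases zmod_two_cases (s y) with h2 | h2
  · exact ⟨y, (zmod_two_cases _).resolve_left (fun h => hy (by rw [h, h2])), h2⟩
  · have h3 : p y = 0 := (zmod_two_cases _).resolve_right (fun h => hy (by rw [h, h2]))
    exact ⟨x + y, by simp [hx, h3], by rw [map_add, h1, h2]; rfl⟩

/-- If the functionals `T(e, r', ·)` and `T(e', r, ·)` agree, there is a triple. -/
theorem DegLT.hasTriple_of_functionals_eq (hf : DegLT 4 f) {e e' r r' : Fin 7 → ZMod 2}
    (hli : LinearIndependent (ZMod 2) ![r, r', e, e'])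
    (he : ∀ y, tri f e e' y = 0) (hr : ∀ y, tri f e r y = 0) (hr' : ∀ y, tri f e' r' y = 0)
    (hp : ∃ y, tri f e r' y ≠ 0) (hps : ∀ y, tri f e r' y = tri f e' r y) : HasTriple f := by
  obtain ⟨z, hz⟩ := hp
  have hz := (zmod_two_cases _).resolve_left hz
  have hker := finrank_ker_ge (hf.triLin e r')
  obtain ⟨a, ha, ha'⟩ := exists_mem_notMem_span ![r, r', e, e'] _
    (lt_of_lt_of_le (by norm_num) hker)
  have hli5 : LinearIndependent (ZMod 2) ![a, r, r', e, e'] := linearIndependent_finCons.2 ⟨hli, ha'⟩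
  obtain ⟨b, hb, hb'⟩ := exists_mem_notMem_span ![a, r, r', e, e'] _
    (lt_of_lt_of_le (by norm_num) hker)
  have hli6 : LinearIndependent (ZMod 2) ![b, a, r, r', e, e'] :=
    linearIndependent_finCons.2 ⟨hli5, hb'⟩
  have pa : tri f e r' a = 0 := ha
  have pb : tri f e r' b = 0 := hb
  have sa : tri f e' r a = 0 := (hps a).symm.trans pa
  have sb : tri f e' r b = 0 := (hps b).symm.trans pb
  have sz : tri f e' r z = 1 := (hps z).symm.trans hz
  have hli7 : LinearIndependent (ZMod 2) ![z, b, a, r, r', e, e'] := by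
    refine linearIndependent_finCons.2 ⟨hli6, notMem_span_of_linearMap (hf.triLin e r') ?_ ?_⟩
    · intro i
      fin_cases i
      exacts [hb, ha, (tri_perms_zero hr).2.1 r', tri_self_right f e r', tri_self_outer f e r',
        (tri_perms_zero he).2.1 r']
    · change tri f e r' z ≠ 0
      rw [hz]; decide
  have x1 (u v : Fin 7 → ZMod 2) := tri_self_left f u v
  have x2 (u v : Fin 7 → ZMod 2) := tri_self_right f u v
  have x3 (u v : Fin 7 → ZMod 2) := tri_self_outer f u v
  -- One of T(e, a, b), T(e', a, b), T(e + e', a, b) vanishes. The corresponding direction then has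
  -- a radical of dimension at least four, where t corrects a so as to be orthogonal to z as well.
  -- For e + e' the vector r + r' is radical exactly because the two functionals agree.
  rcases zmod_two_cases (tri f e a b) with h0 | h0
  · obtain ⟨t, ht⟩ : ∃ t, tri f e a z = t := ⟨_, rfl⟩
    refine hf.hasTriple_of_four (x := e) (a := e') (b := r) (c := a + t • r') ?_ he hr ?_
    · exact linearIndependent_of_eq_combination hli7 ![![0,0,0,0,0,1,0],![0,0,0,0,0,0,1],![0,0,0,1,0,0,0],![0,0,1,0,t,0,0]]
        (by clear * -; decide +revert) (by intro j; fin_cases j <;> simp [Fin.sum_univ_succ])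
    · apply hf.tri_eq_zero_of_basis hli7 <;>
      simp [hf.tri_add_mid, hf.tri_smul_mid, x1, x2, x3, tri_perms_zero hr, tri_perms_zero he,
        tri_perms pa, tri_perms pb, hz, h0, ht, CharTwo.add_self_eq_zero]
  rcases zmod_two_cases (tri f e' a b) with h0' | h0'
  · obtain ⟨t, ht⟩ : ∃ t, tri f e' a z = t := ⟨_, rfl⟩
    refine hf.hasTriple_of_four (x := e') (a := e) (b := r') (c := a + t • r) ?_
      (tri_perms_zero he).2.2.1 hr' ?_
    · exact linearIndependent_of_eq_combination hli7 ![![0,0,0,0,0,0,1],![0,0,0,0,0,1,0],![0,0,0,0,1,0,0],![0,0,1,t,0,0,0]]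
        (by clear * -; decide +revert) (by intro j; fin_cases j <;> simp [Fin.sum_univ_succ])
    · apply hf.tri_eq_zero_of_basis hli7 <;>
      simp [hf.tri_add_mid, hf.tri_smul_mid, x1, x2, x3, tri_perms_zero hr', tri_perms_zero he,
        tri_perms sa, tri_perms sb, sz, h0', ht, CharTwo.add_self_eq_zero]
  obtain ⟨t, ht⟩ : ∃ t, tri f e a z + tri f e' a z = t := ⟨_, rfl⟩
  refine hf.hasTriple_of_four (x := e + e') (a := e) (b := r + r') (c := a + t • r) ?_ ?_ ?_ ?_
  · exact linearIndependent_of_eq_combination hli7 ![![0,0,0,0,0,1,1],![0,0,0,0,0,1,0],![0,0,0,1,1,0,0],![0,0,1,t,0,0,0]]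
      (by clear * -; decide +revert) (by intro j; fin_cases j <;> simp [Fin.sum_univ_succ])
  · intro y
    simp [hf.tri_add_left, x1, tri_perms_zero he]
  · intro y
    simp [hf.tri_add_left, hf.tri_add_mid, hr, hr', hps, CharTwo.add_self_eq_zero]
  · have ht' : tri f e a z + tri f e' a z + t = 0 := by rw [ht, CharTwo.add_self_eq_zero]
    apply hf.tri_eq_zero_of_basis hli7 <;>
    simp [hf.tri_add_mid, hf.tri_add_left, hf.tri_smul_mid, x1, x2, x3, tri_perms_zero hr',
      tri_perms_zero hr, tri_perms_zero he, tri_perms pa, tri_perms pb,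
      tri_perms sa, tri_perms sb, sz, h0', h0, CharTwo.add_self_eq_zero]
    linear_combination ht'

end Pencil

end BoolFun

/-! ### The explicit trilinear form of a cubic without triples -/

namespace BoolFun

/-- The trilinear form on `𝔽₂⁷` with value one on the triples of basis vectors
`045`, `125`, `136`, `026` and value `t` on `234`. -/
def frameForm (t : ZMod 2) (i j k : Fin 7) : ZMod 2 :=
  -- An index set is encoded by its bit mask: 49, 38, 74, 69 and 28 stand for 045, 125, 136, 026 and
  -- 234. A repeated index leaves fewer than three bits, so the form is alternating.
  if 2 ^ i.val ||| 2 ^ j.val ||| 2 ^ k.val ∈ [49, 38, 74, 69] then 1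
  else if 2 ^ i.val ||| 2 ^ j.val ||| 2 ^ k.val = 28 then t else 0

theorem frameForm_swap_left (t : ZMod 2) (i j k : Fin 7) :
    frameForm t i j k = frameForm t j i k := by
  rw [frameForm, frameForm, Nat.lor_comm (2 ^ i.val)]

theorem frameForm_swap_right (t : ZMod 2) (i j k : Fin 7) :
    frameForm t i j k = frameForm t i k j := by
  rw [frameForm, frameForm, Nat.lor_assoc, Nat.lor_comm (2 ^ j.val), ← Nat.lor_assoc]

theorem frameForm_self (t : ZMod 2) (i k : Fin 7) : frameForm t i i k = 0 := by
  revert t i k; decide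

section Frame

theorem tri_eq_frameForm {M : Type*} [AddCommGroup M] [Module (ZMod 2) M] {f : M → ZMod 2}
    {t : ZMod 2} {v : Fin 7 → M}
    (h : ∀ i j k, i < j → j < k → tri f (v i) (v j) (v k) = frameForm t i j k) (i j k : Fin 7) :
    tri f (v i) (v j) (v k) = frameForm t i j k := by
  have h0 : ∀ i j k, i < j → tri f (v i) (v j) (v k) = frameForm t i j k := by
    intro i j k hij
    rcases lt_trichotomy j k with hjk | rfl | hjk
    · exact h i j k hij hjk
    · rw [tri_self_right, frameForm_swap_left, frameForm_swap_right, frameForm_self]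
    · rcases lt_trichotomy i k with hik | rfl | hik
      · rw [tri_swap_right, frameForm_swap_right, h i k j hik hjk]
      · rw [tri_self_outer, frameForm_swap_right, frameForm_self]
      · rw [← tri_rotate, frameForm_swap_right, frameForm_swap_left, h k i j hik hij]
  rcases lt_trichotomy i j with hij | rfl | hij
  · exact h0 i j k hij
  · rw [tri_self_left, frameForm_self]
  · rw [tri_swap_left, frameForm_swap_left, h0 j i k hij]

variable {f : (Fin 7 → ZMod 2) → ZMod 2}

/-- Every index i lies in one of the four fixed triples whose other two indices a, b occur together
in no other triple, so T(v a, v b, ·) reads off the i-th coordinate, whatever t is. -/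
theorem DegLT.linearIndependent_of_frame (hf : DegLT 4 f) {t : ZMod 2}
    {v : Fin 7 → Fin 7 → ZMod 2}
    (hv : ∀ i j k, tri f (v i) (v j) (v k) = frameForm t i j k) :
    LinearIndependent (ZMod 2) v := by
  rw [Fintype.linearIndependent_iff]
  intro g hg i
  have key : ∀ a b : Fin 7, ∑ k, g k * frameForm t a b k = 0 := by
    intro a b
    have := congrArg (hf.triLin (v a) (v b)) hg
    rw [map_sum, map_zero] at this
    rw [← this]
    refine Finset.sum_congr rfl fun k _ => ?_
    rw [map_smul, smul_eq_mul, ← hv a b k]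
    rfl
  have dual : ∀ i : Fin 7, ∃ a b : Fin 7, ∀ t : ZMod 2, ∀ k,
      frameForm t a b k = if k = i then 1 else 0 := by decide
  obtain ⟨a, b, hab⟩ := dual i
  have := key a b
  simpa [hab t] using this

/-- The pencil is completed to a basis by z, z' dual to the functionals T(e, r', ·), T(e', r, ·) and
by w in both kernels. This fixes T on all triples that contain e or e'. -/
theorem exists_raw_frame (hd : degree f ≤ 3) (hN : ¬ HasTriple f) :
    ∃ z z' w r r' e e' : Fin 7 → ZMod 2,
      (∀ y, tri f e e' y = 0) ∧ (∀ y, tri f e r y = 0) ∧ (∀ y, tri f e' r' y = 0) ∧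
      (bil f e e' = 0 ∧ bil f e r = 1 ∧ bil f e' r' = 1) ∧
      (tri f e r' z = 1 ∧ tri f e r' z' = 0 ∧ tri f e r' w = 0) ∧
      (tri f e' r z = 0 ∧ tri f e' r z' = 1 ∧ tri f e' r w = 0) ∧
      (tri f e w z = 0 ∧ tri f e w z' = 1 ∧ tri f e' w z = 1 ∧ tri f e' w z' = 0) ∧
      tri f e z z' = 0 ∧ tri f e' z z' = 0 := by
  have hf : DegLT 4 f := degLT_of_degree_le hd
  obtain ⟨e, e', r, r', hli, he, hr, hr', bee, ber, ber', hp, hs⟩ := exists_pencil hd hN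
  have hps : ∃ y, tri f e r' y ≠ tri f e' r y := by
    by_contra h
    push Not at h
    exact hN (hf.hasTriple_of_functionals_eq hli he hr hr' hp h)
  obtain ⟨z, pz, sz⟩ := exists_dual_vector (p := hf.triLin e r') (s := hf.triLin e' r) hp hps hs
  obtain ⟨z', sz', pz'⟩ := exists_dual_vector (p := hf.triLin e' r) (s := hf.triLin e r') hs
    (hps.imp fun y hy => hy.symm) hp
  obtain ⟨w, hw, hw'⟩ := exists_mem_notMem_span ![r, r', e, e'] _ (lt_of_lt_of_le (by norm_num)
    (finrank_ker_inf_ge (hf.triLin e r') (hf.triLin e' r)))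
  have pw : tri f e r' w = 0 := hw.1
  have sw : tri f e' r w = 0 := hw.2
  have hpi : ∀ i, hf.triLin e r' (![w, r, r', e, e'] i) = 0 := by
    intro i
    fin_cases i
    exacts [pw, (tri_perms_zero hr).2.1 r', tri_self_right f e r', tri_self_outer f e r',
      (tri_perms_zero he).2.1 r']
  have hsi : ∀ i, hf.triLin e' r (![w, r, r', e, e'] i) = 0 := by
    intro i
    fin_cases i
    exacts [sw, tri_self_right f e' r, (tri_perms_zero hr').2.1 r,
      (tri_perms_zero he).2.2.2.1 r, tri_self_outer f e' r]
  have hli5 : LinearIndependent (ZMod 2) ![w, r, r', e, e'] :=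
    linearIndependent_finCons.2 ⟨hli, hw'⟩
  have hli6 : LinearIndependent (ZMod 2) ![z', w, r, r', e, e'] :=
    linearIndependent_finCons.2 ⟨hli5, notMem_span_of_linearMap (hf.triLin e' r) hsi
      (by rw [sz']; decide)⟩
  have hli7 : LinearIndependent (ZMod 2) ![z, z', w, r, r', e, e'] := by
    refine linearIndependent_finCons.2 ⟨hli6, notMem_span_of_linearMap (hf.triLin e r') ?_
      (by rw [pz]; decide)⟩
    intro i
    refine Fin.cases ?_ (fun i => ?_) i
    · exact pz'
    · exact hpi i
  change tri f e r' z = 1 at pz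
  change tri f e' r z = 0 at sz
  change tri f e r' z' = 0 at pz'
  change tri f e' r z' = 1 at sz'
  obtain ⟨a, ha⟩ : ∃ a, tri f e w z = a := ⟨_, rfl⟩
  obtain ⟨b, hb⟩ : ∃ b, tri f e' w z' = b := ⟨_, rfl⟩
  have x1 (u v : Fin 7 → ZMod 2) := tri_self_left f u v
  have x2 (u v : Fin 7 → ZMod 2) := tri_self_right f u v
  have x3 (u v : Fin 7 → ZMod 2) := tri_self_outer f u v
  -- If T(e, w, z') were 0, then w + a r' + b r would be a further radical vector of e, next to e'
  -- and r, so that `DegLT.hasTriple_of_four` would apply.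
  have c1 : tri f e w z' = 1 := by
    refine (zmod_two_cases _).resolve_left fun h0 => hN ?_
    refine hf.hasTriple_of_four (x := e) (a := e') (b := r) (c := w + (a • r' + b • r)) ?_ he hr ?_
    · exact linearIndependent_of_eq_combination hli7
        ![![0,0,0,0,0,1,0],![0,0,0,0,0,0,1],![0,0,0,1,0,0,0],![0,0,1,b,a,0,0]]
        (by clear * -; decide +revert)
        (by intro j; fin_cases j <;> simp [Fin.sum_univ_succ, add_comm])
    · apply hf.tri_eq_zero_of_basis hli7 <;>
      simp [hf.tri_add_mid, hf.tri_smul_mid, x2, x3, tri_perms_zero hr, tri_perms_zero he,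
        tri_perms pw, tri_perms pz, tri_perms pz', ha, h0, CharTwo.add_self_eq_zero]
  have c2 : tri f e' w z = 1 := by
    refine (zmod_two_cases _).resolve_left fun h0 => hN ?_
    refine hf.hasTriple_of_four (x := e') (a := e) (b := r') (c := w + (a • r' + b • r)) ?_
      (tri_perms_zero he).2.2.1 hr' ?_
    · exact linearIndependent_of_eq_combination hli7
        ![![0,0,0,0,0,0,1],![0,0,0,0,0,1,0],![0,0,0,0,1,0,0],![0,0,1,b,a,0,0]]
        (by clear * -; decide +revert)
        (by intro j; fin_cases j <;> simp [Fin.sum_univ_succ, add_comm])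
    · apply hf.tri_eq_zero_of_basis hli7 <;>
      simp [hf.tri_add_mid, hf.tri_smul_mid, x2, x3, tri_perms_zero hr', tri_perms_zero he,
        tri_perms sw, tri_perms sz, tri_perms sz', hb, h0, CharTwo.add_self_eq_zero]
  obtain ⟨k, hk⟩ : ∃ k, tri f e z z' = k := ⟨_, rfl⟩
  obtain ⟨l, hl⟩ : ∃ l, tri f e' z z' = l := ⟨_, rfl⟩
  -- The correction of w clears T(e, w, z) and T(e', w, z'); that of z clears T(e, z, z') and T(e',
  -- z, z').
  refine ⟨z + (k • (w + (a • r' + b • r)) + l • r), z', w + (a • r' + b • r), r, r', e, e', he, hr,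
    hr', ⟨bee, ber, ber'⟩, ⟨?_, pz', ?_⟩, ⟨?_, sz', ?_⟩, ⟨?_, ?_, ?_, ?_⟩, ?_, ?_⟩ <;>
  simp [hf.tri_add_mid, hf.tri_smul_mid, hf.tri_add_right, hf.tri_smul_right, x2,
    tri_perms_zero hr', tri_perms_zero hr, tri_perms sw, tri_perms sz,
    tri_perms sz', tri_perms pw, tri_perms pz, tri_perms pz', tri_perms ha, tri_perms hb,
    tri_perms c1, tri_perms c2, tri_perms hk, tri_perms hl, CharTwo.add_self_eq_zero]

/-- A cubic function without triples has a basis in normal form. -/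
theorem exists_frame (hd : degree f ≤ 3) (hN : ¬ HasTriple f) :
    ∃ v : Fin 7 → Fin 7 → ZMod 2, (∀ i j k, tri f (v i) (v j) (v k) = frameForm 1 i j k) ∧
      bil f (v 5) (v 6) = 0 ∧ bil f (v 5) (v 3) = 1 ∧ bil f (v 6) (v 4) = 1 := by
  have hf : DegLT 4 f := degLT_of_degree_le hd
  obtain ⟨z, z', w, r, r', e, e', he, hr, hr', ⟨bee, ber, ber'⟩, ⟨pz, pz', pw⟩, ⟨sz, sz', sw⟩,
    ⟨c1, c2, c3, c4⟩, c5, c6⟩ := exists_raw_frame hd hN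
  have x1 (u v : Fin 7 → ZMod 2) := tri_self_left f u v
  have x2 (u v : Fin 7 → ZMod 2) := tri_self_right f u v
  have x3 (u v : Fin 7 → ZMod 2) := tri_self_outer f u v
  obtain ⟨a1, h1⟩ : ∃ a, tri f r r' z = a := ⟨_, rfl⟩
  obtain ⟨a2, h2⟩ : ∃ a, tri f r r' z' = a := ⟨_, rfl⟩
  obtain ⟨a3, h3⟩ : ∃ a, tri f r w z = a := ⟨_, rfl⟩
  obtain ⟨a4, h4⟩ : ∃ a, tri f r w z' = a := ⟨_, rfl⟩
  obtain ⟨a5, h5⟩ : ∃ a, tri f r' w z = a := ⟨_, rfl⟩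
  obtain ⟨a6, h6⟩ : ∃ a, tri f r' w z' = a := ⟨_, rfl⟩
  obtain ⟨b1, h7⟩ : ∃ a, tri f r z z' = a := ⟨_, rfl⟩
  obtain ⟨b2, h8⟩ : ∃ a, tri f r' z z' = a := ⟨_, rfl⟩
  obtain ⟨b3, h9⟩ : ∃ a, tri f w z z' = a := ⟨_, rfl⟩
  obtain ⟨t, ht⟩ : ∃ a, tri f r r' w = a := ⟨_, rfl⟩
  -- Among the ten triples avoiding e and e', multiples of e and e' added to the other five vectors
  -- cancel nine values. Only T(r, r', w) = t is unaffected.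
  set v : Fin 7 → Fin 7 → ZMod 2 := ![z + (b3 • e + b1 • e'), z' + b2 • e,
    w + ((a5 + a2) • e + (a4 + a1) • e'), r + (a1 • e + a3 • e'), r' + (a6 • e + a2 • e'), e, e']
    with hv
  have hfr : ∀ i j k, tri f (v i) (v j) (v k) = frameForm t i j k := by
    apply tri_eq_frameForm
    intro i j k hij hjk
    fin_cases i <;> fin_cases j <;> (try exact absurd hij (by decide)) <;>
    fin_cases k <;> (try exact absurd hjk (by decide)) <;>
    simp [hv, frameForm, hf.tri_add_left, hf.tri_smul_left, hf.tri_add_mid, hf.tri_smul_mid,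
      hf.tri_add_right, hf.tri_smul_right, x1, x2, x3, tri_perms_zero he, tri_perms_zero hr,
      tri_perms_zero hr', tri_perms pz, tri_perms pz', tri_perms pw, tri_perms sz, tri_perms sz',
      tri_perms sw, tri_perms c1, tri_perms c2, tri_perms c3, tri_perms c4, tri_perms c5,
      tri_perms c6, tri_perms h1, tri_perms h2, tri_perms h3, tri_perms h4, tri_perms h5,
      tri_perms h6, tri_perms h7, tri_perms h8, tri_perms h9, tri_perms ht] <;>
    (clear * -; decide +revert)
  have hli := hf.linearIndependent_of_frame hfr
  -- For t = 0 the vector v 3 occurs only in the triple 136, so its radical contains v 2, v 3, v 4,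
  -- v 5.
  have ht1 : t = 1 := by
    refine (zmod_two_cases t).resolve_left fun h0 => hN ?_
    subst h0
    have hz : ∀ a b : Fin 7, (∀ k, frameForm 0 a b k = 0) → ∀ y, tri f (v a) (v b) y = 0 := by
      intro a b hab
      refine linearMap_eq_zero_of_basis hli (hf.triLin (v a) (v b)) fun i => ?_
      exact (hfr a b i).trans (hab i)
    refine hf.hasTriple_of_four (x := v 3) (a := v 5) (b := v 4) (c := v 2) ?_ (hz 3 5 (by decide))
      (hz 3 4 (by decide)) (hz 3 2 (by decide))
    exact linearIndependent_of_eq_combination hli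
        ![![0,0,0,1,0,0,0],![0,0,0,0,0,1,0],![0,0,0,0,1,0,0],![0,0,1,0,0,0,0]] (by decide)
        (by intro j; fin_cases j <;> simp [Fin.sum_univ_succ])
  subst ht1
  refine ⟨v, hfr, bee, ?_, ?_⟩
  · have hb : bil f e (a1 • e + a3 • e') = 0 := by
      rcases zmod_two_cases a1 with h | h <;> rcases zmod_two_cases a3 with h' | h' <;>
        simp [h, h', bil_add_right, bil_self, bee, x1, bil_comm f e 0, bil_zero_left]
    change bil f e (r + (a1 • e + a3 • e')) = 1
    rw [bil_add_right, ber, hb, hr]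
    rfl
  · have hb : bil f e' (a6 • e + a2 • e') = 0 := by
      rcases zmod_two_cases a6 with h | h <;> rcases zmod_two_cases a2 with h' | h' <;>
        simp [h, h', bil_add_right, bil_self, bil_comm f e' e, bee, x3, bil_comm f e' 0, bil_zero_left]
    change bil f e' (r' + (a6 • e + a2 • e')) = 1
    rw [bil_add_right, ber', hb, hr']
    rfl

end Frame

end BoolFun

/-! ### Contradiction from the bilinear values at seventeen points -/

namespace BoolFun

section Points

/-- The variables are the values of B on pairs of frame vectors (z1, z2, w, r1, r2, e, f for indices
0 to 6). The sixteen implications fall into four groups of four, governed by a premise s = 0 or s =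
1. Whichever holds, two conclusions are active, and adding them gives one equation per group (`ea`
to `ed`). With `hc`, the sum of these four equations reads 1 = 0. -/
theorem not_sixteen_points (z1z2 z1w z1r1 z1r2 z1e z1f z2w z2r1 z2r2 z2e z2f wr1 wr2 we wf r1r2 r1f r2e : ZMod 2)
    (h0 : z1r1 = 0 → z1z2 = 1)
    (h1 : z1r1 = 0 → z1z2 + z1w + z1e + z2r1 + wr1 + 1 = 1)
    (h2 : z1r1 + z1f + r1r2 + 1 = 0 → z1z2 + z2r2 = 1)
    (h3 : z1r1 + z1e + z1f + wr1 + we + wf + r1r2 + r1f + r2e + 1 = 0 → z1z2 + z1w + z1r1 + z1r2 + z2w + z2r1 + z2r2 = 1)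
    (h4 : z1r1 + 1 = 0 → z1z2 + z1f + z2e = 1)
    (h5 : z1r1 + 1 = 0 → z1z2 + z1w + z1r1 + z1e + z1f + z2r1 + z2e + wr1 + we + r1f + 1 = 1)
    (h6 : z1r1 + z1f + r1r2 = 0 → z1z2 + z1r1 + z2r2 + z2e + r1r2 + 1 = 1)
    (h7 : z1r1 + z1e + z1f + wr1 + we + wf + r1r2 + r1f + r2e = 0 → z1z2 + z1w + z1r2 + z1e + z2w + z2r1 + z2r2 + z2e + wr1 + r1r2 = 1)
    (h8 : z1r1 + z1e + wr1 + we + r1f = 0 → z1z2 + z1r2 + z2w + z2f + wr2 + 1 = 1)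
    (h9 : z1r1 + z1e + wr1 + we + r1f + 1 = 0 → z1z2 + z1w + z1r1 + z1r2 + z1f + z2w + z2r1 + z2f + wr2 + r1r2 = 1)
    (h10 : z1r1 + z1e + z1f + wr1 + we + wf + r1r2 + r1f + r2e = 0 → z1z2 + z1r2 + z2w + z2r2 + z2f + wr2 + 1 = 1)
    (h11 : z1r1 + z1f + r1r2 + 1 = 0 → z1z2 + z1w + z1e + z2r1 + z2r2 + z2f + wr1 + wr2 + wf + r2e + 1 = 1)
    (h12 : z1r1 + z1e + wr1 + we + r1f + 1 = 0 → z1z2 + z1r2 + z1f + z2w + z2e + z2f + wr2 + wf + r2e = 1)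
    (h13 : z1r1 + z1e + wr1 + we + r1f = 0 → z1z2 + z1w + z1r1 + z1r2 + z2w + z2r1 + z2e + z2f + wr2 + we + wf + r1r2 + r1f + r2e + 1 = 1)
    (h14 : z1r1 + z1e + z1f + wr1 + we + wf + r1r2 + r1f + r2e + 1 = 0 → z1z2 + z1r2 + z1f + z2w + z2r2 + z2e + z2f + wr2 + wf + r2e + 1 = 1)
    (h15 : z1r1 + z1f + r1r2 = 0 → z1z2 + z1w + z1r1 + z1e + z2r1 + z2r2 + z2e + z2f + wr1 + wr2 + we + wf + r1r2 + r1f + r2e + 1 = 1)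
    (hc : we + wf + r1f + r2e = 1) : False := by
  have ea : z1w + z1e + z2r1 + wr1 + 1 + z1r1 * (1 + we + r1f) = 0 := by
    clear h2 h3 h6 h7 h8 h9 h10 h11 h12 h13 h14 h15 hc
    rcases zmod_two_cases z1r1 with h | h <;> grind
  have eb : z1w + z1e + z2r1 + z2f + wr1 + wr2 + wf + r2e + 1
      + (1 + z1r1 + z1f + r1r2) * (1 + we + r1f) = 0 := by
    clear h0 h1 h3 h4 h5 h7 h8 h9 h10 h12 h13 h14 hc ea
    rcases zmod_two_cases (z1r1 + z1f + r1r2) with h | h <;> grind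
  have ec : z1w + z1r1 + z2r1 + r1r2 + z2e + wf + r2e
      + (1 + z1r1 + z1e + wr1 + we + r1f) * (we + r1f) = 0 := by
    clear h0 h1 h2 h3 h4 h5 h6 h7 h10 h11 h14 h15 hc ea eb
    rcases zmod_two_cases (z1r1 + z1e + wr1 + we + r1f) with h | h <;> grind
  have ed : z1w + z1r1 + z2r1 + z1f + z2e + z2f + wr2 + wf + r2e + 1
      + (1 + z1r1 + z1e + z1f + wr1 + we + wf + r1r2 + r1f + r2e) * (we + r1f) = 0 := by
    clear h0 h1 h2 h4 h5 h6 h8 h9 h11 h12 h13 h15 hc ea eb ec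
    rcases zmod_two_cases (z1r1 + z1e + z1f + wr1 + we + wf + r1r2 + r1f + r2e) with h | h <;> grind
  clear h0 h1 h2 h3 h4 h5 h6 h7 h8 h9 h10 h11 h12 h13 h14 h15
  rcases zmod_two_cases (we + r1f) with h | h <;> grind

/-- The trilinear form of a frame on sums of basis vectors. -/
def frameSum (t : ZMod 2) (P Q R : List (Fin 7)) : ZMod 2 :=
  (P.map fun i => (Q.map fun j => (R.map fun k => frameForm t i j k).sum).sum).sum

/-- The defect of biadditivity of `bil` in the second argument. -/
def rowCorrection (t : ZMod 2) (i : Fin 7) : List (Fin 7) → ZMod 2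
  | [] => 0
  | j :: Q => rowCorrection t i Q + frameSum t [i] [j] Q

/-- The defect of biadditivity of `bil` on sums of basis vectors. -/
def bilCorrection (t : ZMod 2) : List (Fin 7) → List (Fin 7) → ZMod 2
  | [], _ => 0
  | i :: P, Q => bilCorrection t P Q + rowCorrection t i Q + frameSum t [i] P Q

variable {f : (Fin 7 → ZMod 2) → ZMod 2} {t : ZMod 2} {v : Fin 7 → Fin 7 → ZMod 2}

theorem DegLT.tri_sum_right (hf : DegLT 4 f) (a b : Fin 7 → ZMod 2) (R : List (Fin 7)) :
    tri f a b (R.map v).sum = (R.map fun k => tri f a b (v k)).sum := by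
  have h := map_list_sum (hf.triLin a b) (R.map v)
  rw [List.map_map] at h
  exact h

theorem DegLT.tri_sum (hf : DegLT 4 f)
    (hv : ∀ i j k, tri f (v i) (v j) (v k) = frameForm t i j k) (P Q R : List (Fin 7)) :
    tri f (P.map v).sum (Q.map v).sum (R.map v).sum = frameSum t P Q R := by
  have h1 : ∀ i j, tri f (v i) (v j) (R.map v).sum = (R.map fun k => frameForm t i j k).sum :=
    fun i j => by rw [hf.tri_sum_right]; simp only [hv]
  have h2 : ∀ i, tri f (v i) (Q.map v).sum (R.map v).sum
      = (Q.map fun j => (R.map fun k => frameForm t i j k).sum).sum :=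
    fun i => by
      rw [tri_swap_right, hf.tri_sum_right]
      simp only [← h1, tri_swap_right f (v i) (R.map v).sum]
  rw [tri_rotate, hf.tri_sum_right]
  simp only [frameSum, ← h2]
  congr 2
  funext i
  rw [tri_rotate, tri_rotate]

theorem DegLT.bil_sum_right (hf : DegLT 4 f)
    (hv : ∀ i j k, tri f (v i) (v j) (v k) = frameForm t i j k) (i : Fin 7) (Q : List (Fin 7)) :
    bil f (v i) (Q.map v).sum
      = (Q.map fun j => bil f (v i) (v j)).sum + rowCorrection t i Q := by
  induction Q with
  | nil => simp [rowCorrection, bil_comm f _ 0, bil_zero_left]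
  | cons j Q ih =>
    have h := hf.tri_sum hv [i] [j] Q
    simp only [List.map_cons, List.map_nil, List.sum_cons, List.sum_nil, add_zero] at h
    simp only [List.map_cons, List.sum_cons, bil_add_right, ih, h, rowCorrection]
    ring

theorem DegLT.bil_sum (hf : DegLT 4 f)
    (hv : ∀ i j k, tri f (v i) (v j) (v k) = frameForm t i j k) (P Q : List (Fin 7)) :
    bil f (P.map v).sum (Q.map v).sum
      = (P.map fun i => (Q.map fun j => bil f (v i) (v j)).sum).sum + bilCorrection t P Q := by
  induction P with
  | nil => simp [bilCorrection, bil_zero_left]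
  | cons i P ih =>
    have h := hf.tri_sum hv [i] P Q
    simp only [List.map_cons, List.map_nil, List.sum_cons, List.sum_nil, add_zero] at h
    simp only [List.map_cons, List.sum_cons, bil_add_left, ih, h, bilCorrection,
      hf.bil_sum_right hv]
    ring

theorem sum_map_eq_sum_count (P : List (Fin 7)) :
    (P.map v).sum = ∑ i, (P.count i : ZMod 2) • v i := by
  induction P with
  | nil => simp
  | cons j P ih =>
    rw [List.map_cons, List.sum_cons, ih]
    simp only [List.count_cons, Nat.cast_add, add_smul, Finset.sum_add_distrib, beq_iff_eq,
      Nat.cast_ite, Nat.cast_one, Nat.cast_zero, ite_smul, one_smul, zero_smul,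
      Finset.sum_ite_eq, Finset.mem_univ, if_true]
    rw [add_comm]

/-- The sums over Q and R are radical vectors of the sum over P. If B vanished on both, the three
vectors would be a triple. The constants c, d are the defects of biadditivity of B on these sums. -/
theorem DegLT.bil_eq_one_of_bil_eq_zero (hf : DegLT 4 f) (hN : ¬ HasTriple f)
    (hv : ∀ i j k, tri f (v i) (v j) (v k) = frameForm t i j k) (P Q R : List (Fin 7))
    (c d : ZMod 2) (hc : bilCorrection t P Q = c) (hd : bilCorrection t P R = d)
    (hQ : ∀ k, frameSum t P Q [k] = 0) (hR : ∀ k, frameSum t P R [k] = 0)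
    (hli : LinearIndependent (ZMod 2) ![fun i : Fin 7 => (P.count i : ZMod 2),
      fun i : Fin 7 => (Q.count i : ZMod 2), fun i : Fin 7 => (R.count i : ZMod 2)])
    (h : (P.map fun i => (Q.map fun j => bil f (v i) (v j)).sum).sum + c = 0) :
    (P.map fun i => (R.map fun j => bil f (v i) (v j)).sum).sum + d = 1 := by
  rw [← hc, ← hf.bil_sum hv] at h
  rw [← hd, ← hf.bil_sum hv]
  have hz : ∀ Q : List (Fin 7), (∀ k, frameSum t P Q [k] = 0) →
      ∀ y, tri f (P.map v).sum (Q.map v).sum y = 0 := by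
    intro Q hQ
    refine linearMap_eq_zero_of_basis (hf.linearIndependent_of_frame hv)
      (hf.triLin _ _) fun i => ?_
    have := hf.tri_sum hv P Q [i]
    simp only [List.map_cons, List.map_nil, List.sum_cons, List.sum_nil, add_zero] at this
    exact this.trans (hQ i)
  refine (zmod_two_cases _).resolve_left fun h0 => hN ?_
  refine hf.hasTriple ?_ (hz Q hQ) (hz R hR) h h0
  refine linearIndependent_of_eq_combination (hf.linearIndependent_of_frame hv) _ hli ?_
  intro j
  fin_cases j <;> exact sum_map_eq_sum_count _

/-- Every cubic function in seven variables has a triple. -/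
theorem hasTriple_of_degree_le (hd : degree f ≤ 3) : HasTriple f := by
  by_contra hN
  have hf : DegLT 4 f := degLT_of_degree_le hd
  obtain ⟨v, hv, h56, h53, h64⟩ := exists_frame hd hN
  have key := hf.bil_eq_one_of_bil_eq_zero hN hv
  -- At v 5 + v 6 the premise is B(v 5, v 6) = 0, which the frame provides, so this point yields an
  -- unconditional equation.
  have hc := key [5, 6] [5] [2, 3, 4] 0 0 (by decide) (by decide) (by decide)
    (by decide) (by decide)
  -- The sixteen points are v 0 + α v 3 + β v 4 + γ v 5 + δ v 6 + (αβ + δ) v 2, each with two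
  -- explicit further radical vectors.
  have h0 := key [0] [3] [1] 0 0 (by decide) (by decide) (by decide)
    (by decide) (by decide)
  have h1 := key [0, 3] [3] [1, 2, 5] 0 0 (by decide) (by decide) (by decide)
    (by decide) (by decide)
  have h2 := key [0, 4] [3, 6] [1] 0 0 (by decide) (by decide) (by decide)
    (by decide) (by decide)
  have h3 := key [0, 2, 3, 4] [3, 5, 6] [0, 1] 1 0 (by decide) (by decide) (by decide)
    (by decide) (by decide)
  have h4 := key [0, 5] [3] [1, 6] 0 0 (by decide) (by decide) (by decide)
    (by decide) (by decide)
  have h5 := key [0, 3, 5] [3] [0, 1, 2, 6] 0 1 (by decide) (by decide) (by decide)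
    (by decide) (by decide)
  have h6 := key [0, 4, 5] [3, 6] [1, 3] 0 0 (by decide) (by decide) (by decide)
    (by decide) (by decide)
  have h7 := key [0, 2, 3, 4, 5] [3, 5, 6] [0, 1, 3] 1 1 (by decide) (by decide) (by decide)
    (by decide) (by decide)
  have h8 := key [0, 2, 6] [3, 5] [1, 4] 0 0 (by decide) (by decide) (by decide)
    (by decide) (by decide)
  have h9 := key [0, 2, 3, 6] [3, 5] [0, 1, 4] 0 1 (by decide) (by decide) (by decide)
    (by decide) (by decide)
  have h10 := key [0, 2, 4, 6] [3, 5, 6] [1, 4] 1 0 (by decide) (by decide) (by decide)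
    (by decide) (by decide)
  have h11 := key [0, 3, 4, 6] [3, 6] [1, 2, 5] 0 0 (by decide) (by decide) (by decide)
    (by decide) (by decide)
  have h12 := key [0, 2, 5, 6] [3, 5] [1, 4, 6] 0 1 (by decide) (by decide) (by decide)
    (by decide) (by decide)
  have h13 := key [0, 2, 3, 5, 6] [3, 5] [1, 2, 3, 4] 0 1 (by decide) (by decide) (by decide)
    (by decide) (by decide)
  have h14 := key [0, 2, 4, 5, 6] [3, 5, 6] [1, 4, 6] 1 1 (by decide) (by decide) (by decide)
    (by decide) (by decide)
  have h15 := key [0, 3, 4, 5, 6] [3, 6] [1, 2, 3, 5] 0 1 (by decide) (by decide) (by decide)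
    (by decide) (by decide)
  clear key
  have hβ : ∀ i j, j < i → bil f (v i) (v j) = bil f (v j) (v i) := fun i j _ => bil_comm f _ _
  have hβ0 : ∀ i, bil f (v i) (v i) = 0 := fun i => bil_self f _
  rw [bil_comm] at h53 h64
  generalize hbeta : (fun i j => bil f (v i) (v j)) = β
  have hb : ∀ i j, bil f (v i) (v j) = β i j := fun i j => by rw [← hbeta]
  simp only [hb] at *
  clear hbeta hb hN hf hv hd
  simp only [List.map_cons, List.map_nil, List.sum_cons, List.sum_nil, add_zero, hβ0, h56, h53, h64,
    hβ 2 0 (by decide), hβ 3 0 (by decide), hβ 4 0 (by decide),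
    hβ 5 0 (by decide), hβ 6 0 (by decide), hβ 2 1 (by decide), hβ 3 1 (by decide),
    hβ 4 1 (by decide), hβ 5 1 (by decide), hβ 6 1 (by decide), hβ 3 2 (by decide),
    hβ 4 2 (by decide), hβ 5 2 (by decide), hβ 6 2 (by decide), hβ 4 3 (by decide),
    hβ 5 3 (by decide), hβ 6 3 (by decide), hβ 5 4 (by decide), hβ 6 4 (by decide),
    hβ 6 5 (by decide)] at h0 h1 h2 h3 h4 h5 h6 h7 h8 h9 h10 h11 h12 h13 h14 h15 hc
  clear hβ hβ0 h56 h53 h64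
  refine not_sixteen_points (β 0 1) (β 0 2) (β 0 3) (β 0 4) (β 0 5) (β 0 6) (β 1 2) (β 1 3) (β 1 4) (β 1 5) (β 1 6) (β 2 3) (β 2 4) (β 2 5) (β 2 6) (β 3 4) (β 3 6) (β 4 5) ?_ ?_ ?_ ?_ ?_ ?_ ?_ ?_ ?_ ?_ ?_ ?_ ?_ ?_ ?_ ?_ ?_
  · clear h1 h2 h3 h4 h5 h6 h7 h8 h9 h10 h11 h12 h13 h14 h15 hc
    grind
  · clear h0 h2 h3 h4 h5 h6 h7 h8 h9 h10 h11 h12 h13 h14 h15 hc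
    grind
  · clear h0 h1 h3 h4 h5 h6 h7 h8 h9 h10 h11 h12 h13 h14 h15 hc
    grind
  · clear h0 h1 h2 h4 h5 h6 h7 h8 h9 h10 h11 h12 h13 h14 h15 hc
    grind
  · clear h0 h1 h2 h3 h5 h6 h7 h8 h9 h10 h11 h12 h13 h14 h15 hc
    grind
  · clear h0 h1 h2 h3 h4 h6 h7 h8 h9 h10 h11 h12 h13 h14 h15 hc
    grind
  · clear h0 h1 h2 h3 h4 h5 h7 h8 h9 h10 h11 h12 h13 h14 h15 hc
    grind
  · clear h0 h1 h2 h3 h4 h5 h6 h8 h9 h10 h11 h12 h13 h14 h15 hc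
    grind
  · clear h0 h1 h2 h3 h4 h5 h6 h7 h9 h10 h11 h12 h13 h14 h15 hc
    grind
  · clear h0 h1 h2 h3 h4 h5 h6 h7 h8 h10 h11 h12 h13 h14 h15 hc
    grind
  · clear h0 h1 h2 h3 h4 h5 h6 h7 h8 h9 h11 h12 h13 h14 h15 hc
    grind
  · clear h0 h1 h2 h3 h4 h5 h6 h7 h8 h9 h10 h12 h13 h14 h15 hc
    grind
  · clear h0 h1 h2 h3 h4 h5 h6 h7 h8 h9 h10 h11 h13 h14 h15 hc
    grind
  · clear h0 h1 h2 h3 h4 h5 h6 h7 h8 h9 h10 h11 h12 h14 h15 hc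
    grind
  · clear h0 h1 h2 h3 h4 h5 h6 h7 h8 h9 h10 h11 h12 h13 h15 hc
    grind
  · clear h0 h1 h2 h3 h4 h5 h6 h7 h8 h9 h10 h11 h12 h13 h14 hc
    grind
  · clear h0 h1 h2 h3 h4 h5 h6 h7 h8 h9 h10 h11 h12 h13 h14 h15
    grind

end Points

end BoolFun

namespace BoolFun

/-! ### Affine functions on flats -/

section Flats

variable {M : Type*} [AddCommGroup M] [Module (ZMod 2) M] {f : M → ZMod 2}

/-- `f` is affine on the flat through `y` with the directions `v`. -/
def AffineOn {n : ℕ} (f : M → ZMod 2) (y : M) (v : Fin n → M) : Prop :=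
  ∃ c : Fin n → ZMod 2, ∀ t : Fin n → ZMod 2, f (y + ∑ i, t i • v i) = f y + ∑ i, t i * c i

-- With the mixed second derivatives at y and the third derivative all zero, the expansion of f
-- along the flat has only its constant and linear terms.
set_option linter.unusedSimpArgs false in
theorem DegLT.affineOn_three (hf : DegLT 4 f) {y a b c : M} (hT : tri f a b c = 0)
    (hab : bil f a b + tri f a b y = 0) (hac : bil f a c + tri f a c y = 0)
    (hbc : bil f b c + tri f b c y = 0) : AffineOn f y ![a, b, c] := by
  have h3 := hf.diff_three a b c y
  rw [← hf.diff_two] at hab hac hbc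
  rw [hT] at h3
  refine ⟨![BoolFun.diff a f y, BoolFun.diff b f y, BoolFun.diff c f y], fun t => ?_⟩
  simp only [BoolFun.diff] at h3 hab hac hbc
  simp only [Fin.sum_univ_succ, Fin.sum_univ_zero, Matrix.cons_val_zero, Matrix.cons_val_succ,
    BoolFun.diff, add_zero]
  have e1 : y + b + a = y + (a + b) := by abel
  have e2 : y + c + a = y + (a + c) := by abel
  have e3 : y + c + b = y + (b + c) := by abel
  have e4 : y + (b + c) + a = y + (a + (b + c)) := by abel
  have e5 : y + a + c = y + (a + c) := by abel
  have e6 : y + a + b = y + (a + b) := by abel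
  simp only [e1, e2, e3, e4, e5, e6] at h3 hab hac hbc
  rcases zmod_two_cases (t 0) with h0 | h0 <;>
  rcases zmod_two_cases (t (Fin.succ 0)) with h1 | h1 <;>
  rcases zmod_two_cases (t (Fin.succ (Fin.succ 0))) with h2 | h2 <;>
  simp only [h0, h1, h2, zero_smul, one_smul, zero_add, add_zero, zero_mul, one_mul] <;>
  clear h0 h1 h2 e1 e2 e3 e4 e5 e6 hT <;> grind

theorem AffineOn.of_comp {N : Type*} [AddCommGroup N] [Module (ZMod 2) N] {n : ℕ} {x : M}
    (L : N →ₗ[ZMod 2] M) {y : N} {v : Fin n → N} (h : AffineOn (fun t => f (x + L t)) y v) :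
    AffineOn f (x + L y) (L ∘ v) := by
  obtain ⟨c, hc⟩ := h
  refine ⟨c, fun t => ?_⟩
  have h := hc t
  simpa only [map_add, map_sum, map_smul, Function.comp_apply, add_assoc] using h

/-- If D_e f is constant on the flat, f differs on the translate by e only by that constant. -/
theorem AffineOn.cons {n : ℕ} {y : M} {v : Fin n → M} (h : AffineOn f y v) {e : M} {k : ZMod 2}
    (he : ∀ t : Fin n → ZMod 2, diff e f (y + ∑ i, t i • v i) = k) :
    AffineOn f y (Fin.cons e v : Fin (n + 1) → M) := by
  obtain ⟨c, hc⟩ := h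
  refine ⟨Fin.cons k c, fun t => ?_⟩
  have h1 := hc (Fin.tail t)
  have h2 := he (Fin.tail t)
  simp only [Fin.tail] at h1 h2
  simp only [Fin.sum_univ_succ, Fin.cons_zero, Fin.cons_succ]
  rcases zmod_two_cases (t 0) with h0 | h0 <;> simp only [h0, zero_smul, one_smul, zero_mul, one_mul, zero_add]
  · exact h1
  · rw [diff, h1] at h2
    rw [add_comm e, ← add_assoc]
    clear hc he h0 h1
    grind

/-- Moving the base point along r changes D_p D_q f, since T(p, q, r) = 1, while the other two mixed
derivatives stay zero. So the base point can be chosen to kill all three. -/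
theorem DegLT.affineOn_of_tri_eq_one (hf : DegLT 4 f) {p q r w : M}
    (hT : tri f p q r = 1) (hpq : tri f w p q = 0) (hpr : tri f w p r = 0)
    (hqr : tri f w q r = 0) (hp : bil f w p = 0) (hq : bil f w q = 0) :
    ∃ y, AffineOn f y ![w, p, q] := by
  refine ⟨bil f p q • r, hf.affineOn_three hpq ?_ ?_ ?_⟩
  · rw [hf.tri_smul_right, hpr, hp, mul_zero, add_zero]
  · rw [hf.tri_smul_right, hqr, hq, mul_zero, add_zero]
  · rw [hf.tri_smul_right, hT, mul_one, CharTwo.add_self_eq_zero]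

-- Correcting d by a, b, c makes T(w, ·, ·) vanish on their span. There B(w, ·) is linear, so its
-- kernel contains independent p, q; with r completing them, T(p, q, r) = 1 and
-- `DegLT.affineOn_of_tri_eq_one` applies.
set_option linter.unusedSimpArgs false in
theorem DegLT.exists_affineOn_three (hf : DegLT 4 f) {a b c d : M}
    (hv : LinearIndependent (ZMod 2) ![a, b, c, d]) (hT : tri f a b c = 1) :
    ∃ (y : M) (v : Fin 3 → M), LinearIndependent (ZMod 2) v ∧ AffineOn f y v := by
  obtain ⟨w, hw, hab, hac, hbc⟩ : ∃ w, LinearIndependent (ZMod 2) ![a, b, c, w] ∧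
      tri f w a b = 0 ∧ tri f w a c = 0 ∧ tri f w b c = 0 := by
    refine ⟨d + tri f d b c • a + tri f a d c • b + tri f a b d • c, ?_, ?_, ?_, ?_⟩
    · refine linearIndependent_of_eq_combination hv
        ![![1,0,0,0],![0,1,0,0],![0,0,1,0],![tri f d b c, tri f a d c, tri f a b d, 1]] ?_ ?_
      · generalize tri f d b c = α
        generalize tri f a d c = β
        generalize tri f a b d = γ
        clear * -
        decide +revert
      · intro j
        fin_cases j <;> simp [Fin.sum_univ_succ]
        abel
    · have h1 := tri_perms hT
      have h2 := tri_perms (f := f) (a := a) (b := b) (c := d) rfl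
      simp only [hf.tri_add_left, hf.tri_smul_left, tri_self_left, tri_self_outer, h1, h2,
        tri_self_right]
      clear * -
      grind
    · have h1 := tri_perms hT
      have h2 := tri_perms (f := f) (a := a) (b := d) (c := c) rfl
      simp only [hf.tri_add_left, hf.tri_smul_left, tri_self_left, tri_self_outer, h1, h2,
        tri_self_right]
      clear * -
      grind
    · have h1 := tri_perms hT
      have h2 := tri_perms (f := f) (a := d) (b := b) (c := c) rfl
      simp only [hf.tri_add_left, hf.tri_smul_left, tri_self_left, tri_self_outer, h1, h2,
        tri_self_right]
      clear * -
      grind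
  have key : ∀ A : Fin 3 → Fin 4 → ZMod 2, LinearIndependent (ZMod 2) A → ∀ p q r,
      w = ∑ i, A 0 i • ![a, b, c, w] i → p = ∑ i, A 1 i • ![a, b, c, w] i →
      q = ∑ i, A 2 i • ![a, b, c, w] i → tri f p q r = 1 → tri f w p q = 0 → tri f w p r = 0 →
      tri f w q r = 0 → bil f w p = 0 → bil f w q = 0 →
      ∃ (y : M) (v : Fin 3 → M), LinearIndependent (ZMod 2) v ∧ AffineOn f y v := by
    intro A hA p q r hw' hp hq h1 h2 h3 h4 h5 h6
    obtain ⟨y, hy⟩ := hf.affineOn_of_tri_eq_one h1 h2 h3 h4 h5 h6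
    refine ⟨y, _, linearIndependent_of_eq_combination hw A hA ?_, hy⟩
    intro j
    fin_cases j
    exacts [hw', hp, hq]
  have h1 := tri_perms hT
  have h2 := tri_perms hab
  have h3 := tri_perms hac
  have h4 := tri_perms hbc
  have e1 : (1 : ZMod 2) + 1 = 0 := rfl
  rcases zmod_two_cases (bil f w a) with la | la <;>
  rcases zmod_two_cases (bil f w b) with lb | lb <;>
  rcases zmod_two_cases (bil f w c) with lc | lc
  · refine key ![![0,0,0,1],![1,0,0,0],![0,1,0,0]] (by decide) a b c ?_ ?_ ?_ ?_ ?_ ?_ ?_ ?_ ?_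
    all_goals simp [Fin.sum_univ_succ, hf.tri_add_mid, hf.tri_add_left, hf.tri_add_right,
      bil_add_right, tri_self_left, tri_self_outer, tri_self_right, h1, h2, h3, h4, la, lb, lc, e1]
  · refine key ![![0,0,0,1],![1,0,0,0],![0,1,0,0]] (by decide) a b c ?_ ?_ ?_ ?_ ?_ ?_ ?_ ?_ ?_
    all_goals simp [Fin.sum_univ_succ, hf.tri_add_mid, hf.tri_add_left, hf.tri_add_right,
      bil_add_right, tri_self_left, tri_self_outer, tri_self_right, h1, h2, h3, h4, la, lb, lc, e1]
  · refine key ![![0,0,0,1],![1,0,0,0],![0,0,1,0]] (by decide) a c b ?_ ?_ ?_ ?_ ?_ ?_ ?_ ?_ ?_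
    all_goals simp [Fin.sum_univ_succ, hf.tri_add_mid, hf.tri_add_left, hf.tri_add_right,
      bil_add_right, tri_self_left, tri_self_outer, tri_self_right, h1, h2, h3, h4, la, lb, lc, e1]
  · refine key ![![0,0,0,1],![1,0,0,0],![0,1,1,0]] (by decide) a (b + c) c ?_ ?_ ?_ ?_ ?_ ?_ ?_ ?_ ?_
    all_goals simp [Fin.sum_univ_succ, hf.tri_add_mid, hf.tri_add_left, hf.tri_add_right,
      bil_add_right, tri_self_left, tri_self_outer, tri_self_right, h1, h2, h3, h4, la, lb, lc, e1]
  · refine key ![![0,0,0,1],![0,1,0,0],![0,0,1,0]] (by decide) b c a ?_ ?_ ?_ ?_ ?_ ?_ ?_ ?_ ?_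
    all_goals simp [Fin.sum_univ_succ, hf.tri_add_mid, hf.tri_add_left, hf.tri_add_right,
      bil_add_right, tri_self_left, tri_self_outer, tri_self_right, h1, h2, h3, h4, la, lb, lc, e1]
  · refine key ![![0,0,0,1],![0,1,0,0],![1,0,1,0]] (by decide) b (a + c) a ?_ ?_ ?_ ?_ ?_ ?_ ?_ ?_ ?_
    all_goals simp [Fin.sum_univ_succ, hf.tri_add_mid, hf.tri_add_left, hf.tri_add_right,
      bil_add_right, tri_self_left, tri_self_outer, tri_self_right, h1, h2, h3, h4, la, lb, lc, e1]
  · refine key ![![0,0,0,1],![0,0,1,0],![1,1,0,0]] (by decide) c (a + b) a ?_ ?_ ?_ ?_ ?_ ?_ ?_ ?_ ?_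
    all_goals simp [Fin.sum_univ_succ, hf.tri_add_mid, hf.tri_add_left, hf.tri_add_right,
      bil_add_right, tri_self_left, tri_self_outer, tri_self_right, h1, h2, h3, h4, la, lb, lc, e1]
  · refine key ![![0,0,0,1],![1,1,0,0],![1,0,1,0]] (by decide) (a + b) (a + c) a ?_ ?_ ?_ ?_ ?_ ?_ ?_ ?_ ?_
    all_goals simp [Fin.sum_univ_succ, hf.tri_add_mid, hf.tri_add_left, hf.tri_add_right,
      bil_add_right, tri_self_left, tri_self_outer, tri_self_right, h1, h2, h3, h4, la, lb, lc, e1]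

end Flats

/-! ### Cubic and quadratic functions of four variables -/

section Four

/-- The matrix with complementary entries b23, b13, … multiplies β to the Pfaffian times the
identity, so its rows are radical when the Pfaffian is 0. If β ≠ 0 two of its rows are independent.
The list runs over the six pairs of rows, completed by unit vectors, and the identity serves β = 0.
-/
theorem exists_radical_four (β : Fin 4 → Fin 4 → ZMod 2) (h0 : ∀ i, β i i = 0)
    (hs : ∀ i j, β i j = β j i)
    (hP : β 0 1 * β 2 3 + β 0 2 * β 1 3 + β 0 3 * β 1 2 = 0) :
    ∃ A : Fin 4 → Fin 4 → ZMod 2, LinearIndependent (ZMod 2) A ∧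
      (∀ j, ∑ k, A 0 k * β k j = 0) ∧ ∀ j, ∑ k, A 1 k * β k j = 0 := by
  have key : ∀ b01 b02 b03 b12 b13 b23 : ZMod 2, b01 * b23 + b02 * b13 + b03 * b12 = 0 →
      ∃ A ∈ [![![0, b23, b13, b12], ![b23, 0, b03, b02], ![0, 0, 1, 0], ![0, 0, 0, 1]],
        ![![0, b23, b13, b12], ![b13, b03, 0, b01], ![0, 1, 0, 0], ![0, 0, 0, 1]],
        ![![0, b23, b13, b12], ![b12, b02, b01, 0], ![0, 1, 0, 0], ![0, 0, 1, 0]],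
        ![![b23, 0, b03, b02], ![b13, b03, 0, b01], ![1, 0, 0, 0], ![0, 0, 0, 1]],
        ![![b23, 0, b03, b02], ![b12, b02, b01, 0], ![1, 0, 0, 0], ![0, 0, 1, 0]],
        ![![b13, b03, 0, b01], ![b12, b02, b01, 0], ![1, 0, 0, 0], ![0, 1, 0, 0]],
        ![![1, 0, 0, 0], ![0, 1, 0, 0], ![0, 0, 1, 0], ![0, 0, 0, 1]]],
      LinearIndependent (ZMod 2) A ∧
        (∀ j, ∑ k, A 0 k * (![![0, b01, b02, b03], ![b01, 0, b12, b13], ![b02, b12, 0, b23],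
          ![b03, b13, b23, 0]] : Fin 4 → Fin 4 → ZMod 2) k j = 0) ∧
        ∀ j, ∑ k, A 1 k * (![![0, b01, b02, b03], ![b01, 0, b12, b13], ![b02, b12, 0, b23],
          ![b03, b13, b23, 0]] : Fin 4 → Fin 4 → ZMod 2) k j = 0 := by
    decide
  have hβ : (![![0, β 0 1, β 0 2, β 0 3], ![β 0 1, 0, β 1 2, β 1 3], ![β 0 2, β 1 2, 0, β 2 3],
      ![β 0 3, β 1 3, β 2 3, 0]] : Fin 4 → Fin 4 → ZMod 2) = β := by
    funext i j
    fin_cases i <;> fin_cases j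
    exacts [(h0 0).symm, rfl, rfl, rfl, hs 0 1, (h0 1).symm, rfl, rfl, hs 0 2, hs 1 2, (h0 2).symm,
      rfl, hs 0 3, hs 1 3, hs 2 3, (h0 3).symm]
  obtain ⟨A, -, hA⟩ := key _ _ _ _ _ _ hP
  rw [hβ] at hA
  exact ⟨A, hA⟩

theorem linearMap_eq_sum {n : ℕ} (φ : (Fin n → ZMod 2) →ₗ[ZMod 2] ZMod 2) (x : Fin n → ZMod 2) :
    φ x = ∑ i, x i * φ (Pi.single i 1) := by
  rw [LinearMap.pi_apply_eq_sum_univ φ x]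
  refine Finset.sum_congr rfl fun i _ => ?_
  rw [smul_eq_mul]
  congr 2
  funext j
  simp [Pi.single_apply, eq_comm]

theorem DegLT.tri_eq_zero {M : Type*} [AddCommGroup M] {f : M → ZMod 2} (hf : DegLT 3 f)
    (a b c : M) : tri f a b c = 0 := by
  have : BoolFun.diff a (BoolFun.diff b (BoolFun.diff c f)) = 0 := hf c b a
  rw [tri, this]; rfl

theorem DegLT.bil_add_left {M : Type*} [AddCommGroup M] {f : M → ZMod 2} (hf : DegLT 3 f)
    (a a' b : M) : bil f (a + a') b = bil f a b + bil f a' b := by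
  rw [BoolFun.bil_add_left, hf.tri_eq_zero, add_zero]

theorem DegLT.bil_add_right {M : Type*} [AddCommGroup M] {f : M → ZMod 2} (hf : DegLT 3 f)
    (a b b' : M) : bil f a (b + b') = bil f a b + bil f a b' := by
  rw [BoolFun.bil_add_right, hf.tri_eq_zero, add_zero]

theorem DegLT.bil_eq_sum {n : ℕ} {h : (Fin n → ZMod 2) → ZMod 2} (hh : DegLT 3 h)
    (a b : Fin n → ZMod 2) :
    bil h a b = ∑ i, ∑ j, a i * b j * bil h (Pi.single i 1) (Pi.single j 1) := by
  have h1 (b) := linearMap_eq_sum (AddMonoidHom.toZModLinearMap 2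
    (AddMonoidHom.mk' (fun a => bil h a b) fun a a' => hh.bil_add_left a a' b)) a
  have h2 (a) := linearMap_eq_sum (AddMonoidHom.toZModLinearMap 2
    (AddMonoidHom.mk' (fun b => bil h a b) fun b b' => hh.bil_add_right a b b')) b
  refine (h1 b).trans (Finset.sum_congr rfl fun i _ => ?_)
  refine (congrArg (a i * ·) (h2 (Pi.single i 1))).trans ?_
  simp only [Finset.mul_sum, mul_assoc]
  rfl

theorem DegLT.degLT_three {n : ℕ} {h : (Fin n → ZMod 2) → ZMod 2} (hh : DegLT 4 h)
    (hT : ∀ i j k : Fin n, tri h (Pi.single i 1) (Pi.single j 1) (Pi.single k 1) = 0) :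
    DegLT 3 h := by
  have h1 (i j c) : tri h (Pi.single i 1) (Pi.single j 1) c = 0 := by
    refine (linearMap_eq_sum (hh.triLin _ _) c).trans (Finset.sum_eq_zero fun k _ => ?_)
    exact (congrArg (c k * ·) (hT i j k)).trans (mul_zero _)
  have h2 (i b c) : tri h (Pi.single i 1) b c = 0 := by
    rw [tri_swap_right]
    refine (linearMap_eq_sum (hh.triLin _ _) b).trans (Finset.sum_eq_zero fun k _ => ?_)
    refine (congrArg (b k * ·) ?_).trans (mul_zero _)
    exact (tri_swap_right _ _ _ _).trans (h1 i k c)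
  intro a b c
  funext x
  refine (hh.diff_three c b a x).trans ?_
  refine (linearMap_eq_sum (hh.triLin _ _) a).trans (Finset.sum_eq_zero fun k _ => ?_)
  refine (congrArg (a k * ·) ?_).trans (mul_zero _)
  exact (tri_rotate _ _ _ _).symm.trans (h2 k c b)

/-- The Pfaffian of the bilinear form of a function of four variables. -/
def pfaffian (h : (Fin 4 → ZMod 2) → ZMod 2) : ZMod 2 :=
  bil h (Pi.single 0 1) (Pi.single 1 1) * bil h (Pi.single 2 1) (Pi.single 3 1) +
    bil h (Pi.single 0 1) (Pi.single 2 1) * bil h (Pi.single 1 1) (Pi.single 3 1) +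
    bil h (Pi.single 0 1) (Pi.single 3 1) * bil h (Pi.single 1 1) (Pi.single 2 1)

theorem DegLT.exists_radical_four {h : (Fin 4 → ZMod 2) → ZMod 2} (hh : DegLT 3 h)
    (hP : pfaffian h = 0) :
    ∃ a b c d : Fin 4 → ZMod 2, LinearIndependent (ZMod 2) ![a, b, c, d] ∧
      (∀ x, bil h a x = 0) ∧ ∀ x, bil h b x = 0 := by
  obtain ⟨A, hA, h0, h1⟩ := BoolFun.exists_radical_four
    (fun i j => bil h (Pi.single i 1) (Pi.single j 1)) (fun i => bil_self _ _)
    (fun i j => bil_comm _ _ _) hP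
  refine ⟨A 0, A 1, A 2, A 3, ?_, fun x => ?_, fun x => ?_⟩
  · rwa [show ![A 0, A 1, A 2, A 3] = A by funext i; fin_cases i <;> rfl]
  · rw [hh.bil_eq_sum, Finset.sum_comm]
    refine Finset.sum_eq_zero fun j _ => ?_
    rw [← mul_zero (x j), ← h0 j, Finset.mul_sum]
    exact Finset.sum_congr rfl fun i _ => by ring
  · rw [hh.bil_eq_sum, Finset.sum_comm]
    refine Finset.sum_eq_zero fun j _ => ?_
    rw [← mul_zero (x j), ← h1 j, Finset.mul_sum]
    exact Finset.sum_congr rfl fun i _ => by ring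

/-- A cubic function of four variables is affine on a three-dimensional flat or quadratic and
bent. -/
theorem DegLT.affineOn_three_or {h : (Fin 4 → ZMod 2) → ZMod 2} (hh : DegLT 4 h) :
    (∃ (y : Fin 4 → ZMod 2) (v : Fin 3 → Fin 4 → ZMod 2), LinearIndependent (ZMod 2) v ∧
      AffineOn h y v) ∨ (DegLT 3 h ∧ pfaffian h = 1) := by
  rcases zmod_two_cases (tri h (Pi.single 0 1) (Pi.single 1 1) (Pi.single 2 1)) with t1 | t1
  swap
  · exact .inl (hh.exists_affineOn_three (d := Pi.single 3 1) (by decide) t1)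
  rcases zmod_two_cases (tri h (Pi.single 0 1) (Pi.single 1 1) (Pi.single 3 1)) with t2 | t2
  swap
  · exact .inl (hh.exists_affineOn_three (d := Pi.single 2 1) (by decide) t2)
  rcases zmod_two_cases (tri h (Pi.single 0 1) (Pi.single 2 1) (Pi.single 3 1)) with t3 | t3
  swap
  · exact .inl (hh.exists_affineOn_three (d := Pi.single 1 1) (by decide) t3)
  rcases zmod_two_cases (tri h (Pi.single 1 1) (Pi.single 2 1) (Pi.single 3 1)) with t4 | t4
  swap
  · exact .inl (hh.exists_affineOn_three (d := Pi.single 0 1) (by decide) t4)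
  have h3 : DegLT 3 h := by
    refine hh.degLT_three fun i j k => ?_
    have p1 := tri_perms t1
    have p2 := tri_perms t2
    have p3 := tri_perms t3
    have p4 := tri_perms t4
    fin_cases i <;> fin_cases j <;> fin_cases k <;>
      simp [tri_self_left, tri_self_right, tri_self_outer, p1, p2, p3, p4]
  rcases zmod_two_cases (pfaffian h) with hP | hP
  -- Two radical vectors and any third direction span a totally isotropic hyperplane.
  · obtain ⟨a, b, c, d, hl, ha, hb⟩ := h3.exists_radical_four hP
    refine .inl ⟨0, ![a, b, c], ?_, hh.affineOn_three (h3.tri_eq_zero _ _ _) ?_ ?_ ?_⟩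
    · exact linearIndependent_of_eq_combination hl ![![1,0,0,0],![0,1,0,0],![0,0,1,0]]
        (by decide) (by intro j; fin_cases j <;> simp [Fin.sum_univ_succ])
    · rw [h3.tri_eq_zero, ha, add_zero]
    · rw [h3.tri_eq_zero, ha, add_zero]
    · rw [h3.tri_eq_zero, hb, add_zero]
  · exact .inr ⟨h3, hP⟩

end Four

end BoolFun

namespace BoolFun

/-! ### Affine flats of dimension four -/

section Four

theorem DegLT.diff_eq_bil {M : Type*} [AddCommGroup M] {g : M → ZMod 2} (hg : DegLT 3 g) (a x : M) :
    BoolFun.diff a g x = BoolFun.diff a g 0 + bil g a x := by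
  have h : bil g x a = BoolFun.diff a g (0 + x) + BoolFun.diff a g 0 := rfl
  rw [bil_comm, h, zero_add, add_comm, add_assoc, CharTwo.add_self_eq_zero, add_zero]

theorem DegLT.add_add_of_diff_eq_zero {M : Type*} [AddCommGroup M] {g : M → ZMod 2} {u x : M}
    (h : BoolFun.diff u g x = 0) : g (x + u) = g x :=
  CharTwo.add_eq_zero.1 h

theorem DegLT.diff_add_base {M : Type*} [AddCommGroup M] {g : M → ZMod 2} (hg : DegLT 3 g)
    (a x y : M) : BoolFun.diff a g (x + y) = BoolFun.diff a g x + bil g a y := by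
  rw [hg.diff_eq_bil, hg.diff_eq_bil a x, hg.bil_add_right, add_assoc]

theorem exists_three_equal (g : Fin 5 → ZMod 2) :
    ∃ i j k, i < j ∧ j < k ∧ g j = g i ∧ g k = g i := by
  revert g
  decide

/-- g descends to the quotient by u. Among five distinct points there three share a value, and over
𝔽₂ three distinct points are never collinear. -/
theorem exists_three_cosets_of_diff_eq_zero {g : (Fin 4 → ZMod 2) → ZMod 2}
    {u p q r : Fin 4 → ZMod 2} (hv : LinearIndependent (ZMod 2) ![u, p, q, r])
    (hu : ∀ x, g (x + u) = g x) :
    ∃ a b c : Fin 4 → ZMod 2, LinearIndependent (ZMod 2) ![u, b, c] ∧ g (a + u) = g a ∧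
      g (a + b) = g a ∧ g (a + b + u) = g a ∧ g (a + c) = g a ∧ g (a + c + u) = g a := by
  let C : Fin 5 → Fin 4 → ZMod 2 := ![0, ![0, 1, 0, 0], ![0, 0, 1, 0], ![0, 0, 0, 1], ![0, 1, 1, 0]]
  have hC : ∀ i j k, i < j → j < k →
      LinearIndependent (ZMod 2) ![![1, 0, 0, 0], C i + C j, C i + C k] := by decide
  let X : Fin 5 → Fin 4 → ZMod 2 := fun i => ∑ l, C i l • ![u, p, q, r] l
  obtain ⟨i, j, k, hij, hjk, h1, h2⟩ := exists_three_equal fun i => g (X i)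
  have e (y : Fin 4 → ZMod 2) : X i + (X i + y) = y := by
    rw [← add_assoc, ZModModule.add_self, zero_add]
  refine ⟨X i, X i + X j, X i + X k, ?_, ?_, ?_, ?_, ?_, ?_⟩
  · refine linearIndependent_of_eq_combination hv _ (hC i j k hij hjk) fun l => ?_
    fin_cases l
    · simp [Fin.sum_univ_succ]
    · simp [X, add_smul, Finset.sum_add_distrib]
    · simp [X, add_smul, Finset.sum_add_distrib]
  · rw [hu]
  · rw [e]; exact h1
  · rw [hu, e]; exact h1
  · rw [e]; exact h2
  · rw [hu, e]; exact h2

/-- D_u g is affine with linear part B(u, ·), so it vanishes on a flat with directions u, p, q. That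
flat consists of four cosets of u, and D_p D_q g = 1 says that the four values of g sum to 1: one of
the values occurs exactly three times. -/
theorem DegLT.exists_three_cosets_of_bil {g : (Fin 4 → ZMod 2) → ZMod 2} (hg : DegLT 3 g)
    {u p q r : Fin 4 → ZMod 2} (hv : LinearIndependent (ZMod 2) ![u, p, q, r])
    (hup : bil g u p = 0) (huq : bil g u q = 0) (hur : bil g u r = 1) (hpq : bil g p q = 1) :
    ∃ a b c : Fin 4 → ZMod 2, LinearIndependent (ZMod 2) ![u, b, c] ∧ g (a + u) = g a ∧
      g (a + b) = g a ∧ g (a + b + u) = g a ∧ g (a + c) = g a ∧ g (a + c + u) = g a := by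
  obtain ⟨a, ha⟩ : ∃ a, BoolFun.diff u g a = 0 := by
    refine ⟨BoolFun.diff u g 0 • r, ?_⟩
    rw [hg.diff_eq_bil]
    rcases zmod_two_cases (BoolFun.diff u g 0) with h | h <;> rw [h]
    · rw [zero_smul, bil_comm, bil_zero_left, add_zero]
    · rw [one_smul, hur]; rfl
  have hp : ∀ x, BoolFun.diff u g (x + p) = BoolFun.diff u g x := fun x => by
    rw [hg.diff_add_base, hup, add_zero]
  have hq : ∀ x, BoolFun.diff u g (x + q) = BoolFun.diff u g x := fun x => by
    rw [hg.diff_add_base, huq, add_zero]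
  have w0 := DegLT.add_add_of_diff_eq_zero ha
  have w1 := DegLT.add_add_of_diff_eq_zero ((hp a).trans ha)
  have w2 := DegLT.add_add_of_diff_eq_zero ((hq a).trans ha)
  have w3 := DegLT.add_add_of_diff_eq_zero ((hq (a + p)).trans ((hp a).trans ha))
  have hs : g (a + p + q) + g (a + q) + (g (a + p) + g a) = 1 := by
    have h := hg.diff_add_base p a q
    rw [hpq] at h
    simp only [BoolFun.diff] at h
    rw [add_right_comm a q p] at h
    rw [h]
    have := CharTwo.add_self_eq_zero (g (a + p) + g a)
    linear_combination this
  have key : ∀ A : Fin 3 → Fin 4 → ZMod 2, LinearIndependent (ZMod 2) A → ∀ b c,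
      u = ∑ i, A 0 i • ![u, p, q, r] i → b = ∑ i, A 1 i • ![u, p, q, r] i →
      c = ∑ i, A 2 i • ![u, p, q, r] i → LinearIndependent (ZMod 2) ![u, b, c] := by
    intro A hA b c h1 h2 h3
    refine linearIndependent_of_eq_combination hv A hA fun j => ?_
    fin_cases j
    exacts [h1, h2, h3]
  have c1 : a + p + (p + q) = a + q := by
    rw [← add_assoc, add_assoc a p p, ZModModule.add_self, add_zero]
  have c2 : a + q + (p + q) = a + p := by
    rw [add_comm p q, ← add_assoc, add_assoc a q q, ZModModule.add_self, add_zero]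
  have c3 : a + p + p = a := by rw [add_assoc, ZModModule.add_self, add_zero]
  have c4 : a + q + q = a := by rw [add_assoc, ZModModule.add_self, add_zero]
  have c5 : a + q + p = a + p + q := add_right_comm a q p
  have cases : (g (a + p) = g a ∧ g (a + q) = g a) ∨ (g (a + p) = g a ∧ g (a + p + q) = g a) ∨
      (g (a + q) = g a ∧ g (a + p + q) = g a) ∨
      (g (a + p + q) = g (a + p) ∧ g (a + q) = g (a + p)) := by
    generalize g (a + p + q) = t0 at *
    generalize g (a + p) = t1 at *
    generalize g (a + q) = t2 at *
    generalize g a = t3 at *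
    clear * - hs
    decide +revert
  rcases cases with ⟨h1, h2⟩ | ⟨h1, h2⟩ | ⟨h1, h2⟩ | ⟨h1, h2⟩
  · refine ⟨a, p, q, key ![![1,0,0,0],![0,1,0,0],![0,0,1,0]] (by decide) _ _ ?_ ?_ ?_, ?_⟩
    · simp [Fin.sum_univ_succ]
    · simp [Fin.sum_univ_succ]
    · simp [Fin.sum_univ_succ]
    · simp only [w0, w1, w2, h1, h2, and_self]
  · refine ⟨a, p, p + q, key ![![1,0,0,0],![0,1,0,0],![0,1,1,0]] (by decide) _ _ ?_ ?_ ?_, ?_⟩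
    · simp [Fin.sum_univ_succ]
    · simp [Fin.sum_univ_succ]
    · simp [Fin.sum_univ_succ]
    · simp only [← add_assoc a p q, w0, w1, w3, h1, h2, and_self]
  · refine ⟨a, q, p + q, key ![![1,0,0,0],![0,0,1,0],![0,1,1,0]] (by decide) _ _ ?_ ?_ ?_, ?_⟩
    · simp [Fin.sum_univ_succ]
    · simp [Fin.sum_univ_succ]
    · simp [Fin.sum_univ_succ]
    · simp only [← add_assoc a p q, w0, w2, w3, h1, h2, and_self]
  · refine ⟨a + p, q, p + q, key ![![1,0,0,0],![0,0,1,0],![0,1,1,0]] (by decide) _ _ ?_ ?_ ?_, ?_⟩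
    · simp [Fin.sum_univ_succ]
    · simp [Fin.sum_univ_succ]
    · simp [Fin.sum_univ_succ]
    · simp only [c1, w1, w2, w3, h1, h2, and_self]

/-- A quadratic function of four variables takes one value on three cosets of a line. -/
theorem DegLT.exists_three_cosets {g : (Fin 4 → ZMod 2) → ZMod 2} (hg : DegLT 3 g) :
    ∃ u a b c : Fin 4 → ZMod 2, LinearIndependent (ZMod 2) ![u, b, c] ∧ g (a + u) = g a ∧
      g (a + b) = g a ∧ g (a + b + u) = g a ∧ g (a + c) = g a ∧ g (a + c + u) = g a := by
  rcases zmod_two_cases (pfaffian g) with hP | hP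
  · obtain ⟨r, s, c, d, hl, hr, hs⟩ := hg.exists_radical_four hP
    have hr' : ∀ x, g (x + r) = g x + BoolFun.diff r g 0 := by
      intro x
      have h := hg.diff_eq_bil r x
      rw [hr, add_zero] at h
      rw [← h, BoolFun.diff]
      linear_combination (CharTwo.add_self_eq_zero (g x)).symm
    have hs' : ∀ x, g (x + s) = g x + BoolFun.diff s g 0 := by
      intro x
      have h := hg.diff_eq_bil s x
      rw [hs, add_zero] at h
      rw [← h, BoolFun.diff]
      linear_combination (CharTwo.add_self_eq_zero (g x)).symm
    -- For radical vectors the derivative is constant and additive, so it is zero for r, s or r + s.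
    rcases zmod_two_cases (BoolFun.diff r g 0) with lr | lr
    · exact ⟨r, exists_three_cosets_of_diff_eq_zero hl fun x => by rw [hr', lr, add_zero]⟩
    rcases zmod_two_cases (BoolFun.diff s g 0) with ls | ls
    · refine ⟨s, exists_three_cosets_of_diff_eq_zero (p := r) (q := c) (r := d) ?_
        fun x => by rw [hs', ls, add_zero]⟩
      exact linearIndependent_of_eq_combination hl
        ![![0,1,0,0],![1,0,0,0],![0,0,1,0],![0,0,0,1]]
        (by decide) (by intro j; fin_cases j <;> simp [Fin.sum_univ_succ])
    · refine ⟨r + s, exists_three_cosets_of_diff_eq_zero (p := r) (q := c) (r := d) ?_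
        fun x => ?_⟩
      · exact linearIndependent_of_eq_combination hl
          ![![1,1,0,0],![1,0,0,0],![0,0,1,0],![0,0,0,1]]
          (by decide) (by intro j; fin_cases j <;> simp [Fin.sum_univ_succ])
      · rw [← add_assoc, hs', hr', lr, ls]
        linear_combination (CharTwo.add_self_eq_zero (1 : ZMod 2))
  · have hp : ∀ s t : ZMod 2, ∀ x y z : Fin 4 → ZMod 2, bil g (x + s • z) (y + t • z) =
        bil g x y + t * bil g x z + s * bil g z y := by
      intro s t x y z
      rcases zmod_two_cases s with rfl | rfl <;> rcases zmod_two_cases t with rfl | rfl <;>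
        simp [hg.bil_add_left, hg.bil_add_right, bil_self]
    have hz : ∀ t : ZMod 2, ∀ x y z : Fin 4 → ZMod 2, bil g x (y + t • z) =
        bil g x y + t * bil g x z := by
      intro t x y z
      rcases zmod_two_cases t with rfl | rfl <;> simp [hg.bil_add_right]
    rw [pfaffian] at hP
    generalize he0 : (Pi.single 0 1 : Fin 4 → ZMod 2) = e0 at *
    generalize he1 : (Pi.single 1 1 : Fin 4 → ZMod 2) = e1 at *
    generalize he2 : (Pi.single 2 1 : Fin 4 → ZMod 2) = e2 at *
    generalize he3 : (Pi.single 3 1 : Fin 4 → ZMod 2) = e3 at *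
    have hl : LinearIndependent (ZMod 2) ![e0, e1, e2, e3] := by
      subst he0 he1 he2 he3
      decide
    clear he0 he1 he2 he3
    have hc := bil_comm g
    -- Complete u = e0 to a basis with p, q orthogonal to e0 and B(e0, r) = 1; then B(p, q) is the
    -- Pfaffian, that is 1.
    rcases zmod_two_cases (bil g e0 e1) with b1 | b1
    · rcases zmod_two_cases (bil g e0 e2) with b2 | b2
      · have b3 : bil g e0 e3 = 1 ∧ bil g e1 e2 = 1 := by
          rw [b1, b2] at hP
          rw [zero_mul, zero_mul, zero_add, zero_add] at hP
          generalize bil g e0 e3 = s at *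
          generalize bil g e1 e2 = t at *
          clear * - hP
          decide +revert
        refine ⟨e0, hg.exists_three_cosets_of_bil (p := e1) (q := e2) (r := e3) hl b1 b2 b3.1 b3.2⟩
      · refine ⟨e0, hg.exists_three_cosets_of_bil (p := e1) (q := e3 + bil g e0 e3 • e2) (r := e2)
          ?_ b1 ?_ b2 ?_⟩
        · refine linearIndependent_of_eq_combination hl
            ![![1,0,0,0],![0,1,0,0],![0,0,bil g e0 e3,1],![0,0,1,0]] ?_ ?_
          · generalize bil g e0 e3 = s
            clear * -
            decide +revert
          · intro j; fin_cases j <;> simp [Fin.sum_univ_succ, add_comm]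
        · rw [hz, b2]
          linear_combination (CharTwo.add_self_eq_zero (bil g e0 e3))
        · rw [hz, ← hP, b1, b2]; ring
    · refine ⟨e0, hg.exists_three_cosets_of_bil (p := e2 + bil g e0 e2 • e1)
        (q := e3 + bil g e0 e3 • e1) (r := e1) ?_ ?_ ?_ b1 ?_⟩
      · refine linearIndependent_of_eq_combination hl
          ![![1,0,0,0],![0,bil g e0 e2,1,0],![0,bil g e0 e3,0,1],![0,1,0,0]] ?_ ?_
        · generalize bil g e0 e3 = s
          generalize bil g e0 e2 = t
          clear * -
          decide +revert
        · intro j; fin_cases j <;> simp [Fin.sum_univ_succ, add_comm]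
      · rw [hz, b1]
        linear_combination (CharTwo.add_self_eq_zero (bil g e0 e2))
      · rw [hz, b1]
        linear_combination (CharTwo.add_self_eq_zero (bil g e0 e3))
      · rw [hp, ← hP, b1, bil_comm g e2 e1]; ring

end Four

/-! ### From a triple to an affine flat of dimension four -/

section Seven

theorem exists_finCons {n : ℕ} {v : Fin n → Fin 7 → ZMod 2} (hv : LinearIndependent (ZMod 2) v)
    (hn : n < 7) : ∃ w, LinearIndependent (ZMod 2) (Fin.cons w v : Fin (n + 1) → _) := by
  obtain ⟨w, -, hw⟩ := exists_mem_notMem_span v ⊤ (by simpa using hn)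
  exact ⟨w, linearIndependent_finCons.2 ⟨hv, hw⟩⟩

theorem linearCombination_mem_span {M : Type*} [AddCommGroup M] [Module (ZMod 2) M] {n : ℕ}
    (w : Fin n → M) (t : Fin n → ZMod 2) :
    Fintype.linearCombination (ZMod 2) w t ∈ Submodule.span (ZMod 2) (Set.range w) := by
  rw [← Fintype.range_linearCombination]
  exact LinearMap.mem_range_self _ _

theorem diff_diff_comp {M : Type*} [AddCommGroup M] [Module (ZMod 2) M] {n : ℕ} (f : M → ZMod 2)
    (a : M) (w : Fin n → M) (s t x : Fin n → ZMod 2) :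
    diff s (diff t (fun t => f (a + ∑ i, t i • w i))) x =
      diff (∑ i, s i • w i) (diff (∑ i, t i • w i) f) (a + ∑ i, x i • w i) := by
  simp only [diff, Pi.add_apply, add_smul, Finset.sum_add_distrib, add_assoc]

theorem DegLT.tri_comp {M : Type*} [AddCommGroup M] [Module (ZMod 2) M] {n : ℕ} {f : M → ZMod 2}
    (hf : DegLT 4 f) (a : M) (w : Fin n → M) (s t u : Fin n → ZMod 2) :
    tri (fun t => f (a + ∑ i, t i • w i)) s t u =
      tri f (∑ i, s i • w i) (∑ i, t i • w i) (∑ i, u i • w i) := by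
  rw [← hf.diff_three _ _ _ a]
  simp only [tri, BoolFun.diff, Pi.add_apply, add_smul, Finset.sum_add_distrib, add_assoc,
    Pi.zero_apply, zero_smul, Finset.sum_const_zero, zero_add, add_zero]

theorem DegLT.comp_sum {M : Type*} [AddCommGroup M] [Module (ZMod 2) M] {n k : ℕ} {f : M → ZMod 2}
    (hf : DegLT k f) (a : M) (w : Fin n → M) :
    DegLT k (fun t : Fin n → ZMod 2 => f (a + ∑ i, t i • w i)) :=
  (hf.translate a).comp (Fintype.linearCombination (ZMod 2) w).toAddMonoidHom

variable {M : Type*} [AddCommGroup M] [Module (ZMod 2) M] {f : M → ZMod 2}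

/-- Apply the four-variable dichotomy to f on the flat through a. An affine hyperplane of it extends
by e, because D_e f is constant there. -/
theorem DegLT.affineOn_four_or (hf : DegLT 4 f) {e a k₁ k₂ k₃ p : M}
    (hl : LinearIndependent (ZMod 2) ![e, k₁, k₂, k₃, p]) {κ : ZMod 2}
    (hk : ∀ t : Fin 4 → ZMod 2, BoolFun.diff e f (a + ∑ i, t i • ![k₁, k₂, k₃, p] i) = κ) :
    (∃ (y : M) (v : Fin 4 → M), LinearIndependent (ZMod 2) v ∧ AffineOn f y v) ∨
      (tri f k₁ k₂ p = 0 ∧ tri f k₁ k₃ p = 0 ∧ tri f k₂ k₃ p = 0 ∧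
        BoolFun.diff k₁ (BoolFun.diff k₂ f) a * BoolFun.diff k₃ (BoolFun.diff p f) a +
        BoolFun.diff k₁ (BoolFun.diff k₃ f) a * BoolFun.diff k₂ (BoolFun.diff p f) a +
        BoolFun.diff k₁ (BoolFun.diff p f) a * BoolFun.diff k₂ (BoolFun.diff k₃ f) a = 1) := by
  have hs (i : Fin 4) : ∑ j, (Pi.single i 1 : Fin 4 → ZMod 2) j • ![k₁, k₂, k₃, p] j =
      ![k₁, k₂, k₃, p] i := by
    simp [Pi.single_apply, ite_smul]
  rcases (hf.comp_sum a ![k₁, k₂, k₃, p]).affineOn_three_or with ⟨y, v, hv, h⟩ | ⟨h3, hP⟩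
  · left
    have hl' : LinearIndependent (ZMod 2) (Fin.cons e ![k₁, k₂, k₃, p] : Fin 5 → M) := hl
    obtain ⟨hl4, he⟩ := linearIndependent_finCons.1 hl'
    set L := Fintype.linearCombination (ZMod 2) ![k₁, k₂, k₃, p] with hL
    have h' : AffineOn f (a + L y) (L ∘ v) := AffineOn.of_comp L h
    refine ⟨_, Fin.cons e (L ∘ v), linearIndependent_finCons.2 ⟨?_, fun hmem => he ?_⟩,
      h'.cons (k := κ) ?_⟩
    · exact hv.map' L (LinearMap.ker_eq_bot.2 hl4.fintypeLinearCombination_injective)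
    · refine Submodule.span_le.2 ?_ hmem
      rintro _ ⟨i, rfl⟩
      exact linearCombination_mem_span _ _
    · intro t
      rw [add_assoc]
      simp only [Function.comp_apply, ← map_smul, ← map_sum, ← map_add]
      exact hk _
  · right
    have h3' := fun i j k => (hf.tri_comp a ![k₁, k₂, k₃, p] (Pi.single i 1) (Pi.single j 1)
      (Pi.single k 1)).symm.trans (h3.tri_eq_zero _ _ _)
    simp only [hs] at h3'
    refine ⟨h3' 0 1 3, h3' 0 2 3, h3' 1 2 3, ?_⟩
    simp only [pfaffian, bil, diff_diff_comp, hs, Pi.zero_apply, zero_smul, Finset.sum_const_zero,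
      add_zero] at hP
    exact hP

/-- The three flats spanned by two of the cosets cannot all be bent: T vanishes on k_i, k_j, p, so
the Pfaffian with p + q at base point p is the sum of those with p and with q at 0, and 1 + 1 ≠ 1.
-/
theorem DegLT.affineOn_four_of_cosets (hf : DegLT 4 f) {e k₁ k₂ k₃ p q : M}
    (hl : LinearIndependent (ZMod 2) ![e, k₁, k₂, k₃, p, q]) {κ : ZMod 2}
    (h0 : ∀ x y z : ZMod 2, BoolFun.diff e f (x • k₁ + y • k₂ + z • k₃) = κ)
    (hp : ∀ x y z : ZMod 2, BoolFun.diff e f (x • k₁ + y • k₂ + z • k₃ + p) = κ)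
    (hq : ∀ x y z : ZMod 2, BoolFun.diff e f (x • k₁ + y • k₂ + z • k₃ + q) = κ) :
    ∃ (y : M) (v : Fin 4 → M), LinearIndependent (ZMod 2) v ∧ AffineOn f y v := by
  have h1 := hf.affineOn_four_or (e := e) (a := 0) (k₁ := k₁) (k₂ := k₂) (k₃ := k₃) (p := p)
    (κ := κ) (by
      exact linearIndependent_of_eq_combination hl ![![1,0,0,0,0,0],![0,1,0,0,0,0],![0,0,1,0,0,0],
        ![0,0,0,1,0,0],![0,0,0,0,1,0]]
        (by decide) (by intro j; fin_cases j <;> simp [Fin.sum_univ_succ])) (by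
      intro t
      rw [Fin.sum_univ_four, zero_add]
      rcases zmod_two_cases (t 3) with h | h <;> rw [h]
      · simpa using h0 (t 0) (t 1) (t 2)
      · simpa using hp (t 0) (t 1) (t 2))
  have h2 := hf.affineOn_four_or (e := e) (a := 0) (k₁ := k₁) (k₂ := k₂) (k₃ := k₃) (p := q)
    (κ := κ) (by
      exact linearIndependent_of_eq_combination hl ![![1,0,0,0,0,0],![0,1,0,0,0,0],![0,0,1,0,0,0],
        ![0,0,0,1,0,0],![0,0,0,0,0,1]]
        (by decide) (by intro j; fin_cases j <;> simp [Fin.sum_univ_succ])) (by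
      intro t
      rw [Fin.sum_univ_four, zero_add]
      rcases zmod_two_cases (t 3) with h | h <;> rw [h]
      · simpa using h0 (t 0) (t 1) (t 2)
      · simpa using hq (t 0) (t 1) (t 2))
  have h3 := hf.affineOn_four_or (e := e) (a := p) (k₁ := k₁) (k₂ := k₂) (k₃ := k₃) (p := p + q)
    (κ := κ) (by
      exact linearIndependent_of_eq_combination hl ![![1,0,0,0,0,0],![0,1,0,0,0,0],![0,0,1,0,0,0],
        ![0,0,0,1,0,0],![0,0,0,0,1,1]]
        (by decide) (by intro j; fin_cases j <;> simp [Fin.sum_univ_succ])) (by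
      intro t
      rw [Fin.sum_univ_four]
      rcases zmod_two_cases (t 3) with h | h <;> rw [h]
      · simpa [add_comm p] using hp (t 0) (t 1) (t 2)
      · have := hq (t 0) (t 1) (t 2)
        convert this using 2
        simp only [Matrix.cons_val, one_smul]
        rw [add_comm p, add_assoc, add_comm (p + q) p, ← add_assoc p p, ZModModule.add_self,
          zero_add])
  rcases h1 with h1 | ⟨a1, a2, a3, h1⟩
  · exact h1
  rcases h2 with h2 | ⟨-, -, -, h2⟩
  · exact h2
  rcases h3 with h3 | ⟨-, -, -, h3⟩
  · exact h3
  exfalso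
  have tz (a b : M) : tri f a b 0 = 0 := by rw [← tri_rotate, tri_zero_left]
  have r (k : M) : tri f k q p = tri f k p q := tri_swap_right _ _ _ _
  simp only [hf.diff_two, tz, hf.tri_add_mid, BoolFun.bil_add_right, a1, a2, a3, add_zero,
    tri_self_right, zero_add, r, add_assoc, CharTwo.add_self_eq_zero] at h1 h2 h3
  clear * - h1 h2 h3
  grind

/-- A cubic function of seven variables with a triple is affine on a four-dimensional flat. -/
theorem DegLT.affineOn_four_of_hasTriple {f : (Fin 7 → ZMod 2) → ZMod 2} (hf : DegLT 4 f)
    (hT : HasTriple f) :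
    ∃ (y : Fin 7 → ZMod 2) (v : Fin 4 → Fin 7 → ZMod 2), LinearIndependent (ZMod 2) v ∧
      AffineOn f y v := by
  obtain ⟨e, b, c, hl, hb, hc⟩ := hT
  obtain ⟨w₃, h4⟩ := exists_finCons hl (by decide)
  obtain ⟨w₂, h5⟩ := exists_finCons h4 (by decide)
  obtain ⟨w₁, h6⟩ := exists_finCons h5 (by decide)
  obtain ⟨w₀, h7⟩ := exists_finCons h6 (by decide)
  set w : Fin 4 → Fin 7 → ZMod 2 := ![w₀, w₁, w₂, w₃] with hw
  have hs : LinearIndependent (ZMod 2) (Sum.elim w ![e, b, c]) := by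
    have := h7.comp (finSumFinEquiv : Fin 4 ⊕ Fin 3 ≃ Fin 7) (Equiv.injective _)
    convert this using 1
    funext i
    rcases i with i | i <;> fin_cases i <;> rfl
  obtain ⟨hwl, -, hdis⟩ := linearIndependent_sum.1 hs
  simp only [Sum.elim_comp_inl, Sum.elim_comp_inr] at hwl hdis
  -- The three cosets are found for D_e f restricted to the complement spanned by w, and then
  -- thickened by b and c.
  obtain ⟨u, a, p, q, hupq, g1, g2, g3, g4, g5⟩ :=
    (DegLT.comp_sum (hf e) 0 w).exists_three_cosets
  set L := Fintype.linearCombination (ZMod 2) w with hL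
  have hli : LinearIndependent (ZMod 2) ![e, b, c, L u, L p, L q] := by
    have h1 : LinearIndependent (ZMod 2) (Sum.elim (L ∘ ![u, p, q]) ![e, b, c]) := by
      refine LinearIndependent.sum_type ?_ hl (hdis.mono_left ?_)
      · exact hupq.map' L (LinearMap.ker_eq_bot.2 hwl.fintypeLinearCombination_injective)
      · rw [Submodule.span_le]
        rintro _ ⟨i, rfl⟩
        exact linearCombination_mem_span _ _
    have h2 := h1.comp (![.inr 0, .inr 1, .inr 2, .inl 0, .inl 1, .inl 2] : Fin 6 → Fin 3 ⊕ Fin 3)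
      (by decide)
    convert h2 using 1
    funext i
    fin_cases i <;> rfl
  have eb (x) : BoolFun.diff e f (x + b) = BoolFun.diff e f x :=
    CharTwo.add_eq_zero.1 (congrFun hb x)
  have ec (x) : BoolFun.diff e f (x + c) = BoolFun.diff e f x :=
    CharTwo.add_eq_zero.1 (congrFun hc x)
  have gl (t : Fin 4 → ZMod 2) : BoolFun.diff e f (0 + ∑ i, t i • w i) =
    BoolFun.diff e f (L t) := by rw [zero_add]; rfl
  simp only [gl, map_add] at g1 g2 g3 g4 g5
  have main := (hf.translate (L a)).affineOn_four_of_cosets hli (κ := BoolFun.diff e f (L a))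
  simp only [diff_translate] at main
  have red (x y : ZMod 2) (z m : Fin 7 → ZMod 2) :
      BoolFun.diff e f (L a + (x • b + y • c + z + m)) = BoolFun.diff e f (L a + m + z) := by
    rw [show L a + (x • b + y • c + z + m) = L a + m + z + x • b + y • c by abel]
    rcases zmod_two_cases x with rfl | rfl <;> rcases zmod_two_cases y with rfl | rfl <;>
      simp [eb, ec]
  obtain ⟨y, v, hv, h⟩ := main (fun x y z => by
      have := red x y (z • L u) 0
      rw [add_zero, add_zero] at this
      rw [this]
      rcases zmod_two_cases z with rfl | rfl <;> simp [g1]) (fun x y z => by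
      rw [red]
      rcases zmod_two_cases z with rfl | rfl <;> simp [g2, g3]) (fun x y z => by
      rw [red]
      rcases zmod_two_cases z with rfl | rfl <;> simp [g4, g5])
  exact ⟨_, _, hv, AffineOn.of_comp (x := L a) LinearMap.id h⟩

/-- Every cubic function of seven variables is affine on a four-dimensional flat. -/
theorem exists_affineOn_four {f : (Fin 7 → ZMod 2) → ZMod 2} (hd : degree f ≤ 3) :
    ∃ (y : Fin 7 → ZMod 2) (v : Fin 4 → Fin 7 → ZMod 2), LinearIndependent (ZMod 2) v ∧
      AffineOn f y v :=
  (degLT_of_degree_le hd).affineOn_four_of_hasTriple (hasTriple_of_degree_le hd)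

end Seven

end BoolFun

namespace BoolFun

/-! ### Relative degrees -/

section Relative

variable {m : ℕ} {f : (Fin m → ZMod 2) → ZMod 2}

/-- `DegLT` is preserved by the coordinate isomorphism of the chosen basis, so bases can be
forgotten from here on. -/
theorem relDegree_le_iff {d : ℕ} {a : Fin m → ZMod 2} {V : Submodule (ZMod 2) (Fin m → ZMod 2)} :
    relDegree f a V ≤ d ↔ DegLT (d + 1) fun v : V => f (a + v) := by
  rw [relDegree, degreeOn, degree_le_iff_degLT]
  set b := (Module.finBasis (ZMod 2) V).equivFun
  refine ⟨fun h => ?_, fun h => h.comp b.symm.toLinearMap.toAddMonoidHom⟩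
  simpa using h.comp b.toLinearMap.toAddMonoidHom

theorem relDegree_le_degree (a : Fin m → ZMod 2) (V : Submodule (ZMod 2) (Fin m → ZMod 2)) :
    relDegree f a V ≤ degree f :=
  relDegree_le_iff.2 (((degLT_of_degree_le le_rfl).translate a).comp V.subtype.toAddMonoidHom)

theorem rDegree_le_relDegree (a : Fin m → ZMod 2) (V : Submodule (ZMod 2) (Fin m → ZMod 2)) :
    rDegree (Module.finrank (ZMod 2) V) f ≤ relDegree f a V :=
  Nat.sInf_le ⟨a, V, rfl, rfl⟩

theorem exists_relDegree_eq {r : ℕ} (hr : r ≤ m) (f : (Fin m → ZMod 2) → ZMod 2) :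
    ∃ (a : Fin m → ZMod 2) (V : Submodule (ZMod 2) (Fin m → ZMod 2)),
      Module.finrank (ZMod 2) V = r ∧ relDegree f a V = rDegree r f :=
  (rDegree_isLeast hr f).1

theorem rDegree_le_degree {r : ℕ} (hr : r ≤ m) : rDegree r f ≤ degree f := by
  obtain ⟨a, V, -, h⟩ := exists_relDegree_eq hr f
  rw [← h]
  exact relDegree_le_degree a V

theorem exists_le_finrank_eq {r : ℕ} (V : Submodule (ZMod 2) (Fin m → ZMod 2))
    (hr : r ≤ Module.finrank (ZMod 2) V) : ∃ W ≤ V, Module.finrank (ZMod 2) W = r := by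
  have hli : LinearIndependent (ZMod 2) fun i : Fin r =>
      ((Module.finBasis (ZMod 2) V (Fin.castLE hr i) : V) : Fin m → ZMod 2) :=
    (((Module.finBasis (ZMod 2) V).linearIndependent.comp _ (Fin.castLE_injective hr))).map'
      V.subtype V.ker_subtype
  refine ⟨_, ?_, (finrank_span_eq_card hli).trans (Fintype.card_fin r)⟩
  rw [Submodule.span_le]
  rintro _ ⟨i, rfl⟩
  exact Subtype.property _

theorem rDegree_eq_zero_of_const {r : ℕ} {a : Fin m → ZMod 2}
    {V : Submodule (ZMod 2) (Fin m → ZMod 2)} (hr : r ≤ Module.finrank (ZMod 2) V)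
    (h : ∀ v ∈ V, f (a + v) = f a) : rDegree r f = 0 := by
  obtain ⟨W, hW, rfl⟩ := exists_le_finrank_eq V hr
  refine Nat.le_zero.1 ((rDegree_le_relDegree a W).trans (relDegree_le_iff.2 fun b => ?_))
  funext x
  simp only [diff, h _ (hW (Submodule.coe_mem _)), CharTwo.add_self_eq_zero, Pi.zero_apply]

/-- f is constant on the translate of the kernel of φ, which loses at most one dimension. -/
theorem rDegree_eq_zero_of_affine {r : ℕ} {a : Fin m → ZMod 2}
    {V : Submodule (ZMod 2) (Fin m → ZMod 2)} (hr : r + 1 ≤ Module.finrank (ZMod 2) V)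
    (φ : V →ₗ[ZMod 2] ZMod 2) (h : ∀ v : V, f (a + v) = φ v + f a) : rDegree r f = 0 := by
  refine rDegree_eq_zero_of_const (a := a) (V := (LinearMap.ker φ).map V.subtype) ?_ ?_
  · rw [Submodule.finrank_map_subtype_eq]
    have h1 := LinearMap.finrank_range_add_finrank_ker φ
    have h2 := Submodule.finrank_le (LinearMap.range φ)
    rw [Module.finrank_self] at h2
    omega
  · rintro _ ⟨v, hv, rfl⟩
    rw [Submodule.subtype_apply, h, LinearMap.mem_ker.1 hv, zero_add]

theorem relDegree_le_one_of_affine {a : Fin m → ZMod 2}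
    {V : Submodule (ZMod 2) (Fin m → ZMod 2)} (φ : V →ₗ[ZMod 2] ZMod 2)
    (h : ∀ v : V, f (a + v) = φ v + f a) : relDegree f a V ≤ 1 := by
  refine relDegree_le_iff.2 fun b c => ?_
  simp only [h]
  funext x
  simp only [diff, map_add, Pi.zero_apply]
  have h2 (t : ZMod 2) : t + t = 0 := CharTwo.add_self_eq_zero t
  linear_combination 2 * h2 (φ x) + h2 (φ c) + h2 (φ b) + 2 * h2 (f a)

theorem AffineOn.exists_submodule {n : ℕ} {y : Fin m → ZMod 2} {v : Fin n → Fin m → ZMod 2}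
    (hv : LinearIndependent (ZMod 2) v) (h : AffineOn f y v) :
    ∃ (V : Submodule (ZMod 2) (Fin m → ZMod 2)) (φ : V →ₗ[ZMod 2] ZMod 2),
      Module.finrank (ZMod 2) V = n ∧ ∀ w : V, f (y + w) = φ w + f y := by
  obtain ⟨c, hc⟩ := h
  refine ⟨Submodule.span (ZMod 2) (Set.range v), (Module.Basis.span hv).constr (ZMod 2) c,
    (finrank_span_eq_card hv).trans (Fintype.card_fin n), fun w => ?_⟩
  rw [Module.Basis.constr_apply_fintype, add_comm (∑ _, _)]
  refine Eq.trans ?_ (hc ((Module.Basis.span hv).equivFun w))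
  congr 2
  conv_lhs => rw [← (Module.Basis.span hv).sum_equivFun w]
  simp [Module.Basis.span_apply]

theorem DegLT.rDegree_eq_zero (hf : DegLT 2 f) {r : ℕ} (hr : r + 1 ≤ m) : rDegree r f = 0 := by
  have hadd (x y) : f (x + y) + f 0 = (f x + f 0) + (f y + f 0) := by
    have h := congrFun (hf y x) 0
    simp only [BoolFun.diff, Pi.zero_apply, zero_add] at h
    have h2 (t : ZMod 2) : t + t = 0 := CharTwo.add_self_eq_zero t
    linear_combination h - h2 (f x) - h2 (f y) - h2 (f 0)
  refine rDegree_eq_zero_of_affine (a := 0) (V := ⊤) (by simpa using hr)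
    ((AddMonoidHom.toZModLinearMap 2 (AddMonoidHom.mk' (fun x => f x + f 0) hadd)).comp
      (Submodule.subtype ⊤)) fun v => ?_
  change f (0 + v) = f v + f 0 + f 0
  rw [zero_add, add_assoc, CharTwo.add_self_eq_zero, add_zero]

theorem maxRDegree_eq {r k d : ℕ} (hk : k ≤ m) (h : ∃ f : (Fin m → ZMod 2) → ZMod 2,
    degree f = k ∧ d ≤ rDegree r f)
    (h' : ∀ f : (Fin m → ZMod 2) → ZMod 2, degree f = k → rDegree r f ≤ d) :
    maxRDegree r k m = d := by
  obtain ⟨⟨g, hg, hg'⟩, hub⟩ := maxRDegree_isGreatest r hk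
  obtain ⟨f, hf, hf'⟩ := h
  exact le_antisymm (hg' ▸ h' g hg) (hf'.trans (hub ⟨f, hf, rfl⟩))

theorem maxRDegree_eq_zero {r k : ℕ} (hk : k ≤ m)
    (h : ∀ f : (Fin m → ZMod 2) → ZMod 2, degree f = k → rDegree r f = 0) :
    maxRDegree r k m = 0 := by
  obtain ⟨g, hg, hg'⟩ := (maxRDegree_isGreatest r hk).1
  rw [← hg', h g hg]

end Relative

/-! ### Functions of large relative degree -/

section Isotropic

theorem finrank_map_add_finrank_inf_ker {M N : Type*} [AddCommGroup M] [Module (ZMod 2) M]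
    [AddCommGroup N] [Module (ZMod 2) N] [FiniteDimensional (ZMod 2) M]
    (V : Submodule (ZMod 2) M) (φ : M →ₗ[ZMod 2] N) :
    Module.finrank (ZMod 2) (V.map φ) +
      Module.finrank (ZMod 2) (V ⊓ LinearMap.ker φ : Submodule (ZMod 2) M) =
        Module.finrank (ZMod 2) V := by
  have h := LinearMap.finrank_range_add_finrank_ker (φ.domRestrict V)
  rw [LinearMap.range_domRestrict, LinearMap.ker_domRestrict] at h
  rw [← h, ← Submodule.finrank_map_subtype_eq, Submodule.map_comap_subtype]

/-- The second half `y` of the coordinates `(x, y, z)`. -/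
def secondHalf : (Fin 7 → ZMod 2) →ₗ[ZMod 2] (Fin 3 → ZMod 2) :=
  LinearMap.funLeft (ZMod 2) (ZMod 2) ![3, 4, 5]

/-- The functional `y ↦ x · y` given by the first half `x` of the coordinates `(x, y, z)`. -/
def firstHalfDual : (Fin 7 → ZMod 2) →ₗ[ZMod 2] Module.Dual (ZMod 2) (Fin 3 → ZMod 2) :=
  (dotProductEquiv (ZMod 2) (Fin 3)).toLinearMap ∘ₗ LinearMap.funLeft (ZMod 2) (ZMod 2) ![0, 1, 2]

variable {V : Submodule (ZMod 2) (Fin 7 → ZMod 2)}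

/-- Write vectors as (x, y, z). The x-parts of the vectors of V with y = 0 annihilate the y-parts of
V, so the two dimensions add up to at most 3; what remains is V ∩ {x = y = 0}. -/
theorem finrank_le_of_pairing_eq_zero
    (h : ∀ n ∈ V, n 3 = 0 → n 4 = 0 → n 5 = 0 →
      ∀ v ∈ V, n 0 * v 3 + n 1 * v 4 + n 2 * v 5 = 0) :
    Module.finrank (ZMod 2) V ≤ 3 + Module.finrank (ZMod 2)
      (V ⊓ LinearMap.ker secondHalf ⊓ LinearMap.ker firstHalfDual :
        Submodule (ZMod 2) (Fin 7 → ZMod 2)) := by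
  have h1 := finrank_map_add_finrank_inf_ker V secondHalf
  have h2 := finrank_map_add_finrank_inf_ker (V ⊓ LinearMap.ker secondHalf) firstHalfDual
  have h3 := Subspace.finrank_add_finrank_dualAnnihilator_eq (V.map secondHalf)
  have h4 : (V ⊓ LinearMap.ker secondHalf).map firstHalfDual ≤
      (V.map secondHalf).dualAnnihilator := by
    rintro _ ⟨n, ⟨hn, hn'⟩, rfl⟩
    rw [Submodule.mem_dualAnnihilator]
    rintro _ ⟨v, hv, rfl⟩
    have e := h n hn (congrFun hn' 0) (congrFun hn' 1) (congrFun hn' 2) v hv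
    simpa [firstHalfDual, secondHalf, dotProduct, Fin.sum_univ_succ, LinearMap.funLeft_apply,
      add_assoc] using e
  have h5 := Submodule.finrank_mono h4
  simp only [Module.finrank_fintype_fun_eq_card, Fintype.card_fin] at h3
  omega

theorem eq_zero_of_mem_ker {n : Fin 7 → ZMod 2}
    (hn : n ∈ V ⊓ LinearMap.ker secondHalf ⊓ LinearMap.ker firstHalfDual) :
    n ∈ V ∧ n 0 = 0 ∧ n 1 = 0 ∧ n 2 = 0 ∧ n 3 = 0 ∧ n 4 = 0 ∧ n 5 = 0 := by
  obtain ⟨⟨hV, h1⟩, h2⟩ := hn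
  have h3 := (dotProductEquiv (ZMod 2) (Fin 3)).map_eq_zero_iff.1 h2
  exact ⟨hV, congrFun h3 0, congrFun h3 1, congrFun h3 2, congrFun h1 0, congrFun h1 1,
    congrFun h1 2⟩

theorem finrank_le_three_of_pairing_eq_zero
    (h : ∀ n ∈ V, n 3 = 0 → n 4 = 0 → n 5 = 0 →
      ∀ v ∈ V, n 0 * v 3 + n 1 * v 4 + n 2 * v 5 = 0)
    (h6 : ∀ n ∈ V, n 0 = 0 → n 1 = 0 → n 2 = 0 → n 3 = 0 → n 4 = 0 → n 5 = 0 → n 6 = 0) :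
    Module.finrank (ZMod 2) V ≤ 3 := by
  refine (finrank_le_of_pairing_eq_zero h).trans ?_
  refine Nat.add_le_add_left (m := 0) (Submodule.finrank_eq_zero.2 ?_).le 3
  refine (Submodule.eq_bot_iff _).2 fun n hn => ?_
  obtain ⟨hV, h0, h1, h2, h3, h4, h5⟩ := eq_zero_of_mem_ker hn
  have h6 := h6 n hV h0 h1 h2 h3 h4 h5
  funext i
  fin_cases i <;> assumption

theorem finrank_le_four_of_pairing_eq_zero
    (h : ∀ n ∈ V, n 3 = 0 → n 4 = 0 → n 5 = 0 →
      ∀ v ∈ V, n 0 * v 3 + n 1 * v 4 + n 2 * v 5 = 0) :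
    Module.finrank (ZMod 2) V ≤ 4 := by
  refine (finrank_le_of_pairing_eq_zero h).trans (Nat.add_le_add_left (m := 1) ?_ 3)
  set N := V ⊓ LinearMap.ker secondHalf ⊓ LinearMap.ker firstHalfDual
  have hinj : Function.Injective ((LinearMap.proj 6 : (Fin 7 → ZMod 2) →ₗ[ZMod 2] ZMod 2).domRestrict N) := by
    refine (injective_iff_map_eq_zero _).2 fun n hn => ?_
    obtain ⟨hV, h0, h1, h2, h3, h4, h5⟩ := eq_zero_of_mem_ker n.2
    have h6 : (n : Fin 7 → ZMod 2) 6 = 0 := hn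
    refine Subtype.ext (funext fun i => ?_)
    fin_cases i <;> assumption
  simpa using LinearMap.finrank_le_finrank_of_injective hinj

end Isotropic

/-! ### Lower bounds for three explicit functions -/

section Examples

/-- The quadratic function `x · y + z` of `(x, y, z)`. -/
def quadraticExample : (Fin 7 → ZMod 2) → ZMod 2 :=
  monomial {0, 3} + monomial {1, 4} + monomial {2, 5} + monomial {6}

/-- The cubic function `x · y + z + y₀y₁y₂` of `(x, y, z)`. -/
def weakExample : (Fin 7 → ZMod 2) → ZMod 2 :=
  quadraticExample + monomial {3, 4, 5}

/-- The cubic function `z (x · y) + x₀x₁x₂ + y₀y₁y₂` of `(x, y, z)`. -/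
def cubicExample : (Fin 7 → ZMod 2) → ZMod 2 :=
  monomial {0, 3, 6} + monomial {1, 4, 6} + monomial {2, 5, 6} + monomial {0, 1, 2} +
    monomial {3, 4, 5}

theorem quadraticExample_apply (v : Fin 7 → ZMod 2) :
    quadraticExample v = v 0 * v 3 + v 1 * v 4 + v 2 * v 5 + v 6 := by
  simp [quadraticExample, monomial]

theorem cubicExample_apply (v : Fin 7 → ZMod 2) :
    cubicExample v = v 0 * v 3 * v 6 + v 1 * v 4 * v 6 + v 2 * v 5 * v 6 + v 0 * v 1 * v 2 +
      v 3 * v 4 * v 5 := by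
  simp [cubicExample, monomial, mul_assoc]

theorem anfCoeff_add {m : ℕ} (f g : (Fin m → ZMod 2) → ZMod 2) (S : Finset (Fin m)) :
    anfCoeff (f + g) S = anfCoeff f S + anfCoeff g S := by
  simp [anfCoeff, Finset.sum_add_distrib]

theorem degLT_monomial_of_card {m k : ℕ} {S : Finset (Fin m)} (h : S.card ≤ k) :
    DegLT (k + 1) (monomial S) :=
  (degLT_monomial S).mono (by omega)

theorem degree_quadraticExample_le : degree quadraticExample ≤ 2 := by
  rw [degree_le_iff_degLT]
  refine ((DegLT.add ?_ ?_).add ?_).add ?_ <;> exact degLT_monomial_of_card (by decide)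

theorem degree_cubicExample_le : degree cubicExample ≤ 3 := by
  rw [degree_le_iff_degLT]
  refine (((DegLT.add ?_ ?_).add ?_).add ?_).add ?_ <;> exact degLT_monomial_of_card (by decide)

theorem degree_weakExample : degree weakExample = 3 := by
  refine le_antisymm ?_ ?_
  · rw [degree_le_iff_degLT]
    exact (degLT_of_degree_le degree_quadraticExample_le).succ.add
      (degLT_monomial_of_card (by decide))
  · refine (show 3 ≤ ({3, 4, 5} : Finset (Fin 7)).card by decide).trans
      (Finset.le_sup (f := Finset.card) (Finset.mem_filter.2 ⟨Finset.mem_univ _, ?_⟩))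
    simp only [weakExample, quadraticExample, anfCoeff_add, anfCoeff_monomial]
    rw [if_neg (show ({3, 4, 5} : Finset (Fin 7)) ≠ {0, 3} by decide),
      if_neg (show ({3, 4, 5} : Finset (Fin 7)) ≠ {1, 4} by decide),
      if_neg (show ({3, 4, 5} : Finset (Fin 7)) ≠ {2, 5} by decide),
      if_neg (show ({3, 4, 5} : Finset (Fin 7)) ≠ {6} by decide), if_pos trivial]
    decide

/-- Translation by n with zero y-part does not see g. Constancy on a + V then gives n_x·(a_y + v_y)
+ n_z = 0 for all v in V, hence n_x·v_y = 0, and n_z = 0 when n_x = 0. So dim V ≤ 3. -/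
theorem one_le_rDegree_four {f : (Fin 7 → ZMod 2) → ZMod 2} {g : ZMod 2 → ZMod 2 → ZMod 2 → ZMod 2}
    (hf : ∀ v, f v = quadraticExample v + g (v 3) (v 4) (v 5)) : 1 ≤ rDegree 4 f := by
  by_contra hlt
  obtain ⟨a, V, hV, h⟩ := exists_relDegree_eq (r := 4) (by decide) f
  have h0 := relDegree_le_iff.1 (show relDegree f a V ≤ 0 by omega)
  have hc : ∀ v ∈ V, f (a + v) = f a := fun v hv => by
    simpa using h0.diff_const ⟨v, hv⟩
  have key : ∀ n ∈ V, n 3 = 0 → n 4 = 0 → n 5 = 0 → ∀ v ∈ V,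
      n 0 * (a 3 + v 3) + n 1 * (a 4 + v 4) + n 2 * (a 5 + v 5) + n 6 = 0 := by
    intro n hn h3 h4 h5 v hv
    have e := (hc _ (V.add_mem hv hn)).trans (hc v hv).symm
    simp only [hf, quadraticExample_apply, Pi.add_apply, h3, h4, h5, add_zero] at e
    linear_combination e
  have hle := finrank_le_three_of_pairing_eq_zero (V := V) (fun n hn h3 h4 h5 v hv => by
      have e1 := key n hn h3 h4 h5 v hv
      have e2 := key n hn h3 h4 h5 0 V.zero_mem
      simp only [Pi.zero_apply, add_zero] at e2
      linear_combination e1 - e2) (fun n hn h0 h1 h2 h3 h4 h5 => by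
      simpa [h0, h1, h2] using key n hn h3 h4 h5 0 V.zero_mem)
  omega

theorem two_le_rDegree_quadraticExample {r : ℕ} (hr : 5 ≤ r) (hr' : r ≤ 7) :
    2 ≤ rDegree r quadraticExample := by
  by_contra hlt
  obtain ⟨a, V, hV, h⟩ := exists_relDegree_eq hr' quadraticExample
  have h0 := relDegree_le_iff.1 (show relDegree quadraticExample a V ≤ 1 by omega)
  have hle := finrank_le_four_of_pairing_eq_zero (V := V) fun n hn h3 h4 h5 v hv => by
    have e := congrFun (h0 ⟨v, hv⟩ ⟨n, hn⟩) 0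
    simp only [diff, Pi.zero_apply, quadraticExample_apply, Submodule.coe_add, zero_add,
      Submodule.coe_zero, Pi.add_apply, h3, h4, h5, add_zero] at e
    generalize a 0 = a0 at *
    have h2 (t : ZMod 2) : t + t = 0 := CharTwo.add_self_eq_zero t
    grind
  omega

theorem tri_cubicExample (a b c : Fin 7 → ZMod 2) : tri cubicExample a b c =
    c 0 * (a 6 * b 3 + b 6 * a 3 + (a 1 * b 2 + a 2 * b 1)) +
    c 1 * (a 6 * b 4 + b 6 * a 4 + (a 2 * b 0 + a 0 * b 2)) +
    c 2 * (a 6 * b 5 + b 6 * a 5 + (a 0 * b 1 + a 1 * b 0)) +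
    c 3 * (a 6 * b 0 + b 6 * a 0 + (a 4 * b 5 + a 5 * b 4)) +
    c 4 * (a 6 * b 1 + b 6 * a 1 + (a 5 * b 3 + a 3 * b 5)) +
    c 5 * (a 6 * b 2 + b 6 * a 2 + (a 3 * b 4 + a 4 * b 3)) +
    c 6 * (a 0 * b 3 + a 3 * b 0 + (a 1 * b 4 + a 4 * b 1) + (a 2 * b 5 + a 5 * b 2)) := by
  have key : ∀ x₁ x₂ x₃ y₁ y₂ y₃ z₁ z₂ z₃ : ZMod 2,
      (x₁ + y₁ + z₁) * (x₂ + y₂ + z₂) * (x₃ + y₃ + z₃) + (x₁ + y₁) * (x₂ + y₂) * (x₃ + y₃) +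
      (x₁ + z₁) * (x₂ + z₂) * (x₃ + z₃) + (y₁ + z₁) * (y₂ + z₂) * (y₃ + z₃) + x₁ * x₂ * x₃ +
      y₁ * y₂ * y₃ + z₁ * z₂ * z₃ = z₁ * (x₂ * y₃ + x₃ * y₂) + z₂ * (x₁ * y₃ + x₃ * y₁) +
        z₃ * (x₁ * y₂ + x₂ * y₁) := by
    clear * -
    decide
  have k1 := key (a 0) (a 3) (a 6) (b 0) (b 3) (b 6) (c 0) (c 3) (c 6)
  have k2 := key (a 1) (a 4) (a 6) (b 1) (b 4) (b 6) (c 1) (c 4) (c 6)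
  have k3 := key (a 2) (a 5) (a 6) (b 2) (b 5) (b 6) (c 2) (c 5) (c 6)
  have k4 := key (a 0) (a 1) (a 2) (b 0) (b 1) (b 2) (c 0) (c 1) (c 2)
  have k5 := key (a 3) (a 4) (a 5) (b 3) (b 4) (b 5) (c 3) (c 4) (c 5)
  simp only [tri, diff, cubicExample_apply, Pi.add_apply, Pi.zero_apply, zero_add, add_zero,
    mul_zero]
  linear_combination k1 + k2 + k3 + k4 + k5

/-- Here y' = x × x' and x' = y × y'. The triple product formula with x·y = 0 makes x' a multiple of
x, so y' = 0 and then x' = 0. -/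
theorem eq_zero_of_cross_product (x₀ x₁ x₂ y₀ y₁ y₂ x₀' x₁' x₂' y₀' y₁' y₂' : ZMod 2)
    (hq : x₀ * y₀ + x₁ * y₁ + x₂ * y₂ = 0)
    (h0 : y₀' + (x₁ * x₂' + x₂ * x₁') = 0)
    (h1 : y₁' + (x₂ * x₀' + x₀ * x₂') = 0)
    (h2 : y₂' + (x₀ * x₁' + x₁ * x₀') = 0)
    (h3 : x₀' + (y₁ * y₂' + y₂ * y₁') = 0)
    (h4 : x₁' + (y₂ * y₀' + y₀ * y₂') = 0)
    (h5 : x₂' + (y₀ * y₁' + y₁ * y₀') = 0)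
    (h6 : x₀ * y₀' + y₀ * x₀' + (x₁ * y₁' + y₁ * x₁') + (x₂ * y₂' + y₂ * x₂') = 0) :
    x₀' = 0 ∧ x₁' = 0 ∧ x₂' = 0 ∧ y₀' = 0 ∧ y₁' = 0 ∧ y₂' = 0 := by
  have e0 : x₀' = 0 := by grind
  have e1 : x₁' = 0 := by grind
  have e2 : x₂' = 0 := by grind
  subst e0 e1 e2
  simp only [mul_zero, add_zero] at h0 h1 h2
  exact ⟨rfl, rfl, rfl, h0, h1, h2⟩

theorem eq_zero_or_eq_of_tri_cubicExample (x₀ x₁ x₂ y₀ y₁ y₂ t x₀' x₁' x₂' y₀' y₁' y₂' t' : ZMod 2)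
    (hq : x₀ * y₀ + x₁ * y₁ + x₂ * y₂ + t = 1)
    (h0 : t * y₀' + t' * y₀ + (x₁ * x₂' + x₂ * x₁') = 0)
    (h1 : t * y₁' + t' * y₁ + (x₂ * x₀' + x₀ * x₂') = 0)
    (h2 : t * y₂' + t' * y₂ + (x₀ * x₁' + x₁ * x₀') = 0)
    (h3 : t * x₀' + t' * x₀ + (y₁ * y₂' + y₂ * y₁') = 0)
    (h4 : t * x₁' + t' * x₁ + (y₂ * y₀' + y₀ * y₂') = 0)
    (h5 : t * x₂' + t' * x₂ + (y₀ * y₁' + y₁ * y₀') = 0)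
    (h6 : x₀ * y₀' + y₀ * x₀' + (x₁ * y₁' + y₁ * x₁') + (x₂ * y₂' + y₂ * x₂') = 0) :
    (x₀' = 0 ∧ x₁' = 0 ∧ x₂' = 0 ∧ y₀' = 0 ∧ y₁' = 0 ∧ y₂' = 0 ∧ t' = 0) ∨
      (x₀' = x₀ ∧ x₁' = x₁ ∧ x₂' = x₂ ∧ y₀' = y₀ ∧ y₁' = y₁ ∧ y₂' = y₂ ∧ t' = t) := by
  rcases zmod_two_cases t with rfl | rfl
  -- Now x·y = 1, and pairing x × x' = t' y with x gives t' = 0. So x' and y' are multiples of x and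
  -- y, by the same factor because of `h6`.
  · have ht : t' = 0 := by grind
    subst ht
    simp only [zero_mul, zero_add, add_zero] at h0 h1 h2 h3 h4 h5 hq
    have e0 : x₀' = (x₀' * y₀ + x₁' * y₁ + x₂' * y₂) * x₀ := by grind
    have e1 : x₁' = (x₀' * y₀ + x₁' * y₁ + x₂' * y₂) * x₁ := by grind
    have e2 : x₂' = (x₀' * y₀ + x₁' * y₁ + x₂' * y₂) * x₂ := by grind
    have e3 : y₀' = (x₀' * y₀ + x₁' * y₁ + x₂' * y₂) * y₀ := by grind
    have e4 : y₁' = (x₀' * y₀ + x₁' * y₁ + x₂' * y₂) * y₁ := by grind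
    have e5 : y₂' = (x₀' * y₀ + x₁' * y₁ + x₂' * y₂) * y₂ := by grind
    generalize x₀' * y₀ + x₁' * y₁ + x₂' * y₂ = α at *
    rcases zmod_two_cases α with rfl | rfl
    · simp only [zero_mul] at e0 e1 e2 e3 e4 e5
      exact .inl ⟨e0, e1, e2, e3, e4, e5, rfl⟩
    · simp only [one_mul] at e0 e1 e2 e3 e4 e5
      exact .inr ⟨e0, e1, e2, e3, e4, e5, rfl⟩
  · rcases zmod_two_cases t' with rfl | rfl
    · obtain ⟨e0, e1, e2, e3, e4, e5⟩ := eq_zero_of_cross_product x₀ x₁ x₂ y₀ y₁ y₂ x₀' x₁' x₂'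
        y₀' y₁' y₂' (by grind) (by grind) (by grind) (by grind) (by grind) (by grind) (by grind) h6
      exact .inl ⟨e0, e1, e2, e3, e4, e5, rfl⟩
    -- Adding the first vector to the second reduces to t' = 0.
    · obtain ⟨e0, e1, e2, e3, e4, e5⟩ := eq_zero_of_cross_product x₀ x₁ x₂ y₀ y₁ y₂ (x₀' + x₀)
        (x₁' + x₁) (x₂' + x₂) (y₀' + y₀) (y₁' + y₁) (y₂' + y₂) (by grind) (by grind) (by grind)
        (by grind) (by grind) (by grind) (by grind) (by grind)
      simp only [CharTwo.add_eq_zero] at e0 e1 e2 e3 e4 e5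
      exact .inr ⟨e0, e1, e2, e3, e4, e5, rfl⟩

/-- Relative degree at most 2 makes T vanish on V. As x·y + z vanishes on no subspace of dimension
above 3, some v in V has value 1, and then T(v, ·, ·) has radical spanned by v. So w ↦ T(v, w, ·)
maps V into its annihilator, of dimension 7 − r, with kernel of dimension at most 1; this forces r ≤
4. -/
theorem three_le_rDegree_cubicExample {r : ℕ} (hr : 5 ≤ r) (hr' : r ≤ 7) :
    3 ≤ rDegree r cubicExample := by
  by_contra hlt
  obtain ⟨a, V, hV, h⟩ := exists_relDegree_eq hr' cubicExample
  have h0 := relDegree_le_iff.1 (show relDegree cubicExample a V ≤ 2 by omega)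
  have hC : DegLT 4 cubicExample := degLT_of_degree_le degree_cubicExample_le
  have hT : ∀ u ∈ V, ∀ v ∈ V, ∀ w ∈ V, tri cubicExample u v w = 0 := by
    intro u hu v hv w hw
    have e := congrFun (h0 ⟨w, hw⟩ ⟨v, hv⟩ ⟨u, hu⟩) 0
    rw [← hC.diff_three u v w a]
    refine Eq.trans ?_ e
    simp only [diff, Submodule.coe_add, Submodule.coe_zero, zero_add, add_assoc, add_zero]
  obtain ⟨v, hv, hq⟩ : ∃ v ∈ V, quadraticExample v = 1 := by
    by_contra hcon
    push Not at hcon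
    have hq : ∀ v ∈ V, quadraticExample v = 0 := fun v hv =>
      (zmod_two_cases _).resolve_right (hcon v hv)
    have hle := finrank_le_three_of_pairing_eq_zero (V := V) (fun n hn h3 h4 h5 v hv => by
      have e1 := hq n hn
      have e2 := hq v hv
      have e3 := hq _ (V.add_mem hv hn)
      simp only [quadraticExample_apply, Pi.add_apply, h3, h4, h5, add_zero] at e1 e2 e3
      linear_combination e3 - e2 - e1) (fun n hn h0 h1 h2 h3 h4 h5 => by
      simpa [quadraticExample_apply, h0, h1, h2] using hq n hn)
    omega
  let Φ : (Fin 7 → ZMod 2) →ₗ[ZMod 2] Module.Dual (ZMod 2) (Fin 7 → ZMod 2) :=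
    AddMonoidHom.toZModLinearMap 2 (AddMonoidHom.mk' (fun w => hC.triLin v w) fun w w' =>
      LinearMap.ext fun c => hC.tri_add_mid v w w' c)
  have hΦ (w c) : Φ w c = tri cubicExample v w c := rfl
  have h1 := finrank_map_add_finrank_inf_ker V Φ
  have h2 : V.map Φ ≤ V.dualAnnihilator := by
    rintro _ ⟨w, hw, rfl⟩
    rw [Submodule.mem_dualAnnihilator]
    exact fun c hc => hT v hv w hw c hc
  have h3 := Submodule.finrank_mono h2
  have h4 := Subspace.finrank_add_finrank_dualAnnihilator_eq V
  have h5 : V ⊓ LinearMap.ker Φ ≤ Submodule.span (ZMod 2) {v} := by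
    rintro w ⟨-, hw⟩
    have e (i : Fin 7) : tri cubicExample v w (Pi.single i 1) = 0 := by
      rw [← hΦ, LinearMap.mem_ker.1 hw]; rfl
    have e0 := e 0
    have e1 := e 1
    have e2 := e 2
    have e3 := e 3
    have e4 := e 4
    have e5 := e 5
    have e6 := e 6
    simp [tri_cubicExample] at e0 e1 e2 e3 e4 e5 e6
    rw [quadraticExample_apply] at hq
    rw [Submodule.mem_span_singleton]
    rcases eq_zero_or_eq_of_tri_cubicExample _ _ _ _ _ _ _ _ _ _ _ _ _ _ hq e0 e1 e2 e3 e4 e5 e6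
      with ⟨w0, w1, w2, w3, w4, w5, w6⟩ | ⟨w0, w1, w2, w3, w4, w5, w6⟩
    · refine ⟨0, (funext fun i => ?_)⟩
      rw [zero_smul]
      fin_cases i <;> exact Eq.symm ‹_›
    · refine ⟨1, (funext fun i => ?_)⟩
      rw [one_smul]
      fin_cases i <;> exact Eq.symm ‹_›
  have h6 := (Submodule.finrank_mono h5).trans (finrank_span_le_card _)
  rw [Module.finrank_fintype_fun_eq_card, Fintype.card_fin] at h4
  simp only [Set.toFinset_singleton, Finset.card_singleton] at h6
  omega

end Examples

end BoolFun

namespace BoolFun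

/-! ### Upper bounds and the entries of the table -/

section Upper

variable {f : (Fin 7 → ZMod 2) → ZMod 2}

theorem rDegree_eq_zero_of_degree_le (hd : degree f ≤ 3) {r : ℕ} (hr : r ≤ 3) :
    rDegree r f = 0 := by
  obtain ⟨y, v, hv, h⟩ := exists_affineOn_four hd
  obtain ⟨V, φ, hV, hφ⟩ := h.exists_submodule hv
  exact rDegree_eq_zero_of_affine (by omega) φ hφ

theorem rDegree_four_le_one (hd : degree f ≤ 3) : rDegree 4 f ≤ 1 := by
  obtain ⟨y, v, hv, h⟩ := exists_affineOn_four hd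
  obtain ⟨V, φ, hV, hφ⟩ := h.exists_submodule hv
  rw [← hV]
  exact (rDegree_le_relDegree y V).trans (relDegree_le_one_of_affine φ hφ)

theorem isNormal_or_isWeaklyNormal (hd : degree f ≤ 3) : IsNormal f ∨ IsWeaklyNormal f := by
  obtain ⟨y, v, hv, h⟩ := exists_affineOn_four hd
  obtain ⟨V, φ, hV, hφ⟩ := h.exists_submodule hv
  have hceil : ⌈((7 : ℕ) : ℚ) / 2⌉₊ = 4 := by
    rw [Nat.ceil_eq_iff (by decide)]
    norm_num
  by_cases h0 : φ = 0
  · refine .inl ⟨y, V, hV.trans hceil.symm, f y, fun w hw => ?_⟩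
    rw [hφ ⟨w, hw⟩, h0, LinearMap.zero_apply, zero_add]
  · exact .inr ⟨y, V, hV.trans hceil.symm, φ, f y, h0, hφ⟩

end Upper

theorem maxRDegree_one {r : ℕ} (hr : r ≤ 6) : maxRDegree r 1 7 = 0 :=
  maxRDegree_eq_zero (by decide) fun _ hf =>
    (degLT_of_degree_le hf.le).rDegree_eq_zero (by omega)

theorem maxRDegree_le_three {r k : ℕ} (hr : r ≤ 3) (hk : k ≤ 3) : maxRDegree r k 7 = 0 :=
  maxRDegree_eq_zero (by omega) fun _ hf => rDegree_eq_zero_of_degree_le (hf.trans_le hk) hr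

/-- The r-degree never exceeds the degree, so the bound for r = 5 already gives degree at least 2.
-/
theorem degree_quadraticExample : degree quadraticExample = 2 :=
  le_antisymm degree_quadraticExample_le
    ((two_le_rDegree_quadraticExample le_rfl (by decide)).trans (rDegree_le_degree (by decide)))

theorem degree_cubicExample : degree cubicExample = 3 :=
  le_antisymm degree_cubicExample_le
    ((three_le_rDegree_cubicExample le_rfl (by decide)).trans (rDegree_le_degree (by decide)))

theorem maxRDegree_two {r : ℕ} (hr : 5 ≤ r) (hr' : r ≤ 7) : maxRDegree r 2 7 = 2 :=
  maxRDegree_eq (by decide)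
    ⟨_, degree_quadraticExample, two_le_rDegree_quadraticExample hr hr'⟩
    fun _ hf => (rDegree_le_degree hr').trans hf.le

theorem maxRDegree_three {r : ℕ} (hr : 5 ≤ r) (hr' : r ≤ 7) : maxRDegree r 3 7 = 3 :=
  maxRDegree_eq (by decide) ⟨_, degree_cubicExample, three_le_rDegree_cubicExample hr hr'⟩
    fun _ hf => (rDegree_le_degree hr').trans hf.le

theorem maxRDegree_four_two : maxRDegree 4 2 7 = 1 :=
  maxRDegree_eq (by decide) ⟨_, degree_quadraticExample,
    one_le_rDegree_four (g := fun _ _ _ => 0) fun _ => (add_zero _).symm⟩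
    fun _ hf => rDegree_four_le_one (hf.trans_le (by decide))

theorem maxRDegree_four_three : maxRDegree 4 3 7 = 1 :=
  maxRDegree_eq (by decide) ⟨_, degree_weakExample,
    one_le_rDegree_four (g := fun x y z => x * (y * z)) fun _ => by simp [weakExample, monomial]⟩
    fun _ hf => rDegree_four_le_one hf.le

end BoolFun

theorem fact2 :
    (BoolFun.maxRDegree 6 1 7 = 0 ∧ BoolFun.maxRDegree 6 2 7 = 2 ∧ BoolFun.maxRDegree 6 3 7 = 3) ∧
    (BoolFun.maxRDegree 5 1 7 = 0 ∧ BoolFun.maxRDegree 5 2 7 = 2 ∧ BoolFun.maxRDegree 5 3 7 = 3) ∧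
    (BoolFun.maxRDegree 4 1 7 = 0 ∧ BoolFun.maxRDegree 4 2 7 = 1 ∧ BoolFun.maxRDegree 4 3 7 = 1) ∧
    (BoolFun.maxRDegree 3 1 7 = 0 ∧ BoolFun.maxRDegree 3 2 7 = 0 ∧ BoolFun.maxRDegree 3 3 7 = 0) ∧
    (BoolFun.maxRDegree 2 1 7 = 0 ∧ BoolFun.maxRDegree 2 2 7 = 0 ∧ BoolFun.maxRDegree 2 3 7 = 0) ∧
    (∀ f : (Fin 7 → ZMod 2) → ZMod 2, BoolFun.degree f ≤ 3 →
      (BoolFun.IsNormal f ∨ BoolFun.IsWeaklyNormal f) ∧ BoolFun.rDegree 4 f ≤ 1) := by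
  open BoolFun in
  exact ⟨⟨maxRDegree_one (by decide), maxRDegree_two (by decide) (by decide),
      maxRDegree_three (by decide) (by decide)⟩,
    ⟨maxRDegree_one (by decide), maxRDegree_two (by decide) (by decide),
      maxRDegree_three (by decide) (by decide)⟩,
    ⟨maxRDegree_one (by decide), maxRDegree_four_two, maxRDegree_four_three⟩,
    ⟨maxRDegree_one (by decide), maxRDegree_le_three (by decide) (by decide),
      maxRDegree_le_three (by decide) (by decide)⟩,
    ⟨maxRDegree_one (by decide), maxRDegree_le_three (by decide) (by decide),
      maxRDegree_le_three (by decide) (by decide)⟩,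
    fun _ hf => ⟨isNormal_or_isWeaklyNormal hf, rDegree_four_le_one hf⟩⟩
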